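/- **Setting.** A Boolean algebra $\mathcal B$ here is a relatively complemented distributive lattice with least element $\emptyset$ (a top element is not required); ideals are nonempty lower sets closed under finite unions. Filters of an ideal $\mathcal I$ are nonempty down-directed upper sets of $\mathcal I$ not containing $\emptyset$, ultrafilters are maximal filters, and the Stone dual $\widehat{\mathcal I}$ is the set of ultrafilters with the topology generated by the sets $\{\xi: A\in\xi\}$, $A\in\mathcal I$. A *generalized Boolean dynamical system* $(\mathcal B,\mathcal L,\theta,\mathcal I_\alpha)$ consists of a Boolean algebra $\mathcal B$, a set $\mathcal L$ and, for each $a\in\mathcal L$, a map $\theta_a:\mathcal B\to\mathcal B$ preserving $\cap,\cup,\setminus,\emptyset$ and an ideal $\mathcal I_a\subseteq\mathcal B$ with $\theta_a(\mathcal B)\subseteq\mathcal I_a$. For a word $\alpha=\alpha_1\cdots\alpha_n\in\mathcal L^*$ put $\theta_\alpha=\theta_{\alpha_n}\circ\cdots\circ\theta_{\alpha_1}$, $\mathcal I_\emptyset=\mathcal B$ and, for $n\ge1$, $\mathcal I_\alpha=\{A: A\subseteq\theta_{\alpha_2\cdots\alpha_n}(C)\text{ for some }C\in\mathcal I_{\alpha_1}\}$.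 Let $\Delta_A=\{a\in\mathcal L:\theta_a(A)\ne\emptyset\}$; $A$ is *regular* if $0<|\Delta_C|<\infty$ for all $\emptyset\ne C\subseteq A$. **The algebra and its diagonal.** A *representation* in a $C^*$-algebra consists of projections $P_A$ $(A\in\mathcal B)$ and partial isometries $S_{a,A}$ $(a\in\mathcal L, A\in\mathcal I_a)$ with (i) $P_\emptyset=0$, $P_{A\cap A'}=P_AP_{A'}$, $P_{A\cup A'}=P_A+P_{A'}-P_{A\cap A'}$; (ii) $P_AS_{a,A'}=S_{a,A'}P_{\theta_a(A)}$; (iii) $S_{a,A}^*S_{a',A'}=\delta_{a,a'}P_{A\cap A'}$; (iv) $P_A=\sum_{a\in\Delta_A}S_{a,\theta_a(A)}S_{a,\theta_a(A)}^*$ for regular $A$. Let $C^*(\mathcal B,\mathcal L,\theta,\mathcal I_\alpha)$ be the $C^*$-algebra generated by a universal representation $\{p_A,s_{a,A}\}$. Put $s_{\emptyset,A}=p_A$ and, for $\alpha=\alpha_1\cdots\alpha_n$, $n\ge1$, and $A\in\mathcal I_\alpha$, $s_{\alpha,A}=s_{\alpha_1,C}\,s_{\alpha_2,\theta_{\alpha_2}(C)}\,s_{\alpha_3,\theta_{\alpha_2\alpha_3}(C)}\cdots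 s_{\alpha_n,A}$ with any $C\in\mathcal I_{\alpha_1}$ such that $A\subseteq\theta_{\alpha_2\cdots\alpha_n}(C)$ (simply $s_{\alpha_1,A}$ if $n=1$). The *diagonal* $D$ is the $C^*$-subalgebra generated by all $s_{\alpha,A}s_{\alpha,A}^*$, $\alpha\in\mathcal L^*$, $A\in\mathcal I_\alpha$, and $\widehat D$ is its space of characters (nonzero multiplicative continuous linear functionals) with the weak$^*$ topology. **The boundary path space.** Let $E^0=\widehat{\mathcal B}$ and let $F^0=E^0\cup\{\emptyset\}$ be its one-point compactification ($\emptyset$ is isolated if $\mathcal B$ has a top element). Let $E^1=\{e^a_\eta: a\in\mathcal L,\ \eta\in\widehat{\mathcal I_a}\}\cong\bigsqcup_a\widehat{\mathcal I_a}$, and define $d:E^1\to E^0$, $d(e^a_\eta)=\{A\in\mathcal B: C\subseteq A\text{ for some }C\in\eta\}$, and $r:E^1\to F^0$, $r(e^a_\eta)=\{A\in\mathcal B:\theta_a(A)\in\eta\}$. A path of length $n$ (resp. an infinite path) is a sequence of $n\ge1$ (resp. infinitely many) edges $\mu_1\mu_2\cdots$ with $d(\mu_i)=r(\mu_{i+1})$;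 $E^n\subseteq(E^1)^n$ has the subspace topology, $E^*=\bigsqcup_{n\ge0}E^n$, and $E^\infty$ is the set of infinite paths. For $\mu=\mu_1\mu_2\cdots$ put $r(\mu)=r(\mu_1)$, for $\mu=\mu_1\cdots\mu_n$ put $d(\mu)=d(\mu_n)$, and $r(v)=d(v)=v$ for $v\in E^0$. Let $F^0_{sce}=F^0\setminus\overline{r(E^1)}$, $F^0_{fin}=\{v: r^{-1}(V)\text{ is compact for some neighbourhood }V\text{ of }v\}$, $F^0_{rg}=F^0_{fin}\setminus\overline{F^0_{sce}}$ and $E^0_{sg}=E^0\setminus F^0_{rg}$. Then $\partial E=E^\infty\sqcup\{\mu\in E^*: d(\mu)\in E^0_{sg}\}$, with the topology generated by the sets $\mathcal Z(U)\setminus\mathcal Z(K)$, $U\subseteq E^*$ open, $K\subseteq E^*$ compact, where $\mathcal Z(S)$ is the set of $\mu\in\partial E$ with $r(\mu)\in S$ or $\mu_1\cdots\mu_i\in S$ for some $1\le i\le|\mu|$. For $A\in\mathcal B$ let $\mathcal N(\emptyset,A)=\{\mu\in\partial E: A\in r(\mu)\}$; for a word $\alpha$ of length $n\ge1$ and $A\in\mathcal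 I_\alpha$ let $\mathcal N(\alpha,A)$ be the set of $\mu=e^{\beta_1}_{\eta_1}e^{\beta_2}_{\eta_2}\cdots\in\partial E$ with $|\mu|\ge n$, $\beta_1\cdots\beta_n=\alpha$ and $A\in\eta_n$. **Theorem.** Let $(\mathcal B,\mathcal L,\theta,\mathcal I_\alpha)$ be a generalized Boolean dynamical system. For each $\mu\in\partial E$ there is a unique character $\Phi(\mu)\in\widehat D$ such that, for all $\alpha\in\mathcal L^*$ and $A\in\mathcal I_\alpha$, $$\Phi(\mu)(s_{\alpha,A}s_{\alpha,A}^*)=\begin{cases}1&\text{if }\mu\in\mathcal N(\alpha,A),\\0&\text{otherwise.}\end{cases}$$ Moreover, the map $\Phi:\partial E\to\widehat D$ is a homeomorphism. Consequently $x\mapsto\big(\mu\mapsto\Phi(\mu)(x)\big)$ is a $*$-isomorphism from $D$ onto $C_0(\partial E)$. -/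

import Mathlib

open scoped ENNReal Topology ZeroAtInfty

universe u v w

/-! ### Filters, ultrafilters and Stone duals of ideals in a (generalized) Boolean algebra

A Boolean algebra here need not have a top element, so it is Mathlib's `GeneralizedBooleanAlgebra`.
An ideal (nonempty lower set closed under joins) is Mathlib's `Order.Ideal`. -/

section Stone

variable {B : Type u} [GeneralizedBooleanAlgebra B]

/-- `ξ` is a filter of the poset `J`, where `J` is an ideal of `B`: a nonempty down-directed upper
set of `J` that does not contain the least element. -/
structure IsFilterIn (J : Order.Ideal B) (ξ : Set B) : Prop where
  subset : ξ ⊆ (J : Set B)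
  nonempty : ξ.Nonempty
  bot_notMem : ⊥ ∉ ξ
  mem_of_le : ∀ a ∈ ξ, ∀ b ∈ J, a ≤ b → b ∈ ξ
  directed : ∀ a ∈ ξ, ∀ b ∈ ξ, ∃ c ∈ ξ, c ≤ a ∧ c ≤ b

/-- Ultrafilters of `J`: filters of `J` that are maximal among the filters of `J`. -/
def IsUltrafilterIn (J : Order.Ideal B) (ξ : Set B) : Prop :=
  Maximal (IsFilterIn J) ξ

/-- The Stone dual of an ideal `J` of `B` (itself a generalized Boolean algebra): the set of its
ultrafilters. -/
def StoneDual (J : Order.Ideal B) : Type u :=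
  {ξ : Set B // IsUltrafilterIn J ξ}

/-- The basic set `Z(A) = {ξ : A ∈ ξ}`. -/
def StoneDual.basic (J : Order.Ideal B) (A : B) : Set (StoneDual J) :=
  {ξ | A ∈ ξ.1}

instance StoneDual.instTopologicalSpace (J : Order.Ideal B) : TopologicalSpace (StoneDual J) :=
  TopologicalSpace.generateFrom {U | ∃ A ∈ J, U = StoneDual.basic J A}

theorem IsFilterIn.inf_mem {J : Order.Ideal B} {ξ : Set B} (h : IsFilterIn J ξ) {a b : B}
    (ha : a ∈ ξ) (hb : b ∈ ξ) : a ⊓ b ∈ ξ := by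
  obtain ⟨c, hc, hca, hcb⟩ := h.directed a ha b hb
  exact h.mem_of_le c hc _ (J.lower inf_le_left (h.subset ha)) (le_inf hca hcb)

/-- An ultrafilter that contains `b` contains one of `b ⊓ a` and `b \ a`. -/
theorem IsUltrafilterIn.inf_or_sdiff {J : Order.Ideal B} {ξ : Set B} (h : IsUltrafilterIn J ξ)
    {b : B} (hb : b ∈ ξ) (a : B) : b ⊓ a ∈ ξ ∨ b \ a ∈ ξ := by
  by_cases H : ∃ c ∈ ξ, c ⊓ (b ⊓ a) = ⊥
  · obtain ⟨c, hc, hca⟩ := H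
    right
    have hcb := h.1.inf_mem hc hb
    refine h.1.mem_of_le _ hcb _ (J.lower sdiff_le (h.1.subset hb)) ?_
    rw [le_sdiff]
    refine ⟨inf_le_right, ?_⟩
    rw [disjoint_iff, inf_assoc, hca]
  · left
    push Not at H
    have hF : IsFilterIn J {x | x ∈ J ∧ ∃ c ∈ ξ, c ⊓ (b ⊓ a) ≤ x} := by
      refine ⟨fun x hx => hx.1, ⟨b, h.1.subset hb, b, hb, inf_le_left⟩, ?_, ?_, ?_⟩
      · rintro ⟨-, c, hc, hle⟩
        exact H c hc (le_bot_iff.1 hle)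
      · rintro x ⟨-, c, hc, hle⟩ y hy hxy
        exact ⟨hy, c, hc, hle.trans hxy⟩
      · rintro x ⟨hx, c, hc, hcx⟩ y ⟨-, d, hd, hdy⟩
        refine ⟨x ⊓ y, ⟨J.lower inf_le_left hx, c ⊓ d, h.1.inf_mem hc hd, le_inf ?_ ?_⟩,
          inf_le_left, inf_le_right⟩
        · exact (inf_le_inf_right _ inf_le_left).trans hcx
        · exact (inf_le_inf_right _ inf_le_right).trans hdy
    refine h.2 hF (fun x hx => ⟨h.1.subset hx, x, hx, inf_le_left⟩) ?_
    exact ⟨J.lower inf_le_left (h.1.subset hb), b, hb, inf_le_right⟩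

/-- A filter that contains one of `b ⊓ a` and `b \ a`, for some member `b` depending on `a`, is an
ultrafilter. -/
theorem IsFilterIn.isUltrafilterIn {J : Order.Ideal B} {ξ : Set B} (h : IsFilterIn J ξ)
    (H : ∀ a ∈ J, ∃ b, b ⊓ a ∈ ξ ∨ b \ a ∈ ξ) : IsUltrafilterIn J ξ := by
  refine ⟨h, fun ζ hζ hle a ha => ?_⟩
  obtain ⟨b, hb | hb⟩ := H a (hζ.subset ha)
  · exact h.mem_of_le _ hb _ (hζ.subset ha) inf_le_right
  · exact absurd (inf_sdiff_self_right (x := a) (y := b) ▸ hζ.inf_mem ha (hle hb)) hζ.bot_notMem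

end Stone

/-! ### Generalized Boolean dynamical systems -/

/-- A generalized Boolean dynamical system `(B, L, θ, (I_a))`: for each letter `a : L` an action
`θ a` on `B` (a Boolean homomorphism preserving the least element) and an ideal `I a` of `B` that
contains the range of `θ a`. -/
structure GBDS (B : Type u) [GeneralizedBooleanAlgebra B] (L : Type v) where
  θ : L → B → B
  θ_inf : ∀ a A A', θ a (A ⊓ A') = θ a A ⊓ θ a A'
  θ_sup : ∀ a A A', θ a (A ⊔ A') = θ a A ⊔ θ a A'
  θ_sdiff : ∀ a A A', θ a (A \ A') = θ a A \ θ a A'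
  θ_bot : ∀ a, θ a ⊥ = ⊥
  I : L → Order.Ideal B
  θ_mem : ∀ a A, θ a A ∈ I a

namespace GBDS

variable {B : Type u} [GeneralizedBooleanAlgebra B] {L : Type v} (X : GBDS B L)

/-- The action of a finite word `α₁⋯αₙ`, namely `θ_{αₙ} ∘ ⋯ ∘ θ_{α₁}`. -/
def θWord : List L → B → B
  | [], A => A
  | a :: α, A => θWord α (X.θ a A)

theorem θWord_sup (α : List L) (A A' : B) :
    X.θWord α (A ⊔ A') = X.θWord α A ⊔ X.θWord α A' := by
  induction α generalizing A A' with
  | nil => rfl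
  | cons a α ih => simp only [θWord, X.θ_sup, ih]

theorem θWord_bot (α : List L) : X.θWord α ⊥ = ⊥ := by
  induction α with
  | nil => rfl
  | cons a α ih => simp only [θWord, X.θ_bot, ih]

/-- The ideal `I_α` of a finite word: `I_∅ = B`, and `I_{α₁⋯αₙ}` consists of all
`A ⊆ θ_{α₂⋯αₙ}(C)` with `C ∈ I_{α₁}`. -/
def wordIdeal : List L → Order.Ideal B
  | [] => ⊤
  | a :: α => Order.IsIdeal.toIdeal (I := {A | ∃ C ∈ X.I a, A ≤ X.θWord α C})
      { IsLowerSet := fun _ _ h ⟨C, hC, hle⟩ => ⟨C, hC, h.trans hle⟩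
        Nonempty := ⟨⊥, ⊥, Order.Ideal.bot_mem _, bot_le⟩
        Directed := fun A ⟨C, hC, hA⟩ A' ⟨C', hC', hA'⟩ =>
          ⟨A ⊔ A', ⟨C ⊔ C', Order.Ideal.sup_mem hC hC',
            (sup_le_sup hA hA').trans (X.θWord_sup α C C').ge⟩, le_sup_left, le_sup_right⟩ }

/-- `Δ_A`, the set of letters `a` with `θ_a(A) ≠ ∅`. -/
def Δ (A : B) : Set L := {a | X.θ a A ≠ ⊥}

/-- Regular elements (the least element is regular). -/
def IsRegular (A : B) : Prop := ∀ C, C ≤ A → C ≠ ⊥ → (X.Δ C).Nonempty ∧ (X.Δ C).Finite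

/-! ### Representations and the universal C⋆-algebra -/

/-- A representation of the generalized Boolean dynamical system in a C⋆-algebra `C`. -/
structure Rep (C : Type w) [NonUnitalCStarAlgebra C] where
  P : B → C
  S : (a : L) → X.I a → C
  isStarProjection_P : ∀ A, IsStarProjection (P A)
  isPartialIsometry_S : ∀ a A, S a A * star (S a A) * S a A = S a A
  P_bot : P ⊥ = 0
  P_inf : ∀ A A', P (A ⊓ A') = P A * P A'
  P_sup : ∀ A A', P (A ⊔ A') = P A + P A' - P (A ⊓ A')
  P_mul_S : ∀ A a (A' : X.I a), P A * S a A' = S a A' * P (X.θ a A)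
  star_S_mul_S : ∀ a (A A' : X.I a), star (S a A) * S a A' = P ((A : B) ⊓ (A' : B))
  star_S_mul_S_of_ne : ∀ a a' (A : X.I a) (A' : X.I a'), a ≠ a' → star (S a A) * S a' A' = 0
  P_regular : ∀ A, X.IsRegular A → ∀ F : Finset L, (F : Set L) = X.Δ A →
    P A = ∑ a ∈ F, S a ⟨X.θ a A, X.θ_mem a A⟩ * star (S a ⟨X.θ a A, X.θ_mem a A⟩)

namespace Rep

variable {X} {C : Type w} [NonUnitalCStarAlgebra C] (ρ : X.Rep C)

theorem norm_P_le (A : B) : ‖ρ.P A‖ ≤ 1 := by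
  have h := CStarRing.norm_star_mul_self (x := ρ.P A)
  rw [(ρ.isStarProjection_P A).isSelfAdjoint.star_eq,
    (ρ.isStarProjection_P A).isIdempotentElem.eq] at h
  nlinarith [norm_nonneg (ρ.P A)]

theorem norm_S_le (a : L) (A : X.I a) : ‖ρ.S a A‖ ≤ 1 := by
  have h := CStarRing.norm_star_mul_self (x := ρ.S a A)
  rw [ρ.star_S_mul_S] at h
  nlinarith [norm_nonneg (ρ.S a A), ρ.norm_P_le ((A : B) ⊓ (A : B))]

open Classical in
/-- `S_{a,A}` for `A ∈ I_a`, extended by `0` to all `A`. -/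
noncomputable def letterOp (a : L) (A : B) : C :=
  if h : A ∈ X.I a then ρ.S a ⟨A, h⟩ else 0

/-- The product `S_{α₁,D} S_{α₂,θ_{α₂}(D)} S_{α₃,θ_{α₂α₃}(D)} ⋯ S_{αₙ,A}` for the word
`α₁⋯αₙ = a α`; it is just `S_{a,A}` if `n = 1`. -/
noncomputable def pathProd : L → B → List L → B → C
  | a, _, [], A => ρ.letterOp a A
  | a, D, b :: α, A => ρ.letterOp a D * pathProd b (X.θ b D) α A

open Classical in
/-- `S_{α,A}` for a finite word `α` and `A ∈ I_α`: `S_{∅,A} = P_A`, and `S_{α₁⋯αₙ,A}` is the above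
product for some `D ∈ I_{α₁}` with `A ⊆ θ_{α₂⋯αₙ}(D)`. -/
noncomputable def wordOp : List L → B → C
  | [], A => ρ.P A
  | a :: α, A => if h : ∃ D ∈ X.I a, A ≤ X.θWord α D then ρ.pathProd a h.choose α A else 0

end Rep

/-- All representations in C⋆-algebras of the universe of `B` and `L`. This is no restriction: the
C⋆-subalgebra generated by any representation has a dense subset parametrized by polynomials in the
generators, hence has an isomorphic copy in this universe. -/
structure RepIndex where
  C : Type (max u v)
  [inst : NonUnitalCStarAlgebra C]
  rep : X.Rep C

instance (i : X.RepIndex) : NonUnitalCStarAlgebra i.C := i.inst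

/-- The C⋆-algebra of bounded families indexed by all representations. -/
abbrev AllReps : Type (max u v + 1) := lp (fun i : X.RepIndex => i.C) ∞

/-- The direct sum of all `P_A`. -/
def bigP (A : B) : X.AllReps :=
  ⟨fun i => i.rep.P A, memℓp_infty ⟨1, by rintro _ ⟨i, rfl⟩; exact i.rep.norm_P_le A⟩⟩

/-- The direct sum of all `S_{a,A}`. -/
def bigS (a : L) (A : X.I a) : X.AllReps :=
  ⟨fun i => i.rep.S a A, memℓp_infty ⟨1, by rintro _ ⟨i, rfl⟩; exact i.rep.norm_S_le a A⟩⟩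

/-- The C⋆-subalgebra generated by the direct sum of all representations. -/
noncomputable def cstarSubalgebra : NonUnitalStarSubalgebra ℂ X.AllReps :=
  (NonUnitalStarAlgebra.adjoin ℂ
    (Set.range X.bigP ∪ {x | ∃ a A, x = X.bigS a A})).topologicalClosure

/-- The C⋆-algebra `C⋆(B, L, θ, I_α)` of the system: the C⋆-algebra generated by a universal
representation, realized as the direct sum of all representations. -/
def CStarAlg : Type (max u v + 1) := ↥X.cstarSubalgebra

noncomputable instance : NonUnitalCStarAlgebra X.CStarAlg :=
  NonUnitalStarSubalgebra.nonUnitalCStarAlgebra X.cstarSubalgebra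
    (h_closed := NonUnitalStarSubalgebra.isClosed_topologicalClosure _)

theorem bigP_mem (A : B) : X.bigP A ∈ X.cstarSubalgebra :=
  NonUnitalStarSubalgebra.le_topologicalClosure _
    (NonUnitalStarAlgebra.subset_adjoin ℂ _ (Or.inl ⟨A, rfl⟩))

theorem bigS_mem (a : L) (A : X.I a) : X.bigS a A ∈ X.cstarSubalgebra :=
  NonUnitalStarSubalgebra.le_topologicalClosure _
    (NonUnitalStarAlgebra.subset_adjoin ℂ _ (Or.inr ⟨a, A, rfl⟩))

/-- The coordinate of an element of the universal C⋆-algebra at a representation. -/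
noncomputable def evalRep (i : X.RepIndex) : X.CStarAlg →⋆ₙₐ[ℂ] i.C where
  toFun x := (x.1 : ∀ i : X.RepIndex, i.C) i
  map_smul' _ _ := rfl
  map_zero' := rfl
  map_add' _ _ := rfl
  map_mul' _ _ := rfl
  map_star' _ := rfl

theorem CStarAlg.ext' {x y : X.CStarAlg} (h : ∀ i, X.evalRep i x = X.evalRep i y) : x = y :=
  Subtype.ext (lp.ext (funext h))

/-- The universal representation `{p_A, s_{a,A}}`. -/
noncomputable def univRep : X.Rep X.CStarAlg where
  P A := ⟨X.bigP A, X.bigP_mem A⟩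
  S a A := ⟨X.bigS a A, X.bigS_mem a A⟩
  isStarProjection_P A :=
    ⟨CStarAlg.ext' X fun i => (i.rep.isStarProjection_P A).isIdempotentElem,
      CStarAlg.ext' X fun i => (i.rep.isStarProjection_P A).isSelfAdjoint⟩
  isPartialIsometry_S a A := CStarAlg.ext' X fun i => i.rep.isPartialIsometry_S a A
  P_bot := CStarAlg.ext' X fun i => i.rep.P_bot
  P_inf A A' := CStarAlg.ext' X fun i => i.rep.P_inf A A'
  P_sup A A' := CStarAlg.ext' X fun i => i.rep.P_sup A A'
  P_mul_S A a A' := CStarAlg.ext' X fun i => i.rep.P_mul_S A a A'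
  star_S_mul_S a A A' := CStarAlg.ext' X fun i => i.rep.star_S_mul_S a A A'
  star_S_mul_S_of_ne a a' A A' h := CStarAlg.ext' X fun i => i.rep.star_S_mul_S_of_ne a a' A A' h
  P_regular A hA F hF := CStarAlg.ext' X fun i => by
    rw [map_sum]
    exact i.rep.P_regular A hA F hF

/-- Universality: every representation factors uniquely through the universal one. -/
theorem existsUnique_lift {C : Type (max u v)} [NonUnitalCStarAlgebra C] (ρ : X.Rep C) :
    ∃! π : X.CStarAlg →⋆ₙₐ[ℂ] C,
      (∀ A, π (X.univRep.P A) = ρ.P A) ∧ ∀ a A, π (X.univRep.S a A) = ρ.S a A := by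
  refine ⟨X.evalRep ⟨C, ρ⟩, ⟨fun _ => rfl, fun _ _ => rfl⟩, fun π hπ => ?_⟩
  have hc : ∀ σ : X.CStarAlg →⋆ₙₐ[ℂ] C, Continuous σ := fun σ =>
    AddMonoidHomClass.continuous_of_bound σ 1 fun x => by
      simpa using NonUnitalStarAlgHom.norm_apply_le σ x
  set s : Set X.AllReps := Set.range X.bigP ∪ {x | ∃ a A, x = X.bigS a A} with hs
  have key : ∀ x (hx : x ∈ NonUnitalStarAlgebra.adjoin ℂ s),
      π ⟨x, NonUnitalStarSubalgebra.le_topologicalClosure _ hx⟩ =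
        X.evalRep ⟨C, ρ⟩ ⟨x, NonUnitalStarSubalgebra.le_topologicalClosure _ hx⟩ := by
    intro x hx
    induction hx using NonUnitalStarAlgebra.adjoin_induction with
    | mem x h =>
      rcases h with ⟨A, rfl⟩ | ⟨a, A, rfl⟩
      · exact hπ.1 A
      · exact hπ.2 a A
    | add x y hx hy h1 h2 =>
      exact (map_add π ⟨x, _⟩ ⟨y, _⟩).trans ((congrArg₂ (· + ·) h1 h2).trans
        (map_add (X.evalRep ⟨C, ρ⟩) ⟨x, _⟩ ⟨y, _⟩).symm)
    | zero => exact (map_zero π).trans (map_zero (X.evalRep ⟨C, ρ⟩)).symm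
    | mul x y hx hy h1 h2 =>
      exact (map_mul π ⟨x, _⟩ ⟨y, _⟩).trans ((congrArg₂ (· * ·) h1 h2).trans
        (map_mul (X.evalRep ⟨C, ρ⟩) ⟨x, _⟩ ⟨y, _⟩).symm)
    | smul r x hx h1 =>
      exact (map_smul π r ⟨x, _⟩).trans ((congrArg (r • ·) h1).trans
        (map_smul (X.evalRep ⟨C, ρ⟩) r ⟨x, _⟩).symm)
    | star x hx h1 =>
      exact (map_star π ⟨x, _⟩).trans ((congrArg star h1).trans
        (map_star (X.evalRep ⟨C, ρ⟩) ⟨x, _⟩).symm)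
  ext ⟨x, hx⟩
  have hcl : IsClosed {y : X.CStarAlg | π y = X.evalRep ⟨C, ρ⟩ y} :=
    isClosed_eq (hc _) (hc _)
  have hd : (⟨x, hx⟩ : X.CStarAlg) ∈
      closure {y : X.CStarAlg | y.1 ∈ NonUnitalStarAlgebra.adjoin ℂ s} := by
    have hind : Topology.IsInducing (fun y : X.CStarAlg => (y.1 : X.AllReps)) :=
      Topology.IsInducing.subtypeVal
    rw [hind.closure_eq_preimage_closure_image]
    refine closure_mono ?_ hx
    intro z hz
    exact ⟨⟨z, NonUnitalStarSubalgebra.le_topologicalClosure _ hz⟩, hz, rfl⟩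
  exact closure_minimal (fun y hy => key y.1 hy) hcl hd

/-- The projection `s_{α,A} s_{α,A}⋆` of the universal C⋆-algebra. -/
noncomputable def wordProj (α : List L) (A : B) : X.CStarAlg :=
  X.univRep.wordOp α A * star (X.univRep.wordOp α A)

/-- The diagonal subalgebra `D`: the C⋆-subalgebra generated by the `s_{α,A} s_{α,A}⋆`, where `α` is
a finite word and `A ∈ I_α`. -/
noncomputable def diagonal : NonUnitalStarSubalgebra ℂ X.CStarAlg :=
  (NonUnitalStarAlgebra.adjoin ℂ
    {x | ∃ α, ∃ A ∈ X.wordIdeal α, x = X.wordProj α A}).topologicalClosure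

/-- `s_{α,A} s_{α,A}⋆` as an element of `D`. -/
noncomputable def diagProj (α : List L) (A : B) (hA : A ∈ X.wordIdeal α) : X.diagonal :=
  ⟨X.wordProj α A, NonUnitalStarSubalgebra.le_topologicalClosure _
    (NonUnitalStarAlgebra.subset_adjoin ℂ _ ⟨α, A, hA, rfl⟩)⟩

/-! ### The topological correspondence -/

/-- `E⁰`, the Stone dual of `B`. -/
abbrev E0 (_ : GBDS B L) : Type u := StoneDual (⊤ : Order.Ideal B)

/-- `F⁰ = E⁰ ∪ {∅}`: the one-point compactification of `E⁰`, whose additional point `∞` stands for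
`∅` (and is isolated if `B` has a greatest element, since `E⁰` is then compact). -/
abbrev F0 : Type u := OnePoint X.E0

/-- `E¹`, the space of edges `e^a_η` with `a : L` and `η` an ultrafilter of `I_a`; topologically, the
disjoint union of the Stone duals of the `I_a`. -/
abbrev E1 : Type (max u v) := Σ a : L, StoneDual (X.I a)

variable {X} in
theorem isUltrafilterIn_up {a : L} (η : StoneDual (X.I a)) :
    IsUltrafilterIn (⊤ : Order.Ideal B) {A | ∃ C ∈ η.1, C ≤ A} := by
  have hη := η.2.1
  refine IsFilterIn.isUltrafilterIn ⟨fun _ _ => trivial, ?_, ?_, ?_, ?_⟩ fun A _ => ?_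
  · obtain ⟨C, hC⟩ := hη.nonempty
    exact ⟨C, C, hC, le_rfl⟩
  · rintro ⟨C, hC, hle⟩
    exact hη.bot_notMem (le_bot_iff.1 hle ▸ hC)
  · rintro A ⟨C, hC, hle⟩ A' - hAA'
    exact ⟨C, hC, hle.trans hAA'⟩
  · rintro A ⟨C, hC, hle⟩ A' ⟨C', hC', hle'⟩
    exact ⟨C ⊓ C', ⟨C ⊓ C', hη.inf_mem hC hC', le_rfl⟩, inf_le_left.trans hle,
      inf_le_right.trans hle'⟩
  · obtain ⟨C, hC⟩ := hη.nonempty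
    exact ⟨C, (η.2.inf_or_sdiff hC A).imp (fun h => ⟨_, h, le_rfl⟩) fun h => ⟨_, h, le_rfl⟩⟩

variable {X} in
theorem isUltrafilterIn_preimage {a : L} (η : StoneDual (X.I a))
    (h : {A | X.θ a A ∈ η.1}.Nonempty) :
    IsUltrafilterIn (⊤ : Order.Ideal B) {A | X.θ a A ∈ η.1} := by
  have hη := η.2.1
  refine IsFilterIn.isUltrafilterIn ⟨fun _ _ => trivial, h, ?_, ?_, ?_⟩ fun A _ => ?_
  · intro hb
    exact hη.bot_notMem (X.θ_bot a ▸ hb)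
  · intro A hA A' _ hle
    refine hη.mem_of_le _ hA _ (X.θ_mem a A') ?_
    rw [← inf_eq_left, ← X.θ_inf, inf_eq_left.2 hle]
  · intro A hA A' hA'
    refine ⟨A ⊓ A', ?_, inf_le_left, inf_le_right⟩
    rw [Set.mem_ofPred_eq, X.θ_inf]
    exact hη.inf_mem hA hA'
  · obtain ⟨C, hC⟩ := h
    refine ⟨C, ?_⟩
    rw [Set.mem_ofPred_eq, Set.mem_ofPred_eq, X.θ_inf, X.θ_sdiff]
    exact η.2.inf_or_sdiff hC _

/-- `d(e^a_η)`, the upward closure of `η` in `B`. -/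
def d (e : X.E1) : X.E0 := ⟨{A | ∃ C ∈ e.2.1, C ≤ A}, isUltrafilterIn_up e.2⟩

open Classical in
/-- `r(e^a_η) = {A ∈ B : θ_a(A) ∈ η}`, which is either `∅` or an ultrafilter of `B`. -/
noncomputable def r (e : X.E1) : X.F0 :=
  if h : {A | X.θ e.1 A ∈ e.2.1}.Nonempty then
    OnePoint.some (X := X.E0) ⟨{A | X.θ e.1 A ∈ e.2.1}, isUltrafilterIn_preimage e.2 h⟩
  else OnePoint.infty

/-- The set of members of a point of `F⁰`, which is empty for `∞`. -/
def F0mem : X.F0 → Set B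
  | OnePoint.some ξ => ξ.1
  | OnePoint.infty => ∅

/-! ### Paths -/

/-- `Eⁿ`, the paths of length `n`; those of length `0` are the vertices. -/
def FinPath : ℕ → Type (max u v)
  | 0 => ULift.{v} X.E0
  | n + 1 => {p : Fin (n + 1) → X.E1 // ∀ i : Fin n, (X.d (p i.castSucc) : X.F0) = X.r (p i.succ)}

instance instTopologicalSpaceFinPath : (n : ℕ) → TopologicalSpace (X.FinPath n)
  | 0 => inferInstanceAs (TopologicalSpace (ULift.{v} X.E0))
  | n + 1 => inferInstanceAs (TopologicalSpace {p : Fin (n + 1) → X.E1 //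
      ∀ i : Fin n, (X.d (p i.castSucc) : X.F0) = X.r (p i.succ)})

/-- `E*`, the space of finite paths, with the disjoint union topology. -/
abbrev FinPaths : Type (max u v) := Σ n, X.FinPath n

/-- `E^∞`, the infinite paths. -/
def InfPath : Type (max u v) :=
  {p : ℕ → X.E1 // ∀ i, (X.d (p i) : X.F0) = X.r (p (i + 1))}

/-- `d(μ)` for a finite path `μ`. -/
def source : X.FinPaths → X.E0
  | ⟨0, v⟩ => v.down
  | ⟨n + 1, p⟩ => X.d (p.1 (Fin.last n))

/-- `F⁰_sce`. -/
def F0sce : Set X.F0 := (closure (Set.range X.r))ᶜ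

/-- `F⁰_fin`. -/
def F0fin : Set X.F0 := {v | ∃ V ∈ 𝓝 v, IsCompact (X.r ⁻¹' V)}

/-- `F⁰_rg`. -/
def F0rg : Set X.F0 := X.F0fin \ closure X.F0sce

/-- `F⁰_sg`. -/
def F0sg : Set X.F0 := (X.F0rg)ᶜ

/-- `E⁰_sg = F⁰_sg ∩ E⁰`. -/
def E0sg : Set X.E0 := {v | (v : X.F0) ∈ X.F0sg}

/-- The boundary path space `∂E`: the infinite paths and the finite paths `μ` with
`d(μ) ∈ E⁰_sg`. -/
def BoundaryPath : Type (max u v) := X.InfPath ⊕ {μ : X.FinPaths // X.source μ ∈ X.E0sg}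

namespace BoundaryPath

variable {X}

/-- `r(μ) ∈ F⁰`. -/
noncomputable def range : X.BoundaryPath → X.F0
  | Sum.inl p => X.r (p.1 0)
  | Sum.inr ⟨⟨0, v⟩, _⟩ => (v.down : X.F0)
  | Sum.inr ⟨⟨_ + 1, p⟩, _⟩ => X.r (p.1 0)

/-- The edge of `μ` with (zero-based) index `i`, if `i < |μ|`. -/
def edge? : X.BoundaryPath → ℕ → Option X.E1
  | Sum.inl p, i => some (p.1 i)
  | Sum.inr ⟨⟨0, _⟩, _⟩, _ => none
  | Sum.inr ⟨⟨n + 1, p⟩, _⟩, i => if h : i < n + 1 then some (p.1 ⟨i, h⟩) else none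

end BoundaryPath

/-- `𝒵(S)` for `S ⊆ E*`: the boundary paths `μ` such that `r(μ) ∈ S` or some initial segment
`μ_{[1,i]}` with `1 ≤ i ≤ |μ|` belongs to `S`. -/
def cyl (S : Set X.FinPaths) : Set X.BoundaryPath :=
  {μ | (∃ v : X.E0, μ.range = (v : X.F0) ∧ (⟨0, ULift.up v⟩ : X.FinPaths) ∈ S) ∨
    ∃ (n : ℕ) (p : X.FinPath (n + 1)), (⟨n + 1, p⟩ : X.FinPaths) ∈ S ∧
      ∀ j : Fin (n + 1), μ.edge? j = some (p.1 j)}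

instance : TopologicalSpace X.BoundaryPath :=
  TopologicalSpace.generateFrom
    {W | ∃ U K : Set X.FinPaths, IsOpen U ∧ IsCompact K ∧ W = X.cyl U ∩ (X.cyl K)ᶜ}

/-- `𝒩(α, A)`. For `α = ∅` it is `{μ : A ∈ r(μ)}`; for a word `α` of length `n ≥ 1` it consists of
the boundary paths `e^{β₁}_{η₁} e^{β₂}_{η₂} ⋯` of length at least `n` with `β₁⋯βₙ = α` and
`A ∈ ηₙ`. -/
def N : List L → B → Set X.BoundaryPath
  | [], A => {μ | A ∈ X.F0mem μ.range}
  | a :: α, A => {μ | ∃ e : Fin (α.length + 1) → X.E1, (∀ j : Fin (α.length + 1), μ.edge? j = some (e j)) ∧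
      (∀ j, (e j).1 = (a :: α).get j) ∧ A ∈ (e (Fin.last α.length)).2.1}

end GBDS

/-! A character of `D` takes only the values 0 and 1 on the generating projections and is determined
by them. It therefore amounts to a family of sets of Boolean elements, one for each word `α`: those
`A` with value 1 at `s_{α,A} s_{α,A}⋆`. The structure `Spec` axiomatizes such families, and the
proof identifies it with both sides of the theorem.

From characters to `Spec`: the axioms are the multiplication rules of the projections
(`Rep.wordQ_mul_wordQ_append`, `Rep.wordQ_mul_wordQ_of_not_prefix`, `Rep.wordQ_sup`) and relation
(iv) transported along a word (`Rep.wordQ_regular`). Back from `Spec` to characters, one must know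
that the defining relations impose nothing more. The system is represented on `ℓ²` of the set
`Spec`, where `S_{a,A}` prepends a letter (`Spec.rep`). There `D` acts by multiplication operators
(`Spec.wordQ_rep`), so evaluation at a point is multiplicative (`Spec.vecFunctional_eq`).
Faithfulness of this representation is not needed.

From paths to `Spec`: a boundary path records which sets `𝒩(α, A)` contain it. Conversely, the words
with nonempty value form a chain of prefixes, and the value at each nonempty word generates the
ultrafilter of one edge. The axiom `regular` says that the path can stop only at a vertex containing
no regular set, and by `mem_E0sg_iff` these vertices are exactly `E⁰_sg`.

For the topologies, the sets `finCyl α A` with `A ∈ I_α` are compact and open and form a base of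
`E*` (`isCompact_finCyl`, `exists_finCyl_subset`). Hence the topology of `∂E` is the one in which
the sets `𝒩(α, A)` and their complements are open, and these correspond to the sets of characters
with value 1 or 0 at a generator. The last assertion is Gelfand duality for algebras without unit,
deduced from the unital case through the unitization. -/

namespace GBDS

/-! ### Word actions and word ideals. -/

section Words

variable {B : Type u} [GeneralizedBooleanAlgebra B] {L : Type v} (X : GBDS B L)

theorem θ_mono (a : L) {A A' : B} (h : A ≤ A') : X.θ a A ≤ X.θ a A' := by
  rw [← inf_eq_left, ← X.θ_inf, inf_eq_left.2 h]

theorem θWord_inf (α : List L) (A A' : B) :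
    X.θWord α (A ⊓ A') = X.θWord α A ⊓ X.θWord α A' := by
  induction α generalizing A A' with
  | nil => rfl
  | cons a α ih => simp only [θWord, X.θ_inf, ih]

theorem θWord_mono (α : List L) {A A' : B} (h : A ≤ A') : X.θWord α A ≤ X.θWord α A' := by
  rw [← inf_eq_left, ← X.θWord_inf, inf_eq_left.2 h]

theorem θWord_append (α β : List L) (A : B) :
    X.θWord (α ++ β) A = X.θWord β (X.θWord α A) := by
  induction α generalizing A with
  | nil => rfl
  | cons a α ih => exact ih _

theorem mem_wordIdeal_nil (A : B) : A ∈ X.wordIdeal [] := trivial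

theorem mem_wordIdeal_singleton {a : L} {A : B} : A ∈ X.wordIdeal [a] ↔ A ∈ X.I a :=
  ⟨fun ⟨_, hC, h⟩ => (X.I a).lower h hC, fun h => ⟨A, h, le_rfl⟩⟩

theorem wordIdeal_mono {α : List L} {A A' : B} (h : A ≤ A') (h' : A' ∈ X.wordIdeal α) :
    A ∈ X.wordIdeal α := (X.wordIdeal α).lower h h'

theorem mem_wordIdeal_of_cons {a : L} {α : List L} {A : B} (h : A ∈ X.wordIdeal (a :: α)) :
    A ∈ X.wordIdeal α := by
  cases α with
  | nil => trivial
  | cons b α =>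
    obtain ⟨C, -, hA⟩ := h
    exact ⟨X.θ b C, X.θ_mem b C, hA⟩

theorem mem_wordIdeal_of_append {α β : List L} {A : B} (h : A ∈ X.wordIdeal (α ++ β)) :
    A ∈ X.wordIdeal β := by
  induction α with
  | nil => exact h
  | cons a α ih => exact ih (X.mem_wordIdeal_of_cons h)

theorem mem_I_of_mem_wordIdeal {α : List L} {b : L} {A : B} (h : A ∈ X.wordIdeal (α ++ [b])) :
    A ∈ X.I b := X.mem_wordIdeal_singleton.1 (X.mem_wordIdeal_of_append h)

theorem θWord_mem_wordIdeal {α : List L} (β : List L) {A : B} (h : A ∈ X.wordIdeal α) :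
    X.θWord β A ∈ X.wordIdeal (α ++ β) := by
  cases α with
  | nil =>
    cases β with
    | nil => trivial
    | cons b β => exact ⟨X.θ b A, X.θ_mem b A, le_rfl⟩
  | cons a α =>
    obtain ⟨C, hC, hA⟩ := h
    exact ⟨C, hC, (X.θWord_mono β hA).trans (X.θWord_append α β C).ge⟩

theorem θ_mem_wordIdeal {α : List L} (b : L) {A : B} (h : A ∈ X.wordIdeal α) :
    X.θ b A ∈ X.wordIdeal (α ++ [b]) := X.θWord_mem_wordIdeal [b] h

/-- The empty word must be excluded: an element of `I_b` need not lie below any `θ_b(C)`. This is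
why `r(μ)` can be the point `∞`. -/
theorem exists_le_θWord {α β : List L} (hα : α ≠ []) {A : B} (h : A ∈ X.wordIdeal (α ++ β)) :
    ∃ C ∈ X.wordIdeal α, A ≤ X.θWord β C := by
  cases α with
  | nil => exact absurd rfl hα
  | cons a α =>
    obtain ⟨C, hC, hA⟩ := h
    exact ⟨X.θWord α C, ⟨C, hC, le_rfl⟩, hA.trans (X.θWord_append α β C).le⟩

theorem exists_le_θWord_of_cons {a : L} {α : List L} {A : B} (h : A ∈ X.wordIdeal (a :: α)) :
    ∃ D, ∃ _ : D ∈ X.I a, A ≤ X.θWord α D :=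
  let ⟨D, hD, hA⟩ := h
  ⟨D, hD, hA⟩

theorem IsRegular.mono {A A' : B} (h : A ≤ A') (h' : X.IsRegular A') : X.IsRegular A :=
  fun C hC => h' C (hC.trans h)

end Words

/-! ### Calculus of the operators `S_{α,A}` and their range projections. -/

theorem eq_of_star_mul_eq {C : Type w} [NonUnitalCStarAlgebra C] {x y p : C}
    (h1 : star x * x = p) (h2 : star x * y = p) (h3 : star y * x = p) (h4 : star y * y = p) :
    x = y := by
  -- C⋆-identity for `x - y`: the four terms of `(x - y)⋆ (x - y)` cancel.
  rw [← sub_eq_zero, ← CStarRing.star_mul_self_eq_zero_iff, star_sub, sub_mul, mul_sub, mul_sub,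
    h1, h2, h3, h4]
  simp

namespace Rep

variable {B : Type u} [GeneralizedBooleanAlgebra B] {L : Type v} {X : GBDS B L}
  {C : Type w} [NonUnitalCStarAlgebra C] (ρ : X.Rep C)

theorem star_P (A : B) : star (ρ.P A) = ρ.P A := (ρ.isStarProjection_P A).isSelfAdjoint.star_eq

theorem S_mul_P (a : L) {A : B} (hA : A ∈ X.I a) (D : B) :
    ρ.S a ⟨A, hA⟩ * ρ.P D = ρ.S a ⟨A ⊓ D, (X.I a).lower inf_le_left hA⟩ := by
  refine eq_of_star_mul_eq (p := ρ.P (A ⊓ D)) ?_ ?_ ?_ ?_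
  · rw [star_mul, star_P, mul_assoc, ← mul_assoc (star _), star_S_mul_S, ← P_inf, ← P_inf]
    congr 1; simp
  · rw [star_mul, star_P, mul_assoc, star_S_mul_S, ← P_inf]
    congr 1; simp
  · rw [← mul_assoc, star_S_mul_S, ← P_inf]
    congr 1; simp
  · rw [star_S_mul_S, inf_idem]

theorem letterOp_of_mem {a : L} {A : B} (h : A ∈ X.I a) : ρ.letterOp a A = ρ.S a ⟨A, h⟩ :=
  dif_pos h

theorem pathProd_mul_P {a : L} {D : B} (hD : D ∈ X.I a) {α : List L} {A : B}
    (hA : A ≤ X.θWord α D) (E : B) :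
    ρ.pathProd a D α A * ρ.P E = ρ.pathProd a D α (A ⊓ E) := by
  induction α generalizing a D with
  | nil =>
    have h : A ∈ X.I a := (X.I a).lower hA hD
    rw [pathProd, pathProd, ρ.letterOp_of_mem h, S_mul_P, ρ.letterOp_of_mem]
  | cons b α ih => rw [pathProd, pathProd, mul_assoc, ih (X.θ_mem b D) hA]

theorem P_mul_pathProd {a : L} {D : B} (hD : D ∈ X.I a) {α : List L} {A : B}
    (hA : A ≤ X.θWord α D) (E : B) :
    ρ.P E * ρ.pathProd a D α A = ρ.pathProd a D α A * ρ.P (X.θWord (a :: α) E) := by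
  induction α generalizing a D E with
  | nil =>
    have h : A ∈ X.I a := (X.I a).lower hA hD
    rw [pathProd, ρ.letterOp_of_mem h, P_mul_S]
    rfl
  | cons b α ih =>
    rw [pathProd, ← mul_assoc, ρ.letterOp_of_mem hD, P_mul_S, mul_assoc, ih (X.θ_mem b D) hA,
      mul_assoc]
    rfl

/-- The inner factor `P_{D ⊓ D'}` moves to the right through the remaining product and only cuts
`A'` by `θ_α(D ⊓ D')`; since `A ≤ θ_α(D)` and `A' ≤ θ_α(D')`, the cut disappears in `A ⊓ A'`. -/
theorem star_pathProd_mul {a : L} {D D' : B} (hD : D ∈ X.I a) (hD' : D' ∈ X.I a) {α : List L}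
    {A A' : B} (hA : A ≤ X.θWord α D) (hA' : A' ≤ X.θWord α D') :
    star (ρ.pathProd a D α A) * ρ.pathProd a D' α A' = ρ.P (A ⊓ A') := by
  induction α generalizing a D D' A A' with
  | nil =>
    have h : A ∈ X.I a := (X.I a).lower hA hD
    have h' : A' ∈ X.I a := (X.I a).lower hA' hD'
    rw [pathProd, pathProd, ρ.letterOp_of_mem h, ρ.letterOp_of_mem h', star_S_mul_S]
  | cons b α ih =>
    rw [pathProd, pathProd, ρ.letterOp_of_mem hD, ρ.letterOp_of_mem hD', star_mul, mul_assoc,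
      ← mul_assoc (star (ρ.S a _)), star_S_mul_S, ρ.P_mul_pathProd (X.θ_mem b D') hA',
      ρ.pathProd_mul_P (X.θ_mem b D') hA',
      ih (X.θ_mem b D) (X.θ_mem b D') hA (inf_le_left.trans hA'), X.θWord_inf, ← inf_assoc]
    congr 1
    refine inf_eq_left.2 (le_inf (inf_le_left.trans hA) (inf_le_right.trans hA'))

/-- All four products of an adjoint with an operator are `P_A`. Hence `wordOp` does not depend on
the element chosen in its definition. -/
theorem pathProd_congr {a : L} {D D' : B} (hD : D ∈ X.I a) (hD' : D' ∈ X.I a) {α : List L}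
    {A : B} (hA : A ≤ X.θWord α D) (hA' : A ≤ X.θWord α D') :
    ρ.pathProd a D α A = ρ.pathProd a D' α A :=
  eq_of_star_mul_eq (ρ.star_pathProd_mul hD hD hA hA) (ρ.star_pathProd_mul hD hD' hA hA')
    (ρ.star_pathProd_mul hD' hD hA' hA) (ρ.star_pathProd_mul hD' hD' hA' hA')

theorem wordOp_nil (A : B) : ρ.wordOp [] A = ρ.P A := rfl

theorem wordOp_eq_pathProd {a : L} {D : B} (hD : D ∈ X.I a) {α : List L} {A : B}
    (hA : A ≤ X.θWord α D) : ρ.wordOp (a :: α) A = ρ.pathProd a D α A := by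
  have h : ∃ D ∈ X.I a, A ≤ X.θWord α D := ⟨D, hD, hA⟩
  rw [wordOp, dif_pos h]
  exact ρ.pathProd_congr h.choose_spec.1 hD h.choose_spec.2 hA

/-- Any admissible `D` may be used for the first letter, which lets two words share the same `D`;
inductions on words rest on this. -/
theorem wordOp_cons {a : L} {D : B} (hD : D ∈ X.I a) {α : List L} {A : B}
    (hA : A ≤ X.θWord α D) : ρ.wordOp (a :: α) A = ρ.S a ⟨D, hD⟩ * ρ.wordOp α A := by
  cases α with
  | nil =>
    have h : A ∈ X.I a := (X.I a).lower hA hD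
    rw [ρ.wordOp_eq_pathProd hD hA, pathProd, wordOp, S_mul_P, ρ.letterOp_of_mem h]
    congr 2
    exact (inf_eq_right.2 hA).symm
  | cons b α =>
    rw [ρ.wordOp_eq_pathProd hD hA, ρ.wordOp_eq_pathProd (X.θ_mem b D) hA, pathProd,
      ρ.letterOp_of_mem hD]

theorem wordOp_mul_P {α : List L} {A : B} (hA : A ∈ X.wordIdeal α) (E : B) :
    ρ.wordOp α A * ρ.P E = ρ.wordOp α (A ⊓ E) := by
  cases α with
  | nil => exact (ρ.P_inf _ _).symm
  | cons a α =>
    obtain ⟨D, hD, hA⟩ := hA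
    rw [ρ.wordOp_eq_pathProd hD hA, ρ.pathProd_mul_P hD hA,
      ρ.wordOp_eq_pathProd hD (inf_le_left.trans hA)]

theorem P_mul_wordOp {α : List L} {A : B} (hA : A ∈ X.wordIdeal α) (E : B) :
    ρ.P E * ρ.wordOp α A = ρ.wordOp α (A ⊓ X.θWord α E) := by
  rw [← ρ.wordOp_mul_P hA]
  cases α with
  | nil => rw [wordOp_nil, ← P_inf, ← P_inf, inf_comm]; rfl
  | cons a α =>
    obtain ⟨D, hD, hA⟩ := hA
    rw [ρ.wordOp_eq_pathProd hD hA, ρ.P_mul_pathProd hD hA]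

theorem wordOp_mul_S {α : List L} {A : B} (hA : A ∈ X.wordIdeal α) (b : L) :
    ρ.wordOp α A * ρ.S b ⟨X.θ b A, X.θ_mem b A⟩ = ρ.wordOp (α ++ [b]) (X.θ b A) := by
  induction α with
  | nil =>
    rw [List.nil_append, ρ.wordOp_eq_pathProd (α := []) (A := X.θ b A) (X.θ_mem b A) le_rfl,
      pathProd, ρ.letterOp_of_mem (X.θ_mem b A), wordOp_nil, P_mul_S, S_mul_P]
    congr 2
    exact inf_idem _
  | cons a α ih =>
    have h := X.mem_wordIdeal_of_cons hA
    obtain ⟨D, hD, hA⟩ := hA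
    rw [ρ.wordOp_cons hD hA, mul_assoc, ih h, List.cons_append, ρ.wordOp_cons hD]
    rw [X.θWord_append]
    exact X.θWord_mono [b] hA

/-- The projection `S_{α,A} S_{α,A}⋆`. -/
noncomputable def wordQ (α : List L) (A : B) : C := ρ.wordOp α A * star (ρ.wordOp α A)

theorem star_wordQ (α : List L) (A : B) : star (ρ.wordQ α A) = ρ.wordQ α A := by
  rw [wordQ, star_mul, star_star]

theorem wordQ_nil (A : B) : ρ.wordQ [] A = ρ.P A := by
  rw [wordQ, wordOp_nil, star_P, ← P_inf, inf_idem]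

theorem wordQ_cons {a : L} {D : B} (hD : D ∈ X.I a) {α : List L} {A : B}
    (hA : A ≤ X.θWord α D) :
    ρ.wordQ (a :: α) A = ρ.S a ⟨D, hD⟩ * ρ.wordQ α A * star (ρ.S a ⟨D, hD⟩) := by
  rw [wordQ, ρ.wordOp_cons hD hA, star_mul, wordQ]
  simp only [mul_assoc]

theorem P_mul_wordQ {α : List L} {A : B} (hA : A ∈ X.wordIdeal α) (E : B) :
    ρ.P E * ρ.wordQ α A = ρ.wordQ α (A ⊓ X.θWord α E) := by
  have h : A ⊓ X.θWord α E ∈ X.wordIdeal α := X.wordIdeal_mono inf_le_left hA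
  rw [wordQ, ← mul_assoc, ρ.P_mul_wordOp hA, wordQ, ← ρ.wordOp_mul_P hA, star_mul, star_P,
    mul_assoc, mul_assoc, ← mul_assoc (ρ.P _), ← P_inf, inf_idem]

theorem wordQ_mul_wordQ_append {α β : List L} {A A' : B} (hA : A ∈ X.wordIdeal α)
    (hA' : A' ∈ X.wordIdeal (α ++ β)) :
    ρ.wordQ α A * ρ.wordQ (α ++ β) A' = ρ.wordQ (α ++ β) (A' ⊓ X.θWord β A) := by
  induction α with
  | nil => rw [wordQ_nil]; exact ρ.P_mul_wordQ hA' A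
  | cons a α ih =>
    have h := X.mem_wordIdeal_of_cons hA
    have h' : A' ∈ X.wordIdeal (α ++ β) := X.mem_wordIdeal_of_cons hA'
    obtain ⟨D₁, hD₁, hA⟩ := hA
    obtain ⟨D₂, hD₂, hA' : A' ≤ X.θWord (α ++ β) D₂⟩ := hA'
    -- The join is admissible for both factors, so the same partial isometry is split off from each.
    have hD : D₁ ⊔ D₂ ∈ X.I a := Order.Ideal.sup_mem hD₁ hD₂
    replace hA := hA.trans (X.θWord_mono _ (le_sup_left : D₁ ≤ D₁ ⊔ D₂))
    replace hA' := hA'.trans (X.θWord_mono _ (le_sup_right : D₂ ≤ D₁ ⊔ D₂))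
    rw [List.cons_append, ρ.wordQ_cons hD hA, ρ.wordQ_cons hD hA',
      ρ.wordQ_cons hD (inf_le_left.trans hA'), ← ih h h']
    simp only [mul_assoc]
    rw [← mul_assoc (star (ρ.S a _)) (ρ.S a _), star_S_mul_S, inf_idem, ← mul_assoc (ρ.P _),
      ρ.P_mul_wordQ h', inf_eq_left.2 hA']

theorem wordQ_mul_wordQ {α : List L} {A A' : B} (hA : A ∈ X.wordIdeal α)
    (hA' : A' ∈ X.wordIdeal α) : ρ.wordQ α A * ρ.wordQ α A' = ρ.wordQ α (A' ⊓ A) := by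
  have := ρ.wordQ_mul_wordQ_append (β := []) hA (by rwa [List.append_nil])
  rwa [List.append_nil] at this

theorem wordQ_mul_wordQ_of_not_prefix {α β : List L} {A A' : B} (hA : A ∈ X.wordIdeal α)
    (hA' : A' ∈ X.wordIdeal β) (h1 : ¬ α <+: β) (h2 : ¬ β <+: α) :
    ρ.wordQ α A * ρ.wordQ β A' = 0 := by
  induction α generalizing β A' with
  | nil => exact absurd (List.nil_prefix) h1
  | cons a α ih =>
    cases β with
    | nil => exact absurd (List.nil_prefix) h2
    | cons b β =>
      have h := X.mem_wordIdeal_of_cons hA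
      have h' := X.mem_wordIdeal_of_cons hA'
      obtain ⟨D₁, hD₁, hA⟩ := hA
      obtain ⟨D₂, hD₂, hA'⟩ := hA'
      rw [ρ.wordQ_cons hD₁ hA, ρ.wordQ_cons hD₂ hA']
      simp only [mul_assoc]
      rw [← mul_assoc (star (ρ.S a _)) (ρ.S b _)]
      -- For equal first letters the middle factor `P_{D₁ ⊓ D₂}` is absorbed by shrinking `A'`, and
      -- the induction hypothesis applies to the shrunken set. For different letters the middle
      -- factor is zero.
      by_cases hab : a = b
      · subst hab
        have H := @ih β _ h (X.wordIdeal_mono (inf_le_left : A' ⊓ X.θWord β (D₁ ⊓ D₂) ≤ A') h')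
          (fun H => h1 (List.cons_prefix_cons.2 ⟨rfl, H⟩))
          (fun H => h2 (List.cons_prefix_cons.2 ⟨rfl, H⟩))
        rw [star_S_mul_S, ← mul_assoc (ρ.P _), ρ.P_mul_wordQ h', ← mul_assoc (ρ.wordQ α A),
          H]
        simp
      · rw [ρ.star_S_mul_S_of_ne _ _ _ _ hab]
        simp

/-- For comparable words the product is again a self-adjoint `wordQ`, so taking adjoints exchanges
the factors; for incomparable words both products vanish. -/
theorem wordQ_commute {α β : List L} {A A' : B} (hA : A ∈ X.wordIdeal α)
    (hA' : A' ∈ X.wordIdeal β) : ρ.wordQ α A * ρ.wordQ β A' = ρ.wordQ β A' * ρ.wordQ α A := by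
  have key : ∀ {γ δ : List L} {E E' : B}, E ∈ X.wordIdeal γ → E' ∈ X.wordIdeal δ → γ <+: δ →
      ρ.wordQ γ E * ρ.wordQ δ E' = ρ.wordQ δ E' * ρ.wordQ γ E := by
    rintro γ δ E E' hE hE' ⟨β, rfl⟩
    have h := ρ.wordQ_mul_wordQ_append hE hE'
    have h' := congrArg star h
    rw [star_mul, star_wordQ, star_wordQ, star_wordQ] at h'
    rw [h, h']
  by_cases h1 : α <+: β
  · exact key hA hA' h1
  by_cases h2 : β <+: α
  · exact (key hA' hA h2).symm
  rw [ρ.wordQ_mul_wordQ_of_not_prefix hA hA' h1 h2, ρ.wordQ_mul_wordQ_of_not_prefix hA' hA h2 h1]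

/-- Below a fixed `A`, `wordQ α` is conjugation of `P` by one operator. Linear relations among the
`P_E`, such as `P_sup` and `P_regular`, thus pass to every word. -/
theorem wordOp_mul_P_mul_star {α : List L} {A : B} (hA : A ∈ X.wordIdeal α) {E : B} (hE : E ≤ A) :
    ρ.wordOp α A * ρ.P E * star (ρ.wordOp α A) = ρ.wordQ α E := by
  have h : ρ.wordOp α E = ρ.wordOp α A * ρ.P E := by
    rw [ρ.wordOp_mul_P hA, inf_eq_right.2 hE]
  rw [wordQ, h, star_mul, star_P, mul_assoc, mul_assoc, ← mul_assoc (ρ.P E) (ρ.P E),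
    ← P_inf, inf_idem]

theorem wordQ_bot (α : List L) : ρ.wordQ α ⊥ = 0 := by
  rw [← ρ.wordOp_mul_P_mul_star (A := ⊥) (Order.Ideal.bot_mem _) le_rfl, P_bot]
  simp

theorem wordQ_sup {α : List L} {A A' : B} (hA : A ∈ X.wordIdeal α) (hA' : A' ∈ X.wordIdeal α) :
    ρ.wordQ α (A ⊔ A') = ρ.wordQ α A + ρ.wordQ α A' - ρ.wordQ α (A ⊓ A') := by
  have h : A ⊔ A' ∈ X.wordIdeal α := Order.Ideal.sup_mem hA hA'
  rw [← ρ.wordOp_mul_P_mul_star h le_rfl, ← ρ.wordOp_mul_P_mul_star h le_sup_left,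
    ← ρ.wordOp_mul_P_mul_star h le_sup_right,
    ← ρ.wordOp_mul_P_mul_star h (inf_le_left.trans le_sup_left), P_sup, mul_sub, mul_add, sub_mul,
    add_mul]

theorem wordQ_regular {α : List L} {A : B} (hA : A ∈ X.wordIdeal α) (hreg : X.IsRegular A)
    {F : Finset L} (hF : (F : Set L) = X.Δ A) :
    ρ.wordQ α A = ∑ b ∈ F, ρ.wordQ (α ++ [b]) (X.θ b A) := by
  rw [← ρ.wordOp_mul_P_mul_star hA le_rfl, ρ.P_regular A hreg F hF, Finset.mul_sum, Finset.sum_mul]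
  refine Finset.sum_congr rfl fun b _ => ?_
  rw [wordQ, ← ρ.wordOp_mul_S hA, star_mul]
  simp only [mul_assoc]

end Rep

end GBDS

/-! ### Operators on `ℓ²` given by partial bijections and indicators. -/

section PEquivOperators

variable {ι : Type u}

/-- Distinct indices have distinct images, so the nonzero terms are those of a partial sum for `x`
itself. -/
theorem PEquiv.sum_elim_rpow_le (f : ι ≃. ι) (x : lp (fun _ : ι => ℂ) 2) (s : Finset ι) :
    ∑ i ∈ s, ‖(f i).elim (0 : ℂ) x‖ ^ (2 : ℝ≥0∞).toReal ≤ ‖x‖ ^ (2 : ℝ≥0∞).toReal := by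
  classical
  have hinj : ∀ a a' : ι, ∀ b ∈ f a, b ∈ f a' → a = a' := fun a a' b h h' => f.inj h h'
  calc ∑ i ∈ s, ‖(f i).elim (0 : ℂ) x‖ ^ (2 : ℝ≥0∞).toReal
      = ∑ j ∈ s.filterMap f hinj, ‖x j‖ ^ (2 : ℝ≥0∞).toReal := by
        symm
        refine Finset.sum_bij_ne_zero (fun j hj _ => (Finset.mem_filterMap f).1 hj |>.choose)
          ?_ ?_ ?_ ?_
        · intro j hj _
          exact ((Finset.mem_filterMap f).1 hj).choose_spec.1
        · intro j hj _ j' hj' _ h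
          have h1 := ((Finset.mem_filterMap f).1 hj).choose_spec.2
          have h2 := ((Finset.mem_filterMap f).1 hj').choose_spec.2
          rw [h, h2] at h1
          exact (Option.some.inj h1).symm
        · intro i hi hne
          rcases hfi : f i with _ | j
          · simp [hfi] at hne
          · have hj : j ∈ s.filterMap f hinj := (Finset.mem_filterMap f).2 ⟨i, hi, hfi⟩
            refine ⟨j, hj, by simpa [hfi] using hne, ?_⟩
            exact hinj _ _ j ((Finset.mem_filterMap f).1 hj).choose_spec.2 hfi
        · intro j hj _
          rw [((Finset.mem_filterMap f).1 hj).choose_spec.2]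
          rfl
    _ ≤ _ := lp.sum_rpow_le_norm_rpow (by norm_num) x _

/-- The partial isometry on `ℓ²(ι)` that sends the basis vector at `i` to the one at `f i`. -/
noncomputable def PEquiv.toOp (f : ι ≃. ι) :
    lp (fun _ : ι => ℂ) 2 →L[ℂ] lp (fun _ : ι => ℂ) 2 :=
  LinearMap.mkContinuous
    { toFun := fun x => ⟨fun i => (f.symm i).elim 0 x,
        memℓp_gen' fun s => f.symm.sum_elim_rpow_le x s⟩
      map_add' := fun x y => lp.ext (funext fun i => by
        change (f.symm i).elim 0 (⇑x + ⇑y) = (f.symm i).elim 0 ⇑x + (f.symm i).elim 0 ⇑y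
        rcases f.symm i with _ | j <;> simp)
      map_smul' := fun c x => lp.ext (funext fun i => by
        rcases h : f.symm i with _ | j <;> simp [h]) }
    1 fun x => by
      rw [one_mul]
      exact lp.norm_le_of_forall_sum_le (by norm_num) (norm_nonneg x)
        fun s => f.symm.sum_elim_rpow_le x s

theorem PEquiv.toOp_apply (f : ι ≃. ι) (x : lp (fun _ : ι => ℂ) 2) (i : ι) :
    f.toOp x i = (f.symm i).elim 0 x := rfl

/-- Both inner products are the same sum over the graph of `f`, indexed by its two projections. -/
theorem PEquiv.star_toOp (f : ι ≃. ι) : star f.toOp = f.symm.toOp := by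
  rw [ContinuousLinearMap.star_eq_adjoint, eq_comm, ContinuousLinearMap.eq_adjoint_iff]
  intro x y
  rw [lp.inner_eq_tsum, lp.inner_eq_tsum]
  simp only [toOp_apply, PEquiv.symm_symm]
  have hs : ∀ j : Function.support fun j => inner ℂ (x j) ((f.symm j).elim (0 : ℂ) y),
      (f.symm j).isSome := fun j => by
    by_contra h
    refine j.2 ?_
    rw [Option.not_isSome_iff_eq_none] at h
    simp [h]
  refine tsum_eq_tsum_of_ne_zero_bij (fun j => (f.symm j).get (hs j)) ?_ ?_ ?_
  · intro j j' h
    have h1 : (f.symm j).get (hs j) ∈ f.symm j := Option.get_mem _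
    have h2 : (f.symm j').get (hs j') ∈ f.symm j' := Option.get_mem _
    simp only at h
    rw [h] at h1
    exact Subtype.ext (f.symm.inj h1 h2)
  · intro i hi
    rcases hfi : f i with _ | j
    · simp [hfi] at hi
    · have hj : f.symm j = some i := (f.eq_some_iff).2 hfi
      refine ⟨⟨j, ?_⟩, ?_⟩
      · simpa [hj, hfi] using hi
      · simp [hj]
  · intro j
    have h1 : (f.symm j).get (hs j) ∈ f.symm j := Option.get_mem _
    have h2 : f ((f.symm j).get (hs j)) = some j.1 := f.eq_some_iff.1 h1
    rw [h2]
    conv_rhs => rw [Option.mem_def.1 h1]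
    rfl

open Classical in
/-- The projection of `ℓ²(ι)` onto the functions supported in `s`. -/
noncomputable def indOp (s : Set ι) : lp (fun _ : ι => ℂ) 2 →L[ℂ] lp (fun _ : ι => ℂ) 2 :=
  (PEquiv.ofSet s).toOp

theorem indOp_apply_of_mem {s : Set ι} {i : ι} (h : i ∈ s) (x : lp (fun _ : ι => ℂ) 2) :
    indOp s x i = x i := by
  classical
  rw [indOp, PEquiv.toOp_apply, PEquiv.ofSet_symm, PEquiv.ofSet_eq_some_self_iff.2 h]
  rfl

theorem indOp_apply_of_notMem {s : Set ι} {i : ι} (h : i ∉ s) (x : lp (fun _ : ι => ℂ) 2) :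
    indOp s x i = 0 := by
  classical
  have : PEquiv.ofSet s i = none := by
    rw [Option.eq_none_iff_forall_ne_some]
    intro j hj
    obtain ⟨h1, h2⟩ := PEquiv.ofSet_eq_some_iff.1 hj
    exact h (h1 ▸ h2)
  rw [indOp, PEquiv.toOp_apply, PEquiv.ofSet_symm, this]
  rfl

theorem indOp_mul (s t : Set ι) : indOp s * indOp t = indOp (s ∩ t) := by
  refine ContinuousLinearMap.ext fun x => lp.ext (funext fun i => ?_)
  change indOp s (indOp t x) i = _
  by_cases hs : i ∈ s
  · rw [indOp_apply_of_mem hs]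
    by_cases ht : i ∈ t
    · rw [indOp_apply_of_mem ht, indOp_apply_of_mem (s := s ∩ t) ⟨hs, ht⟩]
    · rw [indOp_apply_of_notMem ht, indOp_apply_of_notMem (s := s ∩ t) fun h => ht h.2]
  · rw [indOp_apply_of_notMem hs, indOp_apply_of_notMem (s := s ∩ t) fun h => hs h.1]

theorem isStarProjection_indOp (s : Set ι) : IsStarProjection (indOp s) := by
  refine ⟨?_, ?_⟩
  · change indOp s * indOp s = indOp s
    rw [indOp_mul, Set.inter_self]
  · change star (indOp s) = indOp s
    rw [indOp, PEquiv.star_toOp, PEquiv.ofSet_symm]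

theorem indOp_empty : indOp (∅ : Set ι) = 0 :=
  ContinuousLinearMap.ext fun x => lp.ext (funext fun i =>
    indOp_apply_of_notMem (Set.notMem_empty i) x)

theorem indOp_univ : indOp (Set.univ : Set ι) = 1 :=
  ContinuousLinearMap.ext fun x => lp.ext (funext fun i => indOp_apply_of_mem (Set.mem_univ i) x)

theorem indOp_union_add_inter (s t : Set ι) :
    indOp (s ∪ t) + indOp (s ∩ t) = indOp s + indOp t := by
  refine ContinuousLinearMap.ext fun x => lp.ext (funext fun i => ?_)
  change indOp (s ∪ t) x i + indOp (s ∩ t) x i = indOp s x i + indOp t x i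
  by_cases hs : i ∈ s <;> by_cases ht : i ∈ t
  · rw [indOp_apply_of_mem hs, indOp_apply_of_mem ht, indOp_apply_of_mem (s := s ∪ t) (Or.inl hs),
      indOp_apply_of_mem (s := s ∩ t) ⟨hs, ht⟩]
  · rw [indOp_apply_of_mem hs, indOp_apply_of_notMem ht,
      indOp_apply_of_mem (s := s ∪ t) (Or.inl hs),
      indOp_apply_of_notMem (s := s ∩ t) fun h => ht h.2]
  · rw [indOp_apply_of_notMem hs, indOp_apply_of_mem ht,
      indOp_apply_of_mem (s := s ∪ t) (Or.inr ht),
      indOp_apply_of_notMem (s := s ∩ t) fun h => hs h.1, add_comm]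
  · rw [indOp_apply_of_notMem hs, indOp_apply_of_notMem ht,
      indOp_apply_of_notMem (s := s ∪ t) fun h => h.elim hs ht,
      indOp_apply_of_notMem (s := s ∩ t) fun h => hs h.1]

theorem indOp_biUnion {κ : Type v} (F : Finset κ) (s : κ → Set ι)
    (hs : ∀ b b' i, i ∈ s b → i ∈ s b' → b = b') :
    indOp (⋃ b ∈ F, s b) = ∑ b ∈ F, indOp (s b) := by
  classical
  induction F using Finset.induction_on with
  | empty => simp [indOp_empty]
  | insert b F hb ih =>
    rw [Finset.sum_insert hb, ← ih, Finset.set_biUnion_insert, ← indOp_union_add_inter,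
      show s b ∩ ⋃ b' ∈ F, s b' = ∅ from Set.eq_empty_of_forall_notMem ?_, indOp_empty, add_zero]
    rintro i ⟨hi, hi'⟩
    simp only [Set.mem_iUnion] at hi'
    obtain ⟨b', hb', hi'⟩ := hi'
    exact hb (hs _ _ _ hi hi' ▸ hb')

/-- Conjugating an indicator operator by a partial bijection. -/
theorem PEquiv.toOp_mul_indOp_mul_star (f : ι ≃. ι) {s t : Set ι}
    (h : ∀ i, i ∈ t ↔ ∃ j ∈ f.symm i, j ∈ s) : f.toOp * indOp s * star f.toOp = indOp t := by
  refine ContinuousLinearMap.ext fun x => lp.ext (funext fun i => ?_)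
  rw [PEquiv.star_toOp]
  change f.toOp (indOp s (f.symm.toOp x)) i = _
  rw [PEquiv.toOp_apply]
  by_cases hi : i ∈ t
  · obtain ⟨j, hj, hjs⟩ := (h i).1 hi
    rw [indOp_apply_of_mem hi, Option.mem_def.1 hj, Option.elim_some, indOp_apply_of_mem hjs,
      PEquiv.toOp_apply, PEquiv.symm_symm, f.eq_some_iff.1 hj]
    rfl
  · rw [indOp_apply_of_notMem hi]
    rcases hfi : f.symm i with _ | j
    · rfl
    · exact indOp_apply_of_notMem (fun hj => hi ((h i).2 ⟨j, hfi, hj⟩)) _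

theorem PEquiv.toOp_mul_star (f : ι ≃. ι) {t : Set ι} (h : ∀ i, i ∈ t ↔ ∃ j, j ∈ f.symm i) :
    f.toOp * star f.toOp = indOp t := by
  rw [← f.toOp_mul_indOp_mul_star (s := Set.univ) (t := t) (by simpa using h), indOp_univ, mul_one]

theorem PEquiv.toOp_mul_star_mul (f : ι ≃. ι) : f.toOp * star f.toOp * f.toOp = f.toOp := by
  rw [f.toOp_mul_star (t := {i | ∃ j, j ∈ f.symm i}) fun _ => Iff.rfl]
  refine ContinuousLinearMap.ext fun x => lp.ext (funext fun i => ?_)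
  change indOp _ (f.toOp x) i = _
  by_cases hi : i ∈ {i | ∃ j, j ∈ f.symm i}
  · rw [indOp_apply_of_mem hi]
  · rw [indOp_apply_of_notMem hi, PEquiv.toOp_apply,
      Option.eq_none_iff_forall_not_mem.2 fun j hj => hi ⟨j, hj⟩]
    rfl

theorem PEquiv.indOp_mul_toOp (f : ι ≃. ι) {s t : Set ι}
    (h : ∀ i, ∀ j ∈ f i, (j ∈ s ↔ i ∈ t)) : indOp s * f.toOp = f.toOp * indOp t := by
  refine ContinuousLinearMap.ext fun x => lp.ext (funext fun j => ?_)
  change indOp s (f.toOp x) j = f.toOp (indOp t x) j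
  rw [PEquiv.toOp_apply f (indOp t x)]
  rcases hfj : f.symm j with _ | i
  · by_cases hj : j ∈ s
    · rw [indOp_apply_of_mem hj, PEquiv.toOp_apply, hfj]
      rfl
    · rw [indOp_apply_of_notMem hj]
      rfl
  · have hi := h i j (f.eq_some_iff.1 hfj)
    rw [Option.elim_some]
    by_cases hj : j ∈ s
    · rw [indOp_apply_of_mem hj, PEquiv.toOp_apply, hfj, indOp_apply_of_mem (hi.1 hj)]
      rfl
    · rw [indOp_apply_of_notMem hj, indOp_apply_of_notMem fun h => hj (hi.2 h)]

/-- Serves relation (iii) for equal letters and, with `t = ∅`, for different ones. -/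
theorem PEquiv.star_toOp_mul_toOp (f g : ι ≃. ι) {t : Set ι}
    (h1 : ∀ i ∈ t, ∃ j ∈ f i, j ∈ g i) (h2 : ∀ i i' j, j ∈ f i → j ∈ g i' → i = i' ∧ i ∈ t) :
    star f.toOp * g.toOp = indOp t := by
  refine ContinuousLinearMap.ext fun x => lp.ext (funext fun i => ?_)
  rw [PEquiv.star_toOp]
  change f.symm.toOp (g.toOp x) i = _
  rw [PEquiv.toOp_apply, PEquiv.symm_symm]
  by_cases hi : i ∈ t
  · obtain ⟨j, hj, hj'⟩ := h1 i hi
    rw [indOp_apply_of_mem hi, Option.mem_def.1 hj, Option.elim_some, PEquiv.toOp_apply,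
      g.eq_some_iff.2 hj']
    rfl
  · rw [indOp_apply_of_notMem hi]
    rcases hfi : f i with _ | j
    · rfl
    · have hgj : g.symm j = none := Option.eq_none_iff_forall_not_mem.2 fun i' hi' =>
        hi (h2 i i' j hfi (g.eq_some_iff.1 hi')).2
      rw [Option.elim_some, PEquiv.toOp_apply, hgj]
      rfl

end PEquivOperators

/-! ### The combinatorial spectrum and the representation on its `ℓ²` space. -/

namespace GBDS

variable {B : Type u} [GeneralizedBooleanAlgebra B] {L : Type v} (X : GBDS B L)

/-- The combinatorial spectrum of the diagonal: a point assigns to each word `α` the set of those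
`A` in `I_α` on whose projections `s_{α,A} s_{α,A}⋆` a given character takes the value `1`. -/
@[ext]
structure Spec where
  mem : List L → Set B
  mem_wordIdeal : ∀ {α A}, A ∈ mem α → A ∈ X.wordIdeal α
  bot_notMem : ∀ α, ⊥ ∉ mem α
  upper : ∀ {α A A'}, A ∈ mem α → A' ∈ X.wordIdeal α → A ≤ A' → A' ∈ mem α
  inf : ∀ {α A A'}, A ∈ mem α → A' ∈ mem α → A ⊓ A' ∈ mem α
  prime : ∀ {α A A'}, A ⊔ A' ∈ mem α → A ∈ mem α ∨ A' ∈ mem α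
  -- The product rule for a word and its prefix: once the value at `(α b, A')` is 1, the value at
  -- `(α, A)` equals that at `A' ⊓ θ_b(A)`.
  letter : ∀ {α b A A'}, A ∈ X.wordIdeal α → A' ∈ mem (α ++ [b]) →
    (A ∈ mem α ↔ A' ⊓ X.θ b A ∈ mem (α ++ [b]))
  letter_unique : ∀ {α b b' A A'}, A ∈ mem (α ++ [b]) → A' ∈ mem (α ++ [b']) → b = b'
  -- Relation (iv): a finite sum of projections with value 1 has a summand with nonzero value.
  regular : ∀ {α A}, A ∈ mem α → X.IsRegular A → ∃ b, X.θ b A ∈ mem (α ++ [b])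
  nonempty : ∃ α A, A ∈ mem α

namespace Spec

variable {X} (w : X.Spec)

/-- The letters of `β` are removed from the right, one application of `letter` for each. -/
theorem upper_of_append {α β : List L} {A A' : B} (hA : A ∈ X.wordIdeal α)
    (hA' : A' ∈ w.mem (α ++ β)) (h : A' ≤ X.θWord β A) : A ∈ w.mem α := by
  induction β using List.reverseRecOn generalizing A' with
  | nil =>
    rw [List.append_nil] at hA'
    exact w.upper hA' hA h
  | append_singleton β b ih =>
    rw [← List.append_assoc] at hA'
    have hm := X.θWord_mem_wordIdeal β hA
    refine ih ((w.letter hm hA').2 ?_) le_rfl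
    rw [X.θWord_append] at h
    rwa [inf_eq_left.2 (show A' ≤ X.θ b (X.θWord β A) from h)]

theorem θWord_inf_mem {α β : List L} {A A' : B} (hA : A ∈ w.mem α)
    (hA' : A' ∈ w.mem (α ++ β)) : A' ⊓ X.θWord β A ∈ w.mem (α ++ β) := by
  induction β using List.reverseRecOn generalizing A' with
  | nil =>
    rw [List.append_nil] at hA' ⊢
    exact w.inf hA' hA
  | append_singleton β b ih =>
    rw [← List.append_assoc] at hA' ⊢
    have hm := X.θWord_mem_wordIdeal β (w.mem_wordIdeal hA)
    rw [X.θWord_append]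
    refine (w.letter hm hA').1 ?_
    -- `letter` requires `θ_β(A)` in the value at `α ++ β`, where no element is given. If the word
    -- is nonempty, `E` supplies one and the induction hypothesis applies to it.
    by_cases hα : α ++ β = []
    · rw [List.append_eq_nil_iff] at hα
      obtain ⟨rfl, rfl⟩ := hα
      exact hA
    · obtain ⟨E, hE, hle⟩ := X.exists_le_θWord hα (w.mem_wordIdeal hA')
      have hE' : E ∈ w.mem (α ++ β) := w.upper_of_append hE hA' hle
      exact w.upper (ih hE') hm inf_le_right

theorem nonempty_of_append {α β : List L} (hα : α ≠ []) {A : B} (hA : A ∈ w.mem (α ++ β)) :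
    ∃ E ∈ w.mem α, A ≤ X.θWord β E := by
  obtain ⟨E, hE, hle⟩ := X.exists_le_θWord hα (w.mem_wordIdeal hA)
  exact ⟨E, w.upper_of_append hE hA hle, hle⟩

theorem prefix_or_prefix {α β : List L} {A A' : B} (hA : A ∈ w.mem α) (hA' : A' ∈ w.mem β) :
    α <+: β ∨ β <+: α := by
  -- The common prefix `γ` grows along the induction, so that `letter_unique` can compare the next
  -- two letters.
  suffices H : ∀ γ α β : List L, ∀ A A', A ∈ w.mem (γ ++ α) → A' ∈ w.mem (γ ++ β) →
      α <+: β ∨ β <+: α from H [] α β A A' hA hA'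
  intro γ α β A A' hA hA'
  induction α generalizing γ β with
  | nil => exact Or.inl List.nil_prefix
  | cons a α ih =>
    cases β with
    | nil => exact Or.inr List.nil_prefix
    | cons b β =>
      rw [List.append_cons] at hA hA'
      obtain ⟨E, hE, -⟩ := w.nonempty_of_append (by simp) hA
      obtain ⟨E', hE', -⟩ := w.nonempty_of_append (by simp) hA'
      obtain rfl := w.letter_unique hE hE'
      exact (ih _ β hA hA').imp (fun h => List.cons_prefix_cons.2 ⟨rfl, h⟩)
        fun h => List.cons_prefix_cons.2 ⟨rfl, h⟩

theorem sup_mem_iff {α : List L} {A A' : B} (hA : A ∈ X.wordIdeal α) (hA' : A' ∈ X.wordIdeal α) :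
    A ⊔ A' ∈ w.mem α ↔ A ∈ w.mem α ∨ A' ∈ w.mem α :=
  ⟨w.prime, fun h => h.elim (fun h => w.upper h (Order.Ideal.sup_mem hA hA') le_sup_left)
    fun h => w.upper h (Order.Ideal.sup_mem hA hA') le_sup_right⟩

theorem inf_mem_iff {α : List L} {A A' : B} (hA : A ∈ X.wordIdeal α) (hA' : A' ∈ X.wordIdeal α) :
    A ⊓ A' ∈ w.mem α ↔ A ∈ w.mem α ∧ A' ∈ w.mem α :=
  ⟨fun h => ⟨w.upper h hA inf_le_left, w.upper h hA' inf_le_right⟩, fun h => w.inf h.1 h.2⟩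

/-- The point of the spectrum obtained by prepending the letter `a`. -/
def cons (a : L) (h : ∃ D ∈ X.I a, D ∈ w.mem []) : X.Spec where
  mem
    | [] => {A | X.θ a A ∈ w.mem []}
    -- `I_{bα}` can be strictly smaller than `I_α`, so its membership is imposed separately; `tail`
    -- undoes this by upward closure.
    | b :: α => {A | b = a ∧ A ∈ w.mem α ∧ A ∈ X.wordIdeal (b :: α)}
  mem_wordIdeal := by
    rintro (_ | ⟨b, α⟩) A hA
    · trivial
    · exact hA.2.2
  bot_notMem := by
    rintro (_ | ⟨b, α⟩) hA
    · rw [Set.mem_ofPred_eq, X.θ_bot] at hA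
      exact w.bot_notMem _ hA
    · exact w.bot_notMem _ hA.2.1
  upper := by
    rintro (_ | ⟨b, α⟩) A A' hA hA' hle
    · exact w.upper hA trivial (X.θ_mono a hle)
    · exact ⟨hA.1, w.upper hA.2.1 (X.mem_wordIdeal_of_cons hA') hle, hA'⟩
  inf := by
    rintro (_ | ⟨b, α⟩) A A' hA hA'
    · rw [Set.mem_ofPred_eq, X.θ_inf]
      exact w.inf hA hA'
    · exact ⟨hA.1, w.inf hA.2.1 hA'.2.1, X.wordIdeal_mono inf_le_left hA.2.2⟩
  prime := by
    rintro (_ | ⟨b, α⟩) A A' hA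
    · rw [Set.mem_ofPred_eq, X.θ_sup] at hA
      exact w.prime hA
    · exact (w.prime hA.2.1).imp (fun h => ⟨hA.1, h, X.wordIdeal_mono le_sup_left hA.2.2⟩)
        fun h => ⟨hA.1, h, X.wordIdeal_mono le_sup_right hA.2.2⟩
  letter := by
    rintro (_ | ⟨b, α⟩) c A A' hA hA'
    · obtain ⟨rfl, h1, h2⟩ := hA'
      have hθ : X.θ c A ∈ X.wordIdeal [] := trivial
      refine ⟨fun h => ⟨rfl, w.inf h1 h, X.wordIdeal_mono inf_le_left h2⟩, fun h => ?_⟩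
      exact w.upper h.2.1 hθ inf_le_right
    · obtain ⟨rfl, h1, h2⟩ := hA'
      have hle := X.mem_wordIdeal_of_cons hA
      refine ⟨fun h => ⟨rfl, (w.letter hle h1).1 h.2.1, X.wordIdeal_mono inf_le_left h2⟩,
        fun h => ⟨rfl, (w.letter hle h1).2 h.2.1, hA⟩⟩
  letter_unique := by
    rintro (_ | ⟨b, α⟩) c c' A A' hA hA'
    · exact hA.1.trans hA'.1.symm
    · exact w.letter_unique hA.2.1 hA'.2.1
  regular := by
    rintro (_ | ⟨b, α⟩) A hA hreg
    · exact ⟨a, rfl, hA, X.mem_wordIdeal_singleton.2 (X.θ_mem a A)⟩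
    · obtain ⟨c, hc⟩ := w.regular hA.2.1 hreg
      exact ⟨c, hA.1, hc, X.θ_mem_wordIdeal c hA.2.2⟩
  nonempty := by
    obtain ⟨D, hD, hDw⟩ := h
    exact ⟨[a], D, rfl, hDw, X.mem_wordIdeal_singleton.2 hD⟩

theorem mem_cons_nil {a : L} (h : ∃ D ∈ X.I a, D ∈ w.mem []) {A : B} :
    A ∈ (w.cons a h).mem [] ↔ X.θ a A ∈ w.mem [] := Iff.rfl

theorem mem_cons_cons {a b : L} (h : ∃ D ∈ X.I a, D ∈ w.mem []) {α : List L} {A : B} :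
    A ∈ (w.cons a h).mem (b :: α) ↔ b = a ∧ A ∈ w.mem α ∧ A ∈ X.wordIdeal (b :: α) := Iff.rfl

/-- The point of the spectrum obtained by removing the first letter `a`. -/
def tail (a : L) (h : ∃ A, A ∈ w.mem [a]) : X.Spec where
  mem α := {A | A ∈ X.wordIdeal α ∧ ∃ C ∈ w.mem (a :: α), C ≤ A}
  mem_wordIdeal hA := hA.1
  bot_notMem := by
    rintro α ⟨-, C, hC, hle⟩
    exact w.bot_notMem _ (le_bot_iff.1 hle ▸ hC)
  upper := by
    rintro α A A' ⟨-, C, hC, hle⟩ hA' hAA'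
    exact ⟨hA', C, hC, hle.trans hAA'⟩
  inf := by
    rintro α A A' ⟨hA, C, hC, hle⟩ ⟨hA', C', hC', hle'⟩
    exact ⟨X.wordIdeal_mono inf_le_left hA, C ⊓ C', w.inf hC hC', inf_le_inf hle hle'⟩
  prime := by
    rintro α A A' ⟨hA, C, hC, hle⟩
    have hC' : C ⊓ A ⊔ C ⊓ A' ∈ w.mem (a :: α) := by
      rwa [← inf_sup_left, inf_eq_left.2 hle]
    exact (w.prime hC').imp
      (fun h => ⟨X.wordIdeal_mono le_sup_left hA, _, h, inf_le_right⟩)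
      fun h => ⟨X.wordIdeal_mono le_sup_right hA, _, h, inf_le_right⟩
  letter := by
    rintro α b A A' hA ⟨hA', C', hC', hle'⟩
    refine ⟨?_, ?_⟩
    · rintro ⟨-, C, hC, hle⟩
      exact ⟨X.wordIdeal_mono inf_le_left hA', _, w.θWord_inf_mem (β := [b]) hC hC',
        inf_le_inf hle' (X.θ_mono b hle)⟩
    · rintro ⟨-, C, hC, hle⟩
      obtain ⟨E, hE, hCE⟩ := w.nonempty_of_append (α := a :: α) (β := [b]) (by simp) hC
      have hAE : E ⊓ A ∈ X.wordIdeal (a :: α) :=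
        X.wordIdeal_mono inf_le_left (w.mem_wordIdeal hE)
      refine ⟨hA, E ⊓ A, w.upper_of_append (β := [b]) hAE hC ?_, inf_le_right⟩
      rw [X.θWord_inf]
      exact le_inf hCE (hle.trans inf_le_right)
  letter_unique := by
    rintro α b b' A A' ⟨-, C, hC, -⟩ ⟨-, C', hC', -⟩
    exact w.letter_unique (α := a :: α) hC hC'
  regular := by
    rintro α A ⟨hA, C, hC, hle⟩ hreg
    obtain ⟨b, hb⟩ := w.regular hC (IsRegular.mono X hle hreg)
    exact ⟨b, X.θ_mem_wordIdeal b hA, _, hb, X.θ_mono b hle⟩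
  nonempty := by
    obtain ⟨C, hC⟩ := h
    exact ⟨[], C, trivial, C, hC, le_rfl⟩

theorem mem_tail {a : L} (h : ∃ A, A ∈ w.mem [a]) {α : List L} {A : B} :
    A ∈ (w.tail a h).mem α ↔ A ∈ X.wordIdeal α ∧ ∃ C ∈ w.mem (a :: α), C ≤ A := Iff.rfl

theorem mem_tail_nil {a : L} (h : ∃ A, A ∈ w.mem [a]) {A : B} (hA : A ∈ X.I a) :
    A ∈ (w.tail a h).mem [] ↔ A ∈ w.mem [a] :=
  ⟨fun ⟨_, _, hC, hle⟩ => w.upper hC (X.mem_wordIdeal_singleton.2 hA) hle,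
    fun h => ⟨trivial, A, h, le_rfl⟩⟩

theorem tail_cons {a : L} (h : ∃ D ∈ X.I a, D ∈ w.mem [])
    (h' : ∃ A, A ∈ (w.cons a h).mem [a]) : (w.cons a h).tail a h' = w := by
  refine Spec.ext (funext fun α => Set.ext fun A => ?_)
  rw [mem_tail]
  refine ⟨?_, fun hA => ⟨w.mem_wordIdeal hA, ?_⟩⟩
  · rintro ⟨hA, C, hC, hle⟩
    exact w.upper hC.2.1 hA hle
  · obtain ⟨D, hD, hDw⟩ := h
    -- `A` itself need not lie in `I_{aα}`, but its meet with `θ_α(D)` does, as `D ∈ I_a`.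
    exact ⟨A ⊓ X.θWord α D, ⟨rfl, w.θWord_inf_mem (α := []) hDw hA, D, hD, inf_le_right⟩,
      inf_le_left⟩

theorem cons_tail {a : L} (h : ∃ A, A ∈ w.mem [a])
    (h' : ∃ D ∈ X.I a, D ∈ (w.tail a h).mem []) : (w.tail a h).cons a h' = w := by
  refine Spec.ext (funext fun α => Set.ext fun A => ?_)
  obtain ⟨E, hE⟩ := h
  cases α with
  | nil =>
    rw [mem_cons_nil, w.mem_tail_nil _ (X.θ_mem a A), w.letter (α := []) (b := a) trivial hE]
    exact ⟨fun h => w.inf hE h,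
      fun h => w.upper h (X.mem_wordIdeal_singleton.2 (X.θ_mem a A)) inf_le_right⟩
  | cons b α =>
    rw [mem_cons_cons, mem_tail]
    refine ⟨?_, fun hA => ?_⟩
    · rintro ⟨rfl, ⟨-, C, hC, hle⟩, hA⟩
      exact w.upper hC hA hle
    · obtain rfl : b = a := by
        rcases w.prefix_or_prefix hE hA with h | h
        · exact (List.cons_prefix_cons.1 h).1.symm
        · exact (List.cons_prefix_cons.1 h).1
      have hI := w.mem_wordIdeal hA
      exact ⟨rfl, ⟨X.mem_wordIdeal_of_cons hI, A, hA, le_rfl⟩, hI⟩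

open Classical in
/-- The partial bijection of the spectrum that prepends `a` to the points over `A ∈ I_a`. -/
noncomputable def consPEquiv (a : L) (A : X.I a) : X.Spec ≃. X.Spec where
  toFun w := if h : (A : B) ∈ w.mem [] then some (w.cons a ⟨A, A.2, h⟩) else none
  invFun w := if h : (A : B) ∈ w.mem [a] then some (w.tail a ⟨A, h⟩) else none
  inv w w' := by
    constructor
    · intro h
      split_ifs at h with hA
      · obtain rfl := Option.some.inj h
        have h1 : (A : B) ∈ (w'.tail a ⟨A, hA⟩).mem [] := (w'.mem_tail_nil _ A.2).2 hA
        rw [dif_pos h1]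
        exact congrArg some (w'.cons_tail _ _)
    · intro h
      split_ifs at h with hA
      · obtain rfl := Option.some.inj h
        have h1 : (A : B) ∈ (w.cons a ⟨A, A.2, hA⟩).mem [a] :=
          ⟨rfl, hA, X.mem_wordIdeal_singleton.2 A.2⟩
        rw [dif_pos h1]
        exact congrArg some (w.tail_cons _ _)

open Classical in
theorem mem_consPEquiv {a : L} {A : X.I a} {w w' : X.Spec} :
    w' ∈ consPEquiv a A w ↔ ∃ h : (A : B) ∈ w.mem [], w' = w.cons a ⟨A, A.2, h⟩ := by
  change w' ∈ (if h : (A : B) ∈ w.mem [] then some (w.cons a ⟨A, A.2, h⟩) else none) ↔ _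
  split_ifs with h
  · exact ⟨fun h' => ⟨h, (Option.some.inj h').symm⟩, fun ⟨_, h'⟩ => h' ▸ rfl⟩
  · exact ⟨fun h' => absurd h' (by simp), fun ⟨h', _⟩ => absurd h' h⟩

open Classical in
theorem mem_consPEquiv_symm {a : L} {A : X.I a} {w w' : X.Spec} :
    w' ∈ (consPEquiv a A).symm w ↔ ∃ h : (A : B) ∈ w.mem [a], w' = w.tail a ⟨A, h⟩ := by
  change w' ∈ (if h : (A : B) ∈ w.mem [a] then some (w.tail a ⟨A, h⟩) else none) ↔ _
  split_ifs with h
  · exact ⟨fun h' => ⟨h, (Option.some.inj h').symm⟩, fun ⟨_, h'⟩ => h' ▸ rfl⟩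
  · exact ⟨fun h' => absurd h' (by simp), fun ⟨h', _⟩ => absurd h' h⟩

/-- A point determines its first letter, and its tail recovers the point before prepending. So
ranges meet only for equal letters, as relation (iii) demands. -/
theorem eq_of_mem_consPEquiv {a a' : L} {A : X.I a} {A' : X.I a'} {w w' z : X.Spec}
    (h : z ∈ consPEquiv a A w) (h' : z ∈ consPEquiv a' A' w') :
    a = a' ∧ w = w' ∧ (A : B) ∈ w.mem [] ∧ (A' : B) ∈ w.mem [] := by
  obtain ⟨hA, hz⟩ := mem_consPEquiv.1 h
  obtain ⟨hA', hz'⟩ := mem_consPEquiv.1 h'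
  have h1 : (A : B) ∈ z.mem [a] := by
    rw [hz]
    exact ⟨rfl, hA, X.mem_wordIdeal_singleton.2 A.2⟩
  obtain rfl : a = a' := by
    rw [hz'] at h1
    exact h1.1
  have hw := w.tail_cons ⟨A, A.2, hA⟩ (hz ▸ ⟨A, h1⟩)
  have hw' := w'.tail_cons ⟨A', A'.2, hA'⟩ (hz' ▸ ⟨A, h1⟩)
  have : w = w' := by
    rw [← hw, ← hw']
    congr 1
    exact hz.symm.trans hz'
  subst this
  exact ⟨rfl, rfl, hA, hA'⟩

variable (X) in
/-- The representation on `ℓ²` of the spectrum, in which `P_A` is multiplication by the indicator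
of `A` and `S_{a,A}` prepends the letter `a`. -/
noncomputable def rep :
    X.Rep (lp (fun _ : X.Spec => ℂ) 2 →L[ℂ] lp (fun _ : X.Spec => ℂ) 2) where
  P A := indOp {w | A ∈ w.mem []}
  S a A := (consPEquiv a A).toOp
  isStarProjection_P A := isStarProjection_indOp _
  isPartialIsometry_S a A := PEquiv.toOp_mul_star_mul _
  P_bot := by
    rw [show {w : X.Spec | ⊥ ∈ w.mem []} = ∅ from
      Set.eq_empty_of_forall_notMem fun w h => w.bot_notMem _ h, indOp_empty]
  P_inf A A' := by
    rw [indOp_mul]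
    congr 1
    exact Set.ext fun w => w.inf_mem_iff trivial trivial
  P_sup A A' := by
    have h1 : {w : X.Spec | A ⊔ A' ∈ w.mem []} = {w | A ∈ w.mem []} ∪ {w | A' ∈ w.mem []} :=
      Set.ext fun w => w.sup_mem_iff trivial trivial
    have h2 : {w : X.Spec | A ⊓ A' ∈ w.mem []} = {w | A ∈ w.mem []} ∩ {w | A' ∈ w.mem []} :=
      Set.ext fun w => w.inf_mem_iff trivial trivial
    rw [h1, h2, eq_sub_iff_add_eq, indOp_union_add_inter]
  P_mul_S A a A' := by
    refine PEquiv.indOp_mul_toOp _ fun w w' hw' => ?_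
    obtain ⟨h, rfl⟩ := mem_consPEquiv.1 hw'
    exact Iff.rfl
  star_S_mul_S a A A' := by
    refine PEquiv.star_toOp_mul_toOp _ _ (fun w hw => ?_) fun w w' z hz hz' => ?_
    · have h := (w.inf_mem_iff (α := []) trivial trivial).1 hw
      exact ⟨_, mem_consPEquiv.2 ⟨h.1, rfl⟩, mem_consPEquiv.2 ⟨h.2, rfl⟩⟩
    · obtain ⟨-, h, h1, h2⟩ := eq_of_mem_consPEquiv hz hz'
      exact ⟨h, w.inf h1 h2⟩
  star_S_mul_S_of_ne a a' A A' h := by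
    rw [← indOp_empty]
    exact PEquiv.star_toOp_mul_toOp _ _ (fun w hw => absurd hw (Set.notMem_empty w))
      fun w w' z hz hz' => absurd (eq_of_mem_consPEquiv hz hz').1 h
  P_regular A hA F hF := by
    -- The range of `S_{b,θ_b(A)}` consists of the points with `θ_b(A)` in the value at `[b]`. These
    -- sets are disjoint by `letter_unique` and cover the points over `A` by `regular`.
    have h : ∀ b, (consPEquiv b ⟨X.θ b A, X.θ_mem b A⟩).toOp *
        star (consPEquiv b ⟨X.θ b A, X.θ_mem b A⟩).toOp =
        indOp {w : X.Spec | X.θ b A ∈ w.mem [b]} := fun b => by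
      refine PEquiv.toOp_mul_star _ fun w => ⟨fun hw => ⟨_, mem_consPEquiv_symm.2 ⟨hw, rfl⟩⟩, ?_⟩
      rintro ⟨w', hw'⟩
      exact (mem_consPEquiv_symm.1 hw').1
    rw [Finset.sum_congr rfl fun b _ => h b, ← indOp_biUnion]
    · congr 1
      ext w
      simp only [Set.mem_iUnion, Set.mem_ofPred_eq]
      constructor
      · intro hw
        obtain ⟨b, hb⟩ := w.regular hw hA
        refine ⟨b, ?_, hb⟩
        rw [← Finset.mem_coe, hF]
        intro h0
        exact w.bot_notMem _ (h0 ▸ hb)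
      · rintro ⟨b, -, hb⟩
        exact w.upper_of_append (α := []) (β := [b]) trivial hb le_rfl
    · intro b b' w hb hb'
      exact w.letter_unique (α := []) hb hb'

/-- Conjugating an indicator by a partial bijection of the basis gives an indicator, so by induction
the generators of `D` act by multiplication. -/
theorem wordQ_rep {α : List L} {A : B} (hA : A ∈ X.wordIdeal α) :
    (rep X).wordQ α A = indOp {w | A ∈ w.mem α} := by
  induction α with
  | nil => rw [Rep.wordQ_nil]; rfl
  | cons a α ih =>
    have h := X.mem_wordIdeal_of_cons hA
    obtain ⟨D, hD, hle⟩ := X.exists_le_θWord_of_cons hA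
    rw [(rep X).wordQ_cons hD hle, ih h]
    refine PEquiv.toOp_mul_indOp_mul_star _ fun w => ?_
    constructor
    · intro hw
      have hDw : D ∈ w.mem [a] :=
        w.upper_of_append (β := α) (X.mem_wordIdeal_singleton.2 hD) hw hle
      exact ⟨_, mem_consPEquiv_symm.2 ⟨hDw, rfl⟩, h, A, hw, le_rfl⟩
    · rintro ⟨w', hw', hAw'⟩
      obtain ⟨hDw, rfl⟩ := mem_consPEquiv_symm.1 hw'
      obtain ⟨-, C, hC, hCA⟩ := hAw'
      exact w.upper hC hA hCA

end Spec

end GBDS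

/-! ### Ultrafilters and the topology of Stone duals. -/

section StoneTopology

variable {B : Type u} [GeneralizedBooleanAlgebra B] {J : Order.Ideal B}

theorem IsUltrafilterIn.mem_or_mem_of_sup {ξ : Set B} (h : IsUltrafilterIn J ξ) {A A' : B}
    (hA : A ⊔ A' ∈ ξ) : A ∈ ξ ∨ A' ∈ ξ := by
  have hJ := h.1.subset hA
  rcases h.inf_or_sdiff hA A with h1 | h1
  · exact Or.inl (h.1.mem_of_le _ h1 _ (J.lower le_sup_left hJ) inf_le_right)
  · refine Or.inr (h.1.mem_of_le _ h1 _ (J.lower le_sup_right hJ) ?_)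
    rw [sup_sdiff_left_self]
    exact sdiff_le

theorem IsFilterIn.exists_isUltrafilterIn {ξ : Set B} (h : IsFilterIn J ξ) :
    ∃ ζ, ξ ⊆ ζ ∧ IsUltrafilterIn J ζ := by
  refine zorn_subset_nonempty {ζ | IsFilterIn J ζ} (fun c hc hchain hne => ?_) ξ h
  refine ⟨⋃₀ c, ⟨?_, ?_, ?_, ?_, ?_⟩, fun s hs => Set.subset_sUnion_of_mem hs⟩
  · exact Set.sUnion_subset fun s hs => (hc hs).subset
  · obtain ⟨s, hs⟩ := hne
    exact (hc hs).nonempty.mono (Set.subset_sUnion_of_mem hs)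
  · rintro ⟨s, hs, hb⟩
    exact (hc hs).bot_notMem hb
  · rintro a ⟨s, hs, ha⟩ b hb hab
    exact ⟨s, hs, (hc hs).mem_of_le a ha b hb hab⟩
  · rintro a ⟨s, hs, ha⟩ b ⟨t, ht, hb⟩
    rcases hchain.total hs ht with hst | hst
    · obtain ⟨c, hc, h⟩ := (hc ht).directed a (hst ha) b hb
      exact ⟨c, ⟨t, ht, hc⟩, h⟩
    · obtain ⟨c, hc, h⟩ := (hc hs).directed a ha b (hst hb)
      exact ⟨c, ⟨s, hs, hc⟩, h⟩

namespace StoneDual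

theorem exists_mem {A : B} (hA : A ∈ J) (h : A ≠ ⊥) : ∃ ξ : StoneDual J, A ∈ ξ.1 := by
  have hF : IsFilterIn J {C | C ∈ J ∧ A ≤ C} :=
    ⟨fun C hC => hC.1, ⟨A, hA, le_rfl⟩, fun hb => h (le_bot_iff.1 hb.2),
      fun C hC D hD hCD => ⟨hD, hC.2.trans hCD⟩,
      fun C hC D hD => ⟨C ⊓ D, ⟨J.lower inf_le_left hC.1, le_inf hC.2 hD.2⟩, inf_le_left,
        inf_le_right⟩⟩
  obtain ⟨ζ, hsub, hζ⟩ := hF.exists_isUltrafilterIn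
  exact ⟨⟨ζ, hζ⟩, hsub ⟨hA, le_rfl⟩⟩

theorem mem_J (ξ : StoneDual J) {A : B} (hA : A ∈ ξ.1) : A ∈ J := ξ.2.1.subset hA

theorem ne_bot (ξ : StoneDual J) {A : B} (hA : A ∈ ξ.1) : A ≠ ⊥ :=
  fun h => ξ.2.1.bot_notMem (h ▸ hA)

theorem upper (ξ : StoneDual J) {A A' : B} (hA : A ∈ ξ.1) (hA' : A' ∈ J) (h : A ≤ A') :
    A' ∈ ξ.1 := ξ.2.1.mem_of_le A hA A' hA' h

theorem inf_mem_iff (ξ : StoneDual J) {A A' : B} (hA : A ∈ J) (hA' : A' ∈ J) :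
    A ⊓ A' ∈ ξ.1 ↔ A ∈ ξ.1 ∧ A' ∈ ξ.1 :=
  ⟨fun h => ⟨ξ.upper h hA inf_le_left, ξ.upper h hA' inf_le_right⟩,
    fun h => ξ.2.1.inf_mem h.1 h.2⟩

theorem eq_of_subset {ξ ζ : StoneDual J} (h : ξ.1 ⊆ ζ.1) : ξ = ζ :=
  Subtype.ext (h.antisymm (ξ.2.2 ζ.2.1 h))

theorem isOpen_basic {A : B} (hA : A ∈ J) : IsOpen (basic J A) :=
  TopologicalSpace.isOpen_generateFrom_of_mem ⟨A, hA, rfl⟩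

theorem mem_nhds_iff {ξ : StoneDual J} {U : Set (StoneDual J)} :
    U ∈ 𝓝 ξ ↔ ∃ A ∈ ξ.1, basic J A ⊆ U := by
  have hb : TopologicalSpace.IsTopologicalBasis {U | ∃ A ∈ J, U = basic J A} := by
    refine ⟨?_, ?_, rfl⟩
    · rintro _ ⟨A, hA, rfl⟩ _ ⟨A', hA', rfl⟩ ζ hζ
      exact ⟨basic J (A ⊓ A'), ⟨_, J.lower inf_le_left hA, rfl⟩, (ζ.inf_mem_iff hA hA').2 hζ,
        fun η hη => (η.inf_mem_iff hA hA').1 hη⟩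
    · refine Set.eq_univ_of_forall fun ζ => ?_
      obtain ⟨A, hA⟩ := ζ.2.1.nonempty
      exact ⟨basic J A, ⟨A, ζ.mem_J hA, rfl⟩, hA⟩
  rw [hb.mem_nhds_iff]
  constructor
  · rintro ⟨_, ⟨A, -, rfl⟩, hA, hU⟩
    exact ⟨A, hA, hU⟩
  · rintro ⟨A, hA, hU⟩
    exact ⟨_, ⟨A, ξ.mem_J hA, rfl⟩, hA, hU⟩

instance : T2Space (StoneDual J) := by
  refine ⟨fun ξ ζ hne => ?_⟩
  obtain ⟨C, hC, hC'⟩ := Set.not_subset.1 fun h => hne (eq_of_subset h)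
  obtain ⟨D, hD⟩ := ζ.2.1.nonempty
  have hDC : D \ C ∈ ζ.1 := (ζ.2.inf_or_sdiff hD C).resolve_left fun h =>
    hC' (ζ.upper h (ξ.mem_J hC) inf_le_right)
  refine ⟨basic J C, basic J (D \ C), isOpen_basic (ξ.mem_J hC), isOpen_basic (ζ.mem_J hDC), hC,
    hDC, Set.disjoint_left.2 fun η hη hη' => η.2.1.bot_notMem ?_⟩
  have := η.2.1.inf_mem hη hη'
  rwa [inf_sdiff_self_right] at this

/-- An ultrafilter `F` of subsets containing `Z(A)` converges to `{C : Z(C) ∈ F}`. That filter is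
maximal because `Z(A)` is the union of `Z(A ⊓ C)` and `Z(A \ C)`. -/
theorem isCompact_basic (A : B) : IsCompact (basic J A) := by
  rw [isCompact_iff_ultrafilter_le_nhds]
  intro F hF
  rw [Filter.le_principal_iff] at hF
  by_cases hA : A ∈ J
  swap
  · exact absurd (Filter.mem_of_superset hF fun ξ hξ => (hA (ξ.mem_J hξ)).elim) F.empty_notMem
  have hfil : IsFilterIn J {C | C ∈ J ∧ basic J C ∈ F} := by
    refine ⟨fun C hC => hC.1, ⟨A, hA, hF⟩, fun hb => ?_, fun C hC D hD hCD => ?_,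
      fun C hC D hD => ?_⟩
    · exact F.empty_notMem (Filter.mem_of_superset hb.2 fun ξ hξ => (ξ.2.1.bot_notMem hξ).elim)
    · exact ⟨hD, Filter.mem_of_superset hC.2 fun ξ hξ => ξ.upper hξ hD hCD⟩
    · refine ⟨C ⊓ D, ⟨J.lower inf_le_left hC.1, ?_⟩, inf_le_left, inf_le_right⟩
      exact Filter.mem_of_superset (Filter.inter_mem hC.2 hD.2) fun ξ hξ =>
        (ξ.inf_mem_iff hC.1 hD.1).2 hξ
  have hult : IsUltrafilterIn J {C | C ∈ J ∧ basic J C ∈ F} := by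
    refine hfil.isUltrafilterIn fun C hC => ⟨A, ?_⟩
    have h1 : A ⊓ C ∈ J := J.lower inf_le_left hA
    have h2 : A \ C ∈ J := J.lower sdiff_le hA
    have : basic J (A ⊓ C) ∪ basic J (A \ C) ∈ F :=
      Filter.mem_of_superset hF fun ξ hξ => ξ.2.inf_or_sdiff hξ C
    exact (Ultrafilter.union_mem_iff.1 this).imp (fun h => ⟨h1, h⟩) fun h => ⟨h2, h⟩
  refine ⟨⟨_, hult⟩, ⟨hA, hF⟩, fun U hU => ?_⟩
  obtain ⟨C, hC, hCU⟩ := mem_nhds_iff.1 hU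
  exact Filter.mem_of_superset hC.2 hCU

theorem isClosed_basic (A : B) : IsClosed (basic J A) := (isCompact_basic A).isClosed

theorem isClopen_basic {A : B} (hA : A ∈ J) : IsClopen (basic J A) :=
  ⟨isClosed_basic A, isOpen_basic hA⟩

end StoneDual

end StoneTopology

/-! ### Singular vertices and regular sets. -/

namespace GBDS

variable {B : Type u} [GeneralizedBooleanAlgebra B] {L : Type v} (X : GBDS B L)

theorem F0mem_coe (v : X.E0) : X.F0mem (v : X.F0) = v.1 := rfl

theorem F0mem_infty : X.F0mem OnePoint.infty = ∅ := rfl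

/-- Ultrafilters are nonempty, which separates them from `∞`. Equations in `F⁰` can therefore be
tested on members. -/
theorem F0mem_injective : Function.Injective X.F0mem := by
  intro v v' h
  induction v using OnePoint.rec with
  | infty =>
    induction v' using OnePoint.rec with
    | infty => rfl
    | coe v' =>
      exact absurd v'.2.1.nonempty (by rw [← F0mem_coe, ← h]; exact Set.not_nonempty_empty)
  | coe v =>
    induction v' using OnePoint.rec with
    | infty => exact absurd v.2.1.nonempty (by rw [← F0mem_coe, h]; exact Set.not_nonempty_empty)
    | coe v' => exact congrArg _ (Subtype.ext h)

theorem F0mem_r (e : X.E1) : X.F0mem (X.r e) = {A | X.θ e.1 A ∈ e.2.1} := by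
  unfold r
  split_ifs with h
  · rfl
  · exact (Set.not_nonempty_iff_eq_empty.1 h).symm

theorem mem_F0mem_r {e : X.E1} {A : B} : A ∈ X.F0mem (X.r e) ↔ X.θ e.1 A ∈ e.2.1 := by
  rw [F0mem_r]
  rfl

theorem mem_d {e : X.E1} {A : B} (hA : A ∈ X.I e.1) : A ∈ (X.d e).1 ↔ A ∈ e.2.1 :=
  ⟨fun ⟨_, hC, h⟩ => e.2.upper hC hA h, fun h => ⟨A, h, le_rfl⟩⟩

theorem mem_coe_image_basic {v : X.F0} {A : B} :
    v ∈ ((↑) : X.E0 → X.F0) '' StoneDual.basic ⊤ A ↔ A ∈ X.F0mem v := by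
  induction v using OnePoint.rec with
  | infty => simp [F0mem_infty]
  | coe v =>
    rw [(OnePoint.coe_injective).mem_set_image]
    rfl

theorem isOpen_coe_image_basic (A : B) :
    IsOpen (((↑) : X.E0 → X.F0) '' StoneDual.basic ⊤ A) :=
  OnePoint.isOpenEmbedding_coe.isOpenMap _ (StoneDual.isOpen_basic trivial)

/-- Choose `A` with `Z(A)` inside `V` and away from the closure of `F⁰_sce`. For `∅ ≠ C ⊆ A`, the
set `Z(C)` meets the range of `r`, which gives a letter in `Δ_C`; compactness of `r⁻¹(V)` leaves
only finitely many letters. -/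
theorem exists_regular_of_mem_F0rg {v : X.E0} (h : (v : X.F0) ∈ X.F0rg) :
    ∃ A ∈ v.1, X.IsRegular A := by
  obtain ⟨⟨V, hV, hVc⟩, hsce⟩ := h
  have hW : V ∩ (closure X.F0sce)ᶜ ∈ 𝓝 (v : X.F0) :=
    Filter.inter_mem hV (isClosed_closure.isOpen_compl.mem_nhds hsce)
  obtain ⟨A, hA, hsub⟩ := StoneDual.mem_nhds_iff.1
    (OnePoint.continuous_coe.continuousAt.preimage_mem_nhds hW)
  refine ⟨A, hA, fun C hCA hC => ⟨?_, ?_⟩⟩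
  · obtain ⟨ξ, hξ⟩ := StoneDual.exists_mem (J := (⊤ : Order.Ideal B)) (A := C) trivial hC
    have h1 : (ξ : X.F0) ∈ closure (Set.range X.r) := by
      by_contra h
      exact (hsub (ξ.upper hξ trivial hCA)).2 (subset_closure h)
    obtain ⟨_, h2, ⟨e, rfl⟩⟩ := mem_closure_iff.1 h1 _ (X.isOpen_coe_image_basic C)
      (X.mem_coe_image_basic.2 hξ)
    exact ⟨e.1, e.2.ne_bot (X.mem_F0mem_r.1 (X.mem_coe_image_basic.1 h2))⟩
  · obtain ⟨t, ht⟩ := hVc.elim_finite_subcover (fun a : L => Set.range (Sigma.mk a : _ → X.E1))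
      (fun a => isOpen_range_sigmaMk) fun e _ => Set.mem_iUnion.2 ⟨e.1, e.2, rfl⟩
    refine t.finite_toSet.subset fun a ha => ?_
    obtain ⟨η, hη⟩ := StoneDual.exists_mem (X.θ_mem a C) ha
    have he : (⟨a, η⟩ : X.E1) ∈ X.r ⁻¹' V := by
      have h1 : C ∈ X.F0mem (X.r ⟨a, η⟩) := X.mem_F0mem_r.2 hη
      obtain ⟨ξ, hξ, hr⟩ := X.mem_coe_image_basic.2 h1
      rw [Set.mem_preimage, ← hr]
      exact (hsub (ξ.upper hξ trivial hCA)).1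
    obtain ⟨b, hb, η', h⟩ := Set.mem_iUnion₂.1 (ht he)
    have hba : b = a := congrArg Sigma.fst h
    exact hba ▸ hb

/-- `r⁻¹(Z(A))` is the union over the finite set `Δ_A` of the compact sets `Z(θ_a(A))`. Each
nonempty `Z(C)` inside `Z(A)` meets the range of `r`, so `Z(A)` misses `F⁰_sce`. -/
theorem mem_F0rg_of_regular {v : X.E0} {A : B} (hA : A ∈ v.1) (hreg : X.IsRegular A) :
    (v : X.F0) ∈ X.F0rg := by
  have hV := X.isOpen_coe_image_basic A
  have hv : (v : X.F0) ∈ ((↑) : X.E0 → X.F0) '' StoneDual.basic ⊤ A := ⟨v, hA, rfl⟩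
  refine ⟨⟨_, hV.mem_nhds hv, ?_⟩, fun hcl => ?_⟩
  · have hfin : (X.Δ A).Finite := (hreg A le_rfl (v.ne_bot hA)).2
    have : X.r ⁻¹' (((↑) : X.E0 → X.F0) '' StoneDual.basic ⊤ A) =
        ⋃ a ∈ X.Δ A, Sigma.mk a '' StoneDual.basic (X.I a) (X.θ a A) := by
      ext e
      rw [Set.mem_preimage, X.mem_coe_image_basic, X.mem_F0mem_r]
      simp only [Set.mem_iUnion]
      constructor
      · intro h
        exact ⟨e.1, e.2.ne_bot h, e.2, h, rfl⟩
      · rintro ⟨a, -, η, hη, rfl⟩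
        exact hη
    rw [this]
    exact hfin.isCompact_biUnion fun a _ =>
      (StoneDual.isCompact_basic _).image continuous_sigmaMk
  · obtain ⟨_, ⟨ξ, hξ, rfl⟩, hsce⟩ := mem_closure_iff.1 hcl _ hV hv
    refine hsce (mem_closure_iff_nhds.2 fun N hN => ?_)
    obtain ⟨C, hC, hsub⟩ := StoneDual.mem_nhds_iff.1
      (OnePoint.continuous_coe.continuousAt.preimage_mem_nhds hN)
    have hCA : C ⊓ A ∈ ξ.1 := ξ.2.1.inf_mem hC hξ
    obtain ⟨a, ha⟩ := (hreg _ inf_le_right (ξ.ne_bot hCA)).1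
    obtain ⟨η, hη⟩ := StoneDual.exists_mem (X.θ_mem a _) ha
    refine ⟨X.r ⟨a, η⟩, ?_, ⟨a, η⟩, rfl⟩
    have h1 : C ⊓ A ∈ X.F0mem (X.r ⟨a, η⟩) := X.mem_F0mem_r.2 hη
    obtain ⟨ζ, hζ, hr⟩ := X.mem_coe_image_basic.2 h1
    rw [← hr]
    exact hsub (ζ.upper hζ trivial inf_le_left)

/-- Here the topological condition on endpoints of boundary paths becomes the algebraic condition in
relation (iv). -/
theorem mem_E0sg_iff {v : X.E0} : v ∈ X.E0sg ↔ ∀ A ∈ v.1, ¬ X.IsRegular A :=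
  ⟨fun h _ hA hreg => h (X.mem_F0rg_of_regular hA hreg), fun h hrg =>
    let ⟨A, hA, hreg⟩ := X.exists_regular_of_mem_F0rg hrg
    h A hA hreg⟩

end GBDS

/-! ### From boundary paths to the combinatorial spectrum. -/

namespace GBDS

variable {B : Type u} [GeneralizedBooleanAlgebra B] {L : Type v} {X : GBDS B L}

namespace BoundaryPath

theorem range_of_edge? {μ : X.BoundaryPath} {e : X.E1} (h : μ.edge? 0 = some e) :
    μ.range = X.r e := by
  rcases μ with p | ⟨⟨_ | n, p⟩, hp⟩
  · exact congrArg X.r (Option.some.inj h)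
  · cases h
  · rw [edge?, dif_pos n.succ_pos] at h
    exact congrArg X.r (Option.some.inj h)

theorem exists_edge? {μ : X.BoundaryPath} {i : ℕ} {e' : X.E1} (h : μ.edge? (i + 1) = some e') :
    ∃ e, μ.edge? i = some e ∧ (X.d e : X.F0) = X.r e' := by
  rcases μ with p | ⟨⟨_ | n, p⟩, hp⟩
  · exact ⟨p.1 i, rfl, (p.2 i).trans (congrArg X.r (Option.some.inj h))⟩
  · cases h
  · rw [edge?] at h
    split_ifs at h with hi
    refine ⟨p.1 ⟨i, by omega⟩, ?_, ?_⟩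
    · rw [edge?, dif_pos]
    · exact (p.2 ⟨i, by omega⟩).trans (congrArg X.r (Option.some.inj h))

theorem exists_range_mem_E0sg {μ : X.BoundaryPath} (h : μ.edge? 0 = none) :
    ∃ v : X.E0, μ.range = v ∧ v ∈ X.E0sg := by
  rcases μ with p | ⟨⟨_ | n, p⟩, hp⟩
  · cases h
  · exact ⟨p.down, rfl, hp⟩
  · rw [edge?, dif_pos n.succ_pos] at h
    cases h

theorem d_mem_E0sg {μ : X.BoundaryPath} {i : ℕ} {e : X.E1} (h : μ.edge? i = some e)
    (h' : μ.edge? (i + 1) = none) : X.d e ∈ X.E0sg := by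
  rcases μ with p | ⟨⟨_ | n, p⟩, hp⟩
  · cases h'
  · cases h
  · rw [edge?] at h h'
    split_ifs at h h' with hi hi'
    obtain rfl : i = n := by omega
    obtain rfl := Option.some.inj h
    exact hp

/-- The hypothesis on ranges is needed for paths of length zero, which have no edges. -/
theorem ext_of_edge? {μ ν : X.BoundaryPath} (hr : μ.range = ν.range)
    (h : ∀ i, μ.edge? i = ν.edge? i) : μ = ν := by
  rcases μ with p | ⟨⟨_ | n, p⟩, hp⟩ <;> rcases ν with q | ⟨⟨_ | m, q⟩, hq⟩
  · exact congrArg Sum.inl (Subtype.ext (funext fun i => Option.some.inj (h i)))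
  · cases h 0
  · have := h (m + 1)
    simp [edge?] at this
  · cases h 0
  · have : p = q := congrArg ULift.up (OnePoint.coe_injective hr)
    subst this
    rfl
  · have := h 0
    simp [edge?] at this
  · have := h (n + 1)
    simp [edge?] at this
  · have := h 0
    simp [edge?] at this
  · obtain rfl : n = m := by
      have h1 := h n
      have h2 := h m
      simp only [edge?] at h1 h2
      split_ifs at h1 h2 <;> omega
    have : p = q := by
      refine Subtype.ext (funext fun i => ?_)
      have := h i
      simp only [edge?] at this
      rw [dif_pos i.2, dif_pos i.2] at this
      exact Option.some.inj this
    subst this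
    rfl

/-- By `hs` the defined edges form an initial segment; `hv` and `hd` put the endpoint into `E⁰_sg`
if the segment is finite. -/
theorem exists_of_edges (v : X.F0) (e : ℕ → Option X.E1)
    (h0 : ∀ e₀, e 0 = some e₀ → v = X.r e₀)
    (hs : ∀ i e', e (i + 1) = some e' → ∃ e₀, e i = some e₀ ∧ (X.d e₀ : X.F0) = X.r e')
    (hv : e 0 = none → ∃ v' : X.E0, v = v' ∧ v' ∈ X.E0sg)
    (hd : ∀ i e₀, e i = some e₀ → e (i + 1) = none → X.d e₀ ∈ X.E0sg) :
    ∃ μ : X.BoundaryPath, μ.range = v ∧ ∀ i, μ.edge? i = e i := by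
  by_cases hinf : ∀ i, (e i).isSome
  · refine ⟨Sum.inl ⟨fun i => (e i).get (hinf i), fun i => ?_⟩, ?_, ?_⟩
    · obtain ⟨e₀, h1, h2⟩ := hs i _ (Option.some_get (hinf (i + 1))).symm
      rw [← h2]
      simp [h1]
    · exact (h0 _ (Option.some_get (hinf 0)).symm).symm
    · exact fun i => Option.some_get (hinf i)
  · have hinf' : ∃ i, e i = none := by simpa using hinf
    classical
    set n := Nat.find hinf' with hn
    have hlt : ∀ i < n, (e i).isSome := fun i hi =>
      Option.ne_none_iff_isSome.1 (Nat.find_min hinf' hi)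
    have hge : ∀ i, n ≤ i → e i = none := by
      intro i hi
      induction i, hi using Nat.le_induction with
      | base => exact Nat.find_spec hinf'
      | succ i _ ih =>
        rw [Option.eq_none_iff_forall_ne_some]
        intro e' he'
        obtain ⟨e₀, h1, -⟩ := hs i e' he'
        rw [ih] at h1
        cases h1
    rcases n with _ | n
    · obtain ⟨v', rfl, hv'⟩ := hv (hge 0 le_rfl)
      refine ⟨Sum.inr ⟨⟨0, ULift.up v'⟩, hv'⟩, rfl, fun i => ?_⟩
      rw [hge i (Nat.zero_le i)]
      rfl
    · refine ⟨Sum.inr ⟨⟨n + 1, ⟨fun i => (e i).get (hlt i i.2), fun i => ?_⟩⟩, ?_⟩, ?_, ?_⟩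
      · obtain ⟨e₀, h1, h2⟩ := hs i _ (Option.some_get (hlt (i + 1) (by omega))).symm
        simp only [Fin.val_castSucc, Fin.val_succ]
        rw [← h2]
        simp [h1]
      · exact hd n _ (Option.some_get (hlt n n.lt_succ_self)).symm (hge (n + 1) le_rfl)
      · exact (h0 _ (Option.some_get (hlt 0 n.succ_pos)).symm).symm
      · intro i
        change (if h : i < n + 1 then some ((e i).get (hlt i h)) else none) = e i
        split_ifs with hi
        · exact Option.some_get (hlt i hi)
        · exact (hge i (by omega)).symm

/-- The word formed by the labels of `μ` begins with `α`. -/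
def HasPrefix (μ : X.BoundaryPath) (α : List L) : Prop :=
  ∀ i (hi : i < α.length), ∃ e, μ.edge? i = some e ∧ e.1 = α[i]

theorem hasPrefix_nil (μ : X.BoundaryPath) : μ.HasPrefix [] := fun _ hi => absurd hi (by simp)

theorem hasPrefix_append {μ : X.BoundaryPath} {α : List L} {b : L} :
    μ.HasPrefix (α ++ [b]) ↔ μ.HasPrefix α ∧ ∃ e, μ.edge? α.length = some e ∧ e.1 = b := by
  constructor
  · intro h
    refine ⟨fun i hi => ?_, ?_⟩
    · obtain ⟨e, h1, h2⟩ := h i (by simp; omega)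
      exact ⟨e, h1, by rw [h2, List.getElem_append_left hi]⟩
    · obtain ⟨e, h1, h2⟩ := h α.length (by simp)
      exact ⟨e, h1, by rw [h2]; simp⟩
  · rintro ⟨h, e, h1, h2⟩ i hi
    by_cases hlt : i < α.length
    · obtain ⟨e', h1', h2'⟩ := h i hlt
      exact ⟨e', h1', by rw [h2', List.getElem_append_left hlt]⟩
    · obtain rfl : i = α.length := by simp at hi; omega
      exact ⟨e, h1, by rw [h2]; simp⟩

/-- The set `η_n`, for the edge `e^a_{η_n}` of `μ` with number `n`, and `r(μ)` for `n = 0`. -/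
def level (μ : X.BoundaryPath) : ℕ → Set B
  | 0 => X.F0mem μ.range
  | n + 1 => {A | ∃ e, μ.edge? n = some e ∧ A ∈ e.2.1}

theorem mem_level_succ {μ : X.BoundaryPath} {n : ℕ} {e : X.E1} (h : μ.edge? n = some e) {A : B} :
    A ∈ μ.level (n + 1) ↔ A ∈ e.2.1 :=
  ⟨fun ⟨_, h', hA⟩ => Option.some.inj (h.symm.trans h') ▸ hA, fun hA => ⟨e, h, hA⟩⟩

theorem mem_N_iff {μ : X.BoundaryPath} {α : List L} {A : B} :
    μ ∈ X.N α A ↔ μ.HasPrefix α ∧ A ∈ μ.level α.length := by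
  cases α with
  | nil => exact ⟨fun h => ⟨μ.hasPrefix_nil, h⟩, fun h => h.2⟩
  | cons a α =>
    constructor
    · rintro ⟨e, h1, h2, h3⟩
      exact ⟨fun i hi => ⟨e ⟨i, hi⟩, h1 ⟨i, hi⟩, h2 ⟨i, hi⟩⟩, e (Fin.last _), h1 (Fin.last _), h3⟩
    · rintro ⟨h, e, he, hA⟩
      choose f hf hf' using fun i : Fin (α.length + 1) => h i i.2
      refine ⟨f, hf, hf', ?_⟩
      have := (hf (Fin.last _)).symm.trans he
      rw [Option.some.inj this]
      exact hA

/-- Passing from a level to the next one. -/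
theorem mem_level_iff {μ : X.BoundaryPath} {α : List L} {e : X.E1} (hα : μ.HasPrefix α)
    (he : μ.edge? α.length = some e) {A : B} (hA : A ∈ X.wordIdeal α) :
    A ∈ μ.level α.length ↔ X.θ e.1 A ∈ e.2.1 := by
  induction α using List.reverseRecOn with
  | nil =>
    change A ∈ X.F0mem μ.range ↔ _
    rw [range_of_edge? he, X.mem_F0mem_r]
  | append_singleton α b _ =>
    rw [List.length_append] at he ⊢
    obtain ⟨e', he', hd⟩ := exists_edge? he
    obtain ⟨-, e'', he'', hb⟩ := hasPrefix_append.1 hα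
    obtain rfl := Option.some.inj (he''.symm.trans he')
    have hI : A ∈ X.I e''.1 := by
      rw [hb]
      exact X.mem_I_of_mem_wordIdeal hA
    rw [List.length_singleton, mem_level_succ he'', ← X.mem_d hI, ← X.F0mem_coe, hd, X.mem_F0mem_r]

/-- The last ultrafilter lives in `I_b`, while a member in the smaller ideal of the whole word is
wanted. A member of the first ultrafilter, pushed forward by the maps `θ`, is one. -/
theorem level_nonempty {μ : X.BoundaryPath} {α : List L} {b : L} (hα : μ.HasPrefix (α ++ [b])) :
    ∃ A ∈ X.wordIdeal (α ++ [b]), A ∈ μ.level (α ++ [b]).length := by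
  rw [List.length_append, List.length_singleton]
  obtain ⟨hα', e, he, rfl⟩ := hasPrefix_append.1 hα
  induction α using List.reverseRecOn generalizing e with
  | nil =>
    obtain ⟨A, hA⟩ := e.2.2.1.nonempty
    exact ⟨A, X.mem_wordIdeal_singleton.2 (e.2.mem_J hA), (mem_level_succ he).2 hA⟩
  | append_singleton α b ih =>
    obtain ⟨h1, e', he', rfl⟩ := hasPrefix_append.1 hα'
    obtain ⟨A, hA, hA'⟩ := ih h1 e' he' hα'
    refine ⟨X.θ e.1 A, X.θ_mem_wordIdeal _ hA, (mem_level_succ he).2 ?_⟩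
    refine (mem_level_iff hα' he hA).1 ?_
    rwa [List.length_append, List.length_singleton]

/-- Every level is the trace of an ultrafilter, or empty. -/
theorem level_cases {μ : X.BoundaryPath} {α : List L} (hα : μ.HasPrefix α) :
    (α = [] ∧ μ.level α.length = ∅) ∨ ∃ (J : Order.Ideal B) (ξ : StoneDual J),
      (∀ A ∈ X.wordIdeal α, A ∈ J) ∧ μ.level α.length = ξ.1 := by
  induction α using List.reverseRecOn with
  | nil =>
    change (_ ∧ X.F0mem μ.range = ∅) ∨ ∃ _ _, _ ∧ X.F0mem μ.range = _
    generalize μ.range = v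
    induction v using OnePoint.rec with
    | infty => exact Or.inl ⟨rfl, rfl⟩
    | coe v => exact Or.inr ⟨⊤, v, fun _ _ => trivial, rfl⟩
  | append_singleton α b _ =>
    obtain ⟨-, e, he, rfl⟩ := hasPrefix_append.1 hα
    refine Or.inr ⟨X.I e.1, e.2, fun A hA => X.mem_I_of_mem_wordIdeal hA, ?_⟩
    rw [List.length_append, List.length_singleton]
    exact Set.ext fun A => mem_level_succ he

end BoundaryPath

open BoundaryPath

/-- The point of the combinatorial spectrum given by a boundary path. -/
def specOfPath (μ : X.BoundaryPath) : X.Spec where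
  mem α := {A | A ∈ X.wordIdeal α ∧ μ ∈ X.N α A}
  mem_wordIdeal hA := hA.1
  bot_notMem := by
    rintro α ⟨-, h⟩
    rw [mem_N_iff] at h
    rcases level_cases h.1 with ⟨-, h0⟩ | ⟨J, ξ, -, h0⟩
    · rw [h0] at h
      exact h.2
    · rw [h0] at h
      exact ξ.2.1.bot_notMem h.2
  upper := by
    rintro α A A' ⟨hA, h⟩ hA' hle
    refine ⟨hA', ?_⟩
    rw [mem_N_iff] at h ⊢
    refine ⟨h.1, ?_⟩
    rcases level_cases h.1 with ⟨-, h0⟩ | ⟨J, ξ, hJ, h0⟩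
    · rw [h0] at h
      exact h.2.elim
    · rw [h0] at h ⊢
      exact ξ.upper h.2 (hJ _ hA') hle
  inf := by
    rintro α A A' ⟨hA, h⟩ ⟨hA', h'⟩
    refine ⟨X.wordIdeal_mono inf_le_left hA, ?_⟩
    rw [mem_N_iff] at h h' ⊢
    refine ⟨h.1, ?_⟩
    rcases level_cases h.1 with ⟨-, h0⟩ | ⟨J, ξ, hJ, h0⟩
    · rw [h0] at h
      exact h.2.elim
    · rw [h0] at h h' ⊢
      exact ξ.2.1.inf_mem h.2 h'.2
  prime := by
    rintro α A A' ⟨hA, h⟩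
    have h1 := X.wordIdeal_mono le_sup_left hA
    have h2 := X.wordIdeal_mono le_sup_right hA
    rw [mem_N_iff] at h
    rcases level_cases h.1 with ⟨-, h0⟩ | ⟨J, ξ, hJ, h0⟩
    · rw [h0] at h
      exact h.2.elim
    · rw [h0] at h
      exact (ξ.2.mem_or_mem_of_sup h.2).imp (fun h3 => ⟨h1, mem_N_iff.2 ⟨h.1, h0 ▸ h3⟩⟩)
        fun h3 => ⟨h2, mem_N_iff.2 ⟨h.1, h0 ▸ h3⟩⟩
  letter := by
    rintro α b A A' hA ⟨hA', h⟩
    rw [mem_N_iff, List.length_append, List.length_singleton] at h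
    obtain ⟨hα, e, he, rfl⟩ := hasPrefix_append.1 h.1
    have h2 := (mem_level_succ he).1 h.2
    have h3 := e.2.inf_mem_iff (e.2.mem_J h2) (X.θ_mem e.1 A)
    constructor
    · rintro ⟨-, h4⟩
      rw [mem_N_iff, mem_level_iff hα he hA] at h4
      refine ⟨X.wordIdeal_mono inf_le_left hA', ?_⟩
      rw [mem_N_iff, List.length_append, List.length_singleton]
      exact ⟨h.1, (mem_level_succ he).2 (h3.2 ⟨h2, h4.2⟩)⟩
    · rintro ⟨-, h4⟩
      rw [mem_N_iff, List.length_append, List.length_singleton] at h4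
      refine ⟨hA, ?_⟩
      rw [mem_N_iff, mem_level_iff hα he hA]
      exact ⟨hα, (h3.1 ((mem_level_succ he).1 h4.2)).2⟩
  letter_unique := by
    rintro α b b' A A' ⟨-, h⟩ ⟨-, h'⟩
    obtain ⟨-, e, he, rfl⟩ := hasPrefix_append.1 (mem_N_iff.1 h).1
    obtain ⟨-, e', he', rfl⟩ := hasPrefix_append.1 (mem_N_iff.1 h').1
    rw [Option.some.inj (he.symm.trans he')]
  regular := by
    rintro α A ⟨hA, h⟩ hreg
    rw [mem_N_iff] at h
    -- If the path stopped here, its endpoint would lie in `E⁰_sg` and yet contain the regular set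
    -- `A`.
    have hedge : ∃ e, μ.edge? α.length = some e := by
      by_contra! hno
      have hnone := Option.eq_none_iff_forall_ne_some.2 hno
      induction α using List.reverseRecOn with
      | nil =>
        obtain ⟨v, hv, hsg⟩ := exists_range_mem_E0sg hnone
        refine X.mem_E0sg_iff.1 hsg A ?_ hreg
        have := h.2
        change A ∈ X.F0mem μ.range at this
        rwa [hv] at this
      | append_singleton α b _ =>
        obtain ⟨-, e, he, rfl⟩ := hasPrefix_append.1 h.1
        rw [List.length_append, List.length_singleton] at h hnone
        exact X.mem_E0sg_iff.1 (d_mem_E0sg he hnone) A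
          ((X.mem_d (X.mem_I_of_mem_wordIdeal hA)).2 ((mem_level_succ he).1 h.2)) hreg
    obtain ⟨e, he⟩ := hedge
    refine ⟨e.1, X.θ_mem_wordIdeal _ hA, ?_⟩
    rw [mem_N_iff, List.length_append, List.length_singleton]
    exact ⟨hasPrefix_append.2 ⟨h.1, e, he, rfl⟩,
      (mem_level_succ he).2 ((mem_level_iff h.1 he hA).1 h.2)⟩
  nonempty := by
    rcases h : μ.edge? 0 with _ | e
    · obtain ⟨v, hv, -⟩ := exists_range_mem_E0sg h
      obtain ⟨A, hA⟩ := v.2.1.nonempty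
      refine ⟨[], A, trivial, ?_⟩
      change A ∈ X.F0mem μ.range
      rwa [hv]
    · have hp : μ.HasPrefix ([] ++ [e.1]) := hasPrefix_append.2 ⟨μ.hasPrefix_nil, e, h, rfl⟩
      obtain ⟨A, hA, hA'⟩ := level_nonempty hp
      exact ⟨_, A, hA, mem_N_iff.2 ⟨hp, hA'⟩⟩

theorem mem_specOfPath {μ : X.BoundaryPath} {α : List L} {A : B} (hA : A ∈ X.wordIdeal α) :
    A ∈ (specOfPath μ).mem α ↔ μ ∈ X.N α A :=
  ⟨fun h => h.2, fun h => ⟨hA, h⟩⟩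

end GBDS

/-! ### The boundary path space is in bijection with the spectrum. -/

namespace GBDS

variable {B : Type u} [GeneralizedBooleanAlgebra B] {L : Type v} {X : GBDS B L}

open BoundaryPath

theorem BoundaryPath.exists_hasPrefix {μ : X.BoundaryPath} {n : ℕ} {e : X.E1}
    (h : μ.edge? n = some e) : ∃ α : List L, α.length = n ∧ μ.HasPrefix (α ++ [e.1]) := by
  induction n generalizing e with
  | zero => exact ⟨[], rfl, hasPrefix_append.2 ⟨μ.hasPrefix_nil, e, h, rfl⟩⟩
  | succ n ih =>
    obtain ⟨e', he', -⟩ := exists_edge? h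
    obtain ⟨α, rfl, hα⟩ := ih he'
    exact ⟨α ++ [e'.1], by simp, hasPrefix_append.2 ⟨hα, e, by simpa using h, rfl⟩⟩

theorem edge?_of_specOfPath_eq {μ ν : X.BoundaryPath} (h : specOfPath μ = specOfPath ν) {n : ℕ}
    {e : X.E1} (he : μ.edge? n = some e) : ν.edge? n = some e := by
  obtain ⟨α, rfl, hα⟩ := exists_hasPrefix he
  have hN : ∀ A ∈ X.wordIdeal (α ++ [e.1]), A ∈ e.2.1 → ν ∈ X.N (α ++ [e.1]) A := by
    intro A hA hAe
    rw [← mem_specOfPath hA, ← h, mem_specOfPath hA, mem_N_iff, List.length_append,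
      List.length_singleton]
    exact ⟨hα, (mem_level_succ he).2 hAe⟩
  obtain ⟨A, hA, hAl⟩ := level_nonempty hα
  rw [List.length_append, List.length_singleton, mem_level_succ he] at hAl
  obtain ⟨-, e', he', hlabel⟩ := hasPrefix_append.1 (mem_N_iff.1 (hN A hA hAl)).1
  rw [he']
  obtain ⟨a, η⟩ := e
  obtain ⟨a', η'⟩ := e'
  obtain rfl : a' = a := hlabel
  congr 2
  -- The spectrum sees only members of the word ideal, so `C` is tested through `C ⊓ A`; maximality
  -- turns the inclusion into equality.
  refine (StoneDual.eq_of_subset fun C hC => ?_).symm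
  have h1 := (mem_N_iff.1 (hN (C ⊓ A) (X.wordIdeal_mono inf_le_right hA) (η.2.1.inf_mem hC hAl))).2
  rw [List.length_append, List.length_singleton, mem_level_succ he'] at h1
  exact η'.upper h1 (η.mem_J hC) inf_le_left

theorem specOfPath_injective : Function.Injective (specOfPath : X.BoundaryPath → X.Spec) := by
  intro μ ν h
  refine ext_of_edge? (X.F0mem_injective (Set.ext fun A => ?_)) fun i => ?_
  · have h1 := mem_specOfPath (μ := μ) (X.mem_wordIdeal_nil A)
    rw [h, mem_specOfPath (X.mem_wordIdeal_nil A)] at h1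
    exact h1.symm
  · rcases hμ : μ.edge? i with _ | e
    · rcases hν : ν.edge? i with _ | e
      · rfl
      · rw [edge?_of_specOfPath_eq h.symm hν] at hμ
        cases hμ
    · exact (edge?_of_specOfPath_eq h hμ).symm

namespace Spec

variable (w : X.Spec)

/-- The ultrafilter of a larger ideal generated by a nonempty value of a point of the spectrum. -/
def ultra (α : List L) (h : ∃ A, A ∈ w.mem α) (J : Order.Ideal B)
    (hJ : ∀ A ∈ w.mem α, A ∈ J) : StoneDual J :=
  ⟨{C | C ∈ J ∧ ∃ D ∈ w.mem α, D ≤ C}, by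
    refine IsFilterIn.isUltrafilterIn ⟨fun C hC => hC.1, ?_, ?_, ?_, ?_⟩ fun C _ => ?_
    · obtain ⟨A, hA⟩ := h
      exact ⟨A, hJ A hA, A, hA, le_rfl⟩
    · rintro ⟨-, D, hD, hle⟩
      exact w.bot_notMem _ (le_bot_iff.1 hle ▸ hD)
    · rintro C ⟨-, D, hD, hle⟩ C' hC' hCC'
      exact ⟨hC', D, hD, hle.trans hCC'⟩
    · rintro C ⟨hC, D, hD, hle⟩ C' ⟨-, D', hD', hle'⟩
      exact ⟨C ⊓ C', ⟨J.lower inf_le_left hC, D ⊓ D', w.inf hD hD', inf_le_inf hle hle'⟩,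
        inf_le_left, inf_le_right⟩
    · obtain ⟨A, hA⟩ := h
      have hA' : A ⊓ C ⊔ A \ C ∈ w.mem α := by rwa [sup_inf_sdiff]
      refine ⟨A, (w.prime hA').imp (fun h => ?_) fun h => ?_⟩
      · exact ⟨hJ _ h, _, h, le_rfl⟩
      · exact ⟨hJ _ h, _, h, le_rfl⟩⟩

/-- This is the condition that consecutive edges match: the left side describes `r` of the edge over
`α b`, the right side `d` of the edge over `α`, or the initial vertex if `α` is empty. -/
theorem exists_le_θ_iff {α : List L} {b : L} (h : ∃ A, A ∈ w.mem (α ++ [b])) {A : B} :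
    (∃ D ∈ w.mem (α ++ [b]), D ≤ X.θ b A) ↔ ∃ E ∈ w.mem α, E ≤ A := by
  constructor
  · rintro ⟨D, hD, hle⟩
    by_cases hα : α = []
    · subst hα
      exact ⟨A, w.upper_of_append (α := []) (β := [b]) trivial hD hle, le_rfl⟩
    · obtain ⟨E, hE, hDE⟩ := w.nonempty_of_append hα hD
      refine ⟨E ⊓ A, w.upper_of_append (X.wordIdeal_mono inf_le_left (w.mem_wordIdeal hE)) hD ?_,
        inf_le_right⟩
      rw [X.θWord_inf]
      exact le_inf hDE hle
  · rintro ⟨E, hE, hle⟩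
    obtain ⟨D, hD⟩ := h
    exact ⟨_, w.θWord_inf_mem hE hD, inf_le_right.trans (X.θ_mono b hle)⟩

/-- The last edge of the path over a word `α b`. -/
def lastEdge (α : List L) (b : L) (h : ∃ A, A ∈ w.mem (α ++ [b])) : X.E1 :=
  ⟨b, w.ultra (α ++ [b]) h (X.I b) fun _ hA => X.mem_I_of_mem_wordIdeal (w.mem_wordIdeal hA)⟩

open Classical in
/-- The edges of the path of a point of the spectrum. -/
noncomputable def edges (n : ℕ) : Option X.E1 :=
  if h : ∃ p : List L × L, p.1.length = n ∧ ∃ A, A ∈ w.mem (p.1 ++ [p.2]) then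
    some (w.lastEdge h.choose.1 h.choose.2 h.choose_spec.2)
  else none

/-- Words with nonempty value are prefixes of one another, so there is at most one of each length
and the choice in `edges` is harmless. -/
theorem edges_eq_some {α : List L} {b : L} (h : ∃ A, A ∈ w.mem (α ++ [b])) :
    w.edges α.length = some (w.lastEdge α b h) := by
  have hex : ∃ p : List L × L, p.1.length = α.length ∧ ∃ A, A ∈ w.mem (p.1 ++ [p.2]) :=
    ⟨(α, b), rfl, h⟩
  rw [edges, dif_pos hex]
  have key : ∀ (p : List L × L) (hp : ∃ A, A ∈ w.mem (p.1 ++ [p.2])), p = (α, b) →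
      w.lastEdge p.1 p.2 hp = w.lastEdge α b h := by
    rintro p hp rfl
    rfl
  refine congrArg some (key _ _ ?_)
  obtain ⟨hl, A, hA⟩ := hex.choose_spec
  obtain ⟨A', hA'⟩ := h
  have : hex.choose.1 ++ [hex.choose.2] = α ++ [b] := by
    rcases w.prefix_or_prefix hA hA' with h | h
    · exact h.eq_of_length (by simp [hl])
    · exact (h.eq_of_length (by simp [hl])).symm
  obtain ⟨h1, h2⟩ := List.append_inj' this rfl
  exact Prod.ext h1 (List.singleton_injective h2)

theorem exists_of_edges_eq_some {n : ℕ} {e : X.E1} (he : w.edges n = some e) :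
    ∃ α b h, α.length = n ∧ e = w.lastEdge α b h := by
  unfold edges at he
  split_ifs at he with h
  exact ⟨_, _, h.choose_spec.2, h.choose_spec.1, (Option.some.inj he).symm⟩

open Classical in
/-- The range vertex of the path of a point of the spectrum. -/
noncomputable def vertex : X.F0 :=
  if h : ∃ A, A ∈ w.mem [] then
    OnePoint.some (X := X.E0) (w.ultra [] h ⊤ fun _ _ => trivial)
  else OnePoint.infty

theorem mem_F0mem_vertex {A : B} : A ∈ X.F0mem w.vertex ↔ ∃ D ∈ w.mem [], D ≤ A := by
  unfold vertex
  split_ifs with h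
  · exact ⟨fun h => h.2, fun h => ⟨trivial, h⟩⟩
  · exact ⟨fun h => h.elim, fun ⟨D, hD, _⟩ => absurd ⟨D, hD⟩ h⟩

theorem exists_boundaryPath :
    ∃ μ : X.BoundaryPath, μ.range = w.vertex ∧ ∀ i, μ.edge? i = w.edges i := by
  have hne : ∀ {α : List L} {b : L} {A : B}, A ∈ w.mem (α ++ [b]) → w.edges α.length ≠ none :=
    fun hA h => by
      rw [w.edges_eq_some ⟨_, hA⟩] at h
      cases h
  refine exists_of_edges _ _ ?_ ?_ ?_ ?_
  · intro e he
    obtain ⟨α, b, h, hl, rfl⟩ := w.exists_of_edges_eq_some he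
    obtain rfl := List.length_eq_zero_iff.1 hl
    refine X.F0mem_injective (Set.ext fun A => ?_)
    rw [mem_F0mem_vertex, X.mem_F0mem_r, ← w.exists_le_θ_iff h]
    exact ⟨fun h => ⟨X.θ_mem _ _, h⟩, fun h => h.2⟩
  · intro i e' he'
    obtain ⟨α, b, h, hl, rfl⟩ := w.exists_of_edges_eq_some he'
    obtain ⟨A, hA⟩ := h
    rcases List.eq_nil_or_concat' α with rfl | ⟨β, c, rfl⟩
    · simp at hl
    · obtain ⟨E, hE, -⟩ := w.nonempty_of_append (by simp) hA
      obtain rfl : β.length = i := by simpa using hl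
      refine ⟨_, w.edges_eq_some ⟨E, hE⟩, X.F0mem_injective (Set.ext fun C => ?_)⟩
      rw [X.mem_F0mem_r, F0mem_coe]
      refine Iff.trans ?_ ((w.exists_le_θ_iff ⟨A, hA⟩).symm.trans
        ⟨fun h => ⟨X.θ_mem _ _, h⟩, fun h => h.2⟩)
      constructor
      · rintro ⟨D, ⟨-, D', hD', hle⟩, hDC⟩
        exact ⟨D', hD', hle.trans hDC⟩
      · rintro ⟨D, hD, hle⟩
        exact ⟨D, ⟨X.mem_I_of_mem_wordIdeal (w.mem_wordIdeal hD), D, hD, le_rfl⟩, hle⟩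
  · intro h0
    -- A nonempty word with nonempty value would give a first edge, so the value at the empty word
    -- is nonempty.
    have hex : ∃ A, A ∈ w.mem [] := by
      obtain ⟨α, A, hA⟩ := w.nonempty
      cases α with
      | nil => exact ⟨A, hA⟩
      | cons a α =>
        obtain ⟨E, hE, -⟩ := w.nonempty_of_append (α := [a]) (β := α) (by simp) hA
        exact absurd h0 (hne (α := []) hE)
    refine ⟨_, dif_pos hex, X.mem_E0sg_iff.2 ?_⟩
    rintro A ⟨-, D, hD, hle⟩ hreg
    obtain ⟨b, hb⟩ := w.regular hD (IsRegular.mono X hle hreg)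
    exact hne hb h0
  · intro i e he hnone
    obtain ⟨α, b, h, rfl, rfl⟩ := w.exists_of_edges_eq_some he
    refine X.mem_E0sg_iff.2 ?_
    rintro A ⟨C, ⟨-, D, hD, hle⟩, hCA⟩ hreg
    -- A regular set at the endpoint would yield one more edge.
    obtain ⟨c, hc⟩ := w.regular hD (IsRegular.mono X (hle.trans hCA) hreg)
    have := hne hc
    rw [List.length_append] at this
    exact this hnone

theorem hasPrefix_of_mem {μ : X.BoundaryPath} (hμ : ∀ i, μ.edge? i = w.edges i) {α : List L}
    {A : B} (hA : A ∈ w.mem α) : μ.HasPrefix α := by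
  induction α using List.reverseRecOn generalizing A with
  | nil => exact μ.hasPrefix_nil
  | append_singleton α b ih =>
    refine hasPrefix_append.2 ⟨?_, _, (hμ _).trans (w.edges_eq_some ⟨A, hA⟩), rfl⟩
    by_cases hα : α = []
    · subst hα
      exact μ.hasPrefix_nil
    · obtain ⟨E, hE, -⟩ := w.nonempty_of_append hα hA
      exact ih hE

theorem mem_of_hasPrefix {μ : X.BoundaryPath} (hμ : ∀ i, μ.edge? i = w.edges i) {α : List L}
    {b : L} (h : μ.HasPrefix (α ++ [b])) : ∃ A, A ∈ w.mem (α ++ [b]) := by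
  obtain ⟨hα, e, he, rfl⟩ := hasPrefix_append.1 h
  obtain ⟨β, c, ⟨A, hA⟩, hl, rfl⟩ := w.exists_of_edges_eq_some ((hμ _).symm.trans he)
  have hβ := (hasPrefix_append.1 (w.hasPrefix_of_mem hμ hA)).1
  obtain rfl : β = α := by
    refine List.ext_getElem hl fun i h1 h2 => ?_
    obtain ⟨e₁, he₁, h3⟩ := hβ i h1
    obtain ⟨e₂, he₂, h4⟩ := hα i h2
    rw [← h3, ← h4, Option.some.inj (he₁.symm.trans he₂)]
  exact ⟨A, hA⟩

end Spec

theorem specOfPath_surjective : Function.Surjective (specOfPath : X.BoundaryPath → X.Spec) := by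
  intro w
  obtain ⟨μ, hr, hμ⟩ := w.exists_boundaryPath
  refine ⟨μ, Spec.ext (funext fun α => Set.ext fun A => ?_)⟩
  -- At the empty word no member is required: if the value there is empty, the vertex is `∞` and
  -- both sides are false.
  have key : A ∈ X.wordIdeal α → (∃ D, D ∈ w.mem α) ∨ α = [] →
      (A ∈ μ.level α.length ↔ A ∈ w.mem α) := by
    intro hA hne
    have hup : A ∈ w.mem α ↔ ∃ D ∈ w.mem α, D ≤ A :=
      ⟨fun h => ⟨A, h, le_rfl⟩, fun ⟨D, hD, hle⟩ => w.upper hD hA hle⟩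
    rcases List.eq_nil_or_concat' α with rfl | ⟨β, b, rfl⟩
    · change A ∈ X.F0mem μ.range ↔ _
      rw [hr, w.mem_F0mem_vertex, hup]
    · have hne' := hne.resolve_right (by simp)
      rw [List.length_append, List.length_singleton,
        mem_level_succ ((hμ _).trans (w.edges_eq_some hne')), hup]
      exact ⟨fun h => h.2, fun h => ⟨X.mem_I_of_mem_wordIdeal hA, h⟩⟩
  constructor
  · rintro ⟨hA, h⟩
    rw [mem_N_iff] at h
    refine (key hA ?_).1 h.2
    rcases List.eq_nil_or_concat' α with rfl | ⟨β, b, rfl⟩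
    · exact Or.inr rfl
    · exact Or.inl (w.mem_of_hasPrefix hμ h.1)
  · intro hA
    have hI := w.mem_wordIdeal hA
    exact ⟨hI, mem_N_iff.2 ⟨w.hasPrefix_of_mem hμ hA, (key hI (Or.inl ⟨A, hA⟩)).2 hA⟩⟩

variable (X) in
/-- The boundary path space is the combinatorial spectrum. -/
noncomputable def pathEquivSpec : X.BoundaryPath ≃ X.Spec :=
  Equiv.ofBijective specOfPath ⟨specOfPath_injective, specOfPath_surjective⟩

end GBDS

/-! ### Compact open cylinders and the topology of the boundary path space. -/

theorem StoneDual.isOpen_basic' {B : Type u} [GeneralizedBooleanAlgebra B] {J : Order.Ideal B}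
    (A : B) : IsOpen (StoneDual.basic J A) := by
  by_cases h : A ∈ J
  · exact isOpen_basic h
  · rw [show basic J A = ∅ from Set.eq_empty_of_forall_notMem fun ξ hξ => h (ξ.mem_J hξ)]
    exact isOpen_empty

theorem StoneDual.exists_le_of_finite {B : Type u} [GeneralizedBooleanAlgebra B]
    {J : Order.Ideal B} (ξ : StoneDual J) {ι : Type*} (s : Finset ι) {f : ι → B}
    (hf : ∀ i, f i ∈ ξ.1) : ∃ A ∈ ξ.1, ∀ i ∈ s, A ≤ f i := by
  classical
  induction s using Finset.induction_on with
  | empty =>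
    obtain ⟨A, hA⟩ := ξ.2.1.nonempty
    exact ⟨A, hA, by simp⟩
  | insert i s _ ih =>
    obtain ⟨A, hA, hle⟩ := ih
    refine ⟨A ⊓ f i, ξ.2.1.inf_mem hA (hf i), fun j hj => ?_⟩
    rcases Finset.mem_insert.1 hj with rfl | hj
    · exact inf_le_right
    · exact inf_le_left.trans (hle j hj)

theorem IsClopen.setOf_iff {Y : Type*} [TopologicalSpace Y] {s t : Set Y} (hs : IsClopen s)
    (ht : IsClopen t) : IsClosed {y | y ∈ s ↔ y ∈ t} := by
  have : {y | y ∈ s ↔ y ∈ t} = (s ∩ t) ∪ (sᶜ ∩ tᶜ) := by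
    ext y
    simp only [Set.mem_ofPred_eq, Set.mem_union, Set.mem_inter_iff, Set.mem_compl_iff]
    tauto
  rw [this]
  exact (hs.inter ht).isClosed.union (hs.compl.inter ht.compl).isClosed

namespace GBDS

variable {B : Type u} [GeneralizedBooleanAlgebra B] {L : Type v} (X : GBDS B L)

theorem continuous_edge (n : ℕ) (j : Fin (n + 1)) :
    Continuous fun p : X.FinPath (n + 1) => p.1 j :=
  (continuous_apply j).comp continuous_subtype_val

instance instT2SpaceFinPath : (n : ℕ) → T2Space (X.FinPath n)
  | 0 => inferInstanceAs (T2Space (ULift.{v} X.E0))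
  | n + 1 => inferInstanceAs (T2Space {p : Fin (n + 1) → X.E1 //
      ∀ i : Fin n, (X.d (p i.castSucc) : X.F0) = X.r (p i.succ)})

/-- The finite paths with label `α` and `A` in the ultrafilter of the last edge. -/
def finCyl : List L → B → Set X.FinPaths
  | [], A => {x | ∃ v : X.E0, x = ⟨0, ULift.up v⟩ ∧ A ∈ v.1}
  | a :: α, A => {x | ∃ p : X.FinPath (α.length + 1), x = ⟨_, p⟩ ∧
      (∀ j, (p.1 j).1 = (a :: α).get j) ∧ A ∈ (p.1 (Fin.last _)).2.1}

theorem cyl_finCyl (α : List L) (A : B) : X.cyl (X.finCyl α A) = X.N α A := by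
  ext μ
  cases α with
  | nil =>
    constructor
    · rintro (⟨v, hv, v', h, hA⟩ | ⟨n, p, ⟨v', h, hA⟩, -⟩)
      · cases h
        change A ∈ X.F0mem μ.range
        rwa [hv]
      · cases h
    · intro h
      change A ∈ X.F0mem μ.range at h
      obtain ⟨v, hA, hv⟩ := X.mem_coe_image_basic.2 h
      exact Or.inl ⟨v, hv.symm, v, rfl, hA⟩
  | cons a α =>
    constructor
    · rintro (⟨v, hv, v', h, hA⟩ | ⟨n, p, ⟨p', h, h1, h2⟩, h3⟩)
      · cases h
      · cases h
        exact ⟨p'.1, h3, h1, h2⟩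
    · rintro ⟨e, h1, h2, h3⟩
      refine Or.inr ⟨α.length, ⟨e, fun i => ?_⟩, ⟨_, rfl, h2, h3⟩, h1⟩
      obtain ⟨e₀, he₀, hd⟩ := BoundaryPath.exists_edge? (h1 i.succ)
      rw [← hd]
      congr 2
      exact Option.some.inj ((h1 i.castSucc).symm.trans he₀)

theorem isOpen_finCyl (α : List L) (A : B) : IsOpen (X.finCyl α A) := by
  cases α with
  | nil =>
    have : X.finCyl [] A = Sigma.mk 0 '' ((ULift.down : X.FinPath 0 → X.E0) ⁻¹'
        StoneDual.basic ⊤ A) := by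
      ext x
      constructor
      · rintro ⟨v, rfl, hA⟩
        exact ⟨ULift.up v, hA, rfl⟩
      · rintro ⟨v, hA, rfl⟩
        exact ⟨v.down, rfl, hA⟩
    rw [this]
    exact isOpenMap_sigmaMk _ ((StoneDual.isOpen_basic' A).preimage continuous_uliftDown)
  | cons a α =>
    have : X.finCyl (a :: α) A = Sigma.mk (α.length + 1) ''
        {p : X.FinPath (α.length + 1) | (∀ j, (p.1 j).1 = (a :: α).get j) ∧
          A ∈ (p.1 (Fin.last _)).2.1} := by
      ext x
      constructor
      · rintro ⟨p, rfl, h⟩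
        exact ⟨p, h, rfl⟩
      · rintro ⟨p, h, rfl⟩
        exact ⟨p, rfl, h⟩
    rw [this]
    refine isOpenMap_sigmaMk _ (IsOpen.inter
      (s := {p : X.FinPath (α.length + 1) | ∀ j, (p.1 j).1 = (a :: α).get j}) ?_ ?_)
    · rw [Set.ofPred_forall]
      refine isOpen_iInter_of_finite fun j => ?_
      have h : IsOpen {e : X.E1 | e.1 = (a :: α).get j} := by
        refine isOpen_sigma_iff.2 fun b => ?_
        by_cases hb : b = (a :: α).get j
        · convert isOpen_univ
          exact Set.eq_univ_of_forall fun _ => hb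
        · convert isOpen_empty
          exact Set.eq_empty_of_forall_notMem fun _ h => hb h
      exact h.preimage (X.continuous_edge _ j)
    · have h : IsOpen {e : X.E1 | A ∈ e.2.1} :=
        isOpen_sigma_iff.2 fun b => StoneDual.isOpen_basic' A
      exact h.preimage (X.continuous_edge _ (Fin.last _))

theorem θWord_take_succ {a : L} {α : List L} (C : B) (j : Fin α.length) :
    X.θWord (α.take (j + 1)) C = X.θ ((a :: α).get j.succ) (X.θWord (α.take j) C) := by
  rw [List.take_succ_eq_append_getElem j.2, X.θWord_append]
  rfl

/-- Membership of `A` in the last ultrafilter forces `D j`, the image of `C` under the letters up to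
index `j`, into the ultrafilter of edge `j`. The paths thus lie in a product of compact sets `Z(D
j)`, cut out by closed conditions. -/
theorem isCompact_finCyl {α : List L} {A : B} (hA : A ∈ X.wordIdeal α) :
    IsCompact (X.finCyl α A) := by
  cases α with
  | nil =>
    have : X.finCyl [] A = (fun v : X.E0 => (⟨0, ULift.up v⟩ : X.FinPaths)) ''
        StoneDual.basic ⊤ A := by
      ext x
      constructor
      · rintro ⟨v, rfl, hA⟩
        exact ⟨v, hA, rfl⟩
      · rintro ⟨v, hA, rfl⟩
        exact ⟨v, rfl, hA⟩
    rw [this]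
    refine (StoneDual.isCompact_basic A).image ?_
    exact (continuous_sigmaMk (σ := X.FinPath) (i := 0)).comp continuous_uliftUp
  | cons a α =>
    obtain ⟨C, hC, hle⟩ := hA
    let P := ∀ j : Fin (α.length + 1), StoneDual (X.I ((a :: α).get j))
    let D : Fin (α.length + 1) → B := fun j => X.θWord (α.take j) C
    have hD : ∀ j : Fin α.length, D j.succ = X.θ ((a :: α).get j.succ) (D j.castSucc) :=
      fun j => X.θWord_take_succ C j
    have hDmem : ∀ j, D j ∈ X.I ((a :: α).get j) := by
      intro j
      induction j using Fin.cases with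
      | zero => exact hC
      | succ j =>
        rw [hD]
        exact X.θ_mem _ _
    have hDlast : A ≤ D (Fin.last _) := by
      simpa [D] using hle
    let S : Set P := {η | A ∈ (η (Fin.last _)).1 ∧ ∀ j : Fin α.length,
      (X.d ⟨_, η j.castSucc⟩ : X.F0) = X.r ⟨_, η j.succ⟩}
    -- Backwards from the last edge: the matching condition `d = r` turns `θ(D j)` in the next
    -- ultrafilter into `D j` in this one.
    have hpi : ∀ η ∈ S, ∀ j, D j ∈ (η j).1 := by
      rintro η ⟨h1, h2⟩ j
      induction j using Fin.reverseInduction with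
      | last => exact (η _).upper h1 (hDmem _) hDlast
      | cast j ih =>
        rw [hD] at ih
        rw [← X.mem_d (e := ⟨_, η j.castSucc⟩) (hDmem _), ← F0mem_coe, h2, X.mem_F0mem_r]
        exact ih
    -- `E` need not lie in the ideal of the edge. Given that `D j` is a member, membership of `E` in
    -- `d` is a condition on `D j ⊓ E`, which does lie there, and so is clopen.
    have hlink : ∀ η : P, ∀ j : Fin α.length, D j.castSucc ∈ (η j.castSucc).1 → ∀ E,
        (E ∈ (X.d ⟨_, η j.castSucc⟩).1 ↔ D j.castSucc ⊓ E ∈ (η j.castSucc).1) := by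
      intro η j hj E
      constructor
      · rintro ⟨F, hF, hFE⟩
        exact (η _).upper ((η _).2.1.inf_mem hj hF) ((X.I _).lower inf_le_left (hDmem _))
          (inf_le_inf_left _ hFE)
      · intro h
        exact ⟨_, h, inf_le_right⟩
    have hS : S = (Set.univ.pi fun j => StoneDual.basic (X.I ((a :: α).get j)) (D j)) ∩
        ({η | A ∈ (η (Fin.last _)).1} ∩ ⋂ j : Fin α.length, ⋂ E : B,
          {η | η ∈ {η : P | D j.castSucc ⊓ E ∈ (η j.castSucc).1} ↔
            η ∈ {η : P | X.θ ((a :: α).get j.succ) E ∈ (η j.succ).1}}) := by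
      ext η
      simp only [Set.mem_inter_iff, Set.mem_iInter]
      constructor
      · intro hη
        refine ⟨fun j _ => hpi η hη j, hη.1, fun j E => ?_⟩
        change D j.castSucc ⊓ E ∈ (η j.castSucc).1 ↔ X.θ ((a :: α).get j.succ) E ∈ (η j.succ).1
        rw [← hlink η j (hpi η hη _), ← F0mem_coe, hη.2 j, X.mem_F0mem_r]
      · rintro ⟨h1, h2, h3⟩
        refine ⟨h2, fun j => X.F0mem_injective (Set.ext fun E => ?_)⟩
        rw [F0mem_coe, hlink η j (h1 _ trivial), X.mem_F0mem_r]
        exact h3 j E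
    have hcl : ∀ j (E : B), E ∈ X.I ((a :: α).get j) → IsClopen {η : P | E ∈ (η j).1} :=
      fun j E hE => (StoneDual.isClopen_basic hE).preimage (continuous_apply j)
    have hSc : IsCompact S := by
      rw [hS]
      refine (isCompact_univ_pi fun j => StoneDual.isCompact_basic (D j)).inter_right ?_
      refine IsClosed.inter ?_ (isClosed_iInter fun j => isClosed_iInter fun E =>
        (hcl _ _ ((X.I _).lower inf_le_left (hDmem _))).setOf_iff (hcl _ _ (X.θ_mem _ _)))
      exact (hcl _ _ ((X.I _).lower hDlast (hDmem _))).isClosed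
    have : CompactSpace S := isCompact_iff_compactSpace.1 hSc
    -- The labels are fixed, so the paths are the continuous image of the families of ultrafilters
    -- in `S`.
    let g : S → X.FinPath (α.length + 1) := fun η => ⟨fun j => ⟨_, η.1 j⟩, η.2.2⟩
    have hg₀ : Continuous fun (η : S) j => (⟨(a :: α).get j, η.1 j⟩ : X.E1) :=
      continuous_pi fun j =>
        continuous_sigmaMk.comp ((continuous_apply j).comp continuous_subtype_val)
    have hg : Continuous g := hg₀.subtype_mk _
    convert isCompact_range ((continuous_sigmaMk (σ := X.FinPath) (i := α.length + 1)).comp hg)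
    ext x
    constructor
    · rintro ⟨p, rfl, h1, h2⟩
      have h3 : ∀ j, ∃ η : StoneDual (X.I ((a :: α).get j)), p.1 j = ⟨_, η⟩ := fun j => by
        have := h1 j
        rcases hp : p.1 j with ⟨b, η⟩
        rw [hp] at this
        change b = _ at this
        subst this
        exact ⟨η, rfl⟩
      choose η hη using h3
      have hηS : η ∈ S := by
        refine ⟨?_, fun j => ?_⟩
        · rw [hη] at h2
          exact h2
        · rw [← hη, ← hη]
          exact p.2 j
      refine ⟨⟨η, hηS⟩, congrArg (Sigma.mk _) (Subtype.ext (funext fun j => (hη j).symm))⟩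
    · rintro ⟨η, rfl⟩
      exact ⟨_, rfl, fun j => rfl, η.2.1⟩

/-- The witness is the image of `C` under the later letters; for paths with the same labels,
membership can be traced back along the matching conditions. -/
theorem exists_mem_last_of_mem {n : ℕ} (p : X.FinPath (n + 1)) (j : Fin (n + 1)) {C : B}
    (hC : C ∈ (p.1 j).2.1) : ∃ A ∈ (p.1 (Fin.last n)).2.1, ∀ q : X.FinPath (n + 1),
      (∀ i, (q.1 i).1 = (p.1 i).1) → A ∈ (q.1 (Fin.last n)).2.1 → C ∈ (q.1 j).2.1 := by
  induction j using Fin.reverseInduction generalizing C with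
  | last => exact ⟨C, hC, fun q _ h => h⟩
  | cast j ih =>
    have hI := (p.1 j.castSucc).2.mem_J hC
    have h1 : X.θ (p.1 j.succ).1 C ∈ (p.1 j.succ).2.1 := by
      rw [← X.mem_F0mem_r, ← p.2 j, F0mem_coe, X.mem_d hI]
      exact hC
    obtain ⟨A, hA, h2⟩ := ih h1
    refine ⟨A, hA, fun q hq hAq => ?_⟩
    have h3 := h2 q hq hAq
    rw [← hq] at h3 hI
    rwa [← X.mem_d hI, ← F0mem_coe, q.2 j, X.mem_F0mem_r]

theorem exists_mem_last_wordIdeal {a : L} {α : List L} (p : X.FinPath (α.length + 1))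
    (hp : ∀ j, (p.1 j).1 = (a :: α).get j) :
    ∃ A ∈ (p.1 (Fin.last _)).2.1, A ∈ X.wordIdeal (a :: α) := by
  obtain ⟨C, hC⟩ := (p.1 0).2.2.1.nonempty
  have hCa : C ∈ X.I a := by
    have := (p.1 0).2.mem_J hC
    rwa [hp 0] at this
  have key : ∀ j : Fin (α.length + 1), X.θWord (α.take j) C ∈ (p.1 j).2.1 := by
    intro j
    induction j using Fin.induction with
    | zero => exact hC
    | succ j ih =>
      have hI := (p.1 j.castSucc).2.mem_J ih
      have h1 := X.θWord_take_succ (a := a) C j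
      rw [Fin.val_succ, h1, ← hp, ← X.mem_F0mem_r, ← p.2 j, F0mem_coe, ← Fin.val_castSucc,
        X.mem_d hI]
      exact ih
  refine ⟨_, key (Fin.last _), C, hCa, ?_⟩
  simp

/-- A basic neighbourhood constrains each edge separately. Every constraint is moved to the last
edge, where finitely many of them are met by one set. -/
theorem exists_finCyl_subset {U : Set X.FinPaths} (hU : IsOpen U) {x : X.FinPaths} (hx : x ∈ U) :
    ∃ α, ∃ A ∈ X.wordIdeal α, x ∈ X.finCyl α A ∧ X.finCyl α A ⊆ U := by
  obtain ⟨n, p⟩ := x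
  cases n with
  | zero =>
    have hc : Continuous fun v : X.E0 => (⟨0, ULift.up v⟩ : X.FinPaths) :=
      (continuous_sigmaMk (σ := X.FinPath) (i := 0)).comp continuous_uliftUp
    obtain ⟨A, hA, hsub⟩ := StoneDual.mem_nhds_iff.1
      ((hU.preimage hc).mem_nhds (show p.down ∈ _ from hx))
    refine ⟨[], A, trivial, ⟨p.down, rfl, hA⟩, ?_⟩
    rintro _ ⟨v, rfl, hv⟩
    exact hsub hv
  | succ n =>
    obtain ⟨a, α, rfl, hp⟩ : ∃ (a : L) (α : List L) (h : α.length = n),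
        ∀ j : Fin (n + 1), (p.1 j).1 = (a :: α).get (j.cast (by simp [h])) := by
      refine ⟨(p.1 0).1, List.ofFn fun j : Fin n => (p.1 j.succ).1, by simp, fun j => ?_⟩
      induction j using Fin.cases with
      | zero => rfl
      | succ j => simp
    replace hp : ∀ j, (p.1 j).1 = (a :: α).get j := hp
    have h1 : (Sigma.mk (α.length + 1) : X.FinPath (α.length + 1) → X.FinPaths) ⁻¹' U ∈ 𝓝 p :=
      (hU.preimage continuous_sigmaMk).mem_nhds hx
    have h2 : 𝓝 p = Filter.comap Subtype.val (𝓝 p.1) := nhds_subtype _ _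
    rw [h2] at h1
    obtain ⟨T, hT, hTU⟩ := Filter.mem_comap.1 h1
    rw [nhds_pi, Filter.mem_pi] at hT
    obtain ⟨I, -, t, ht, htT⟩ := hT
    have h3 : ∀ j, ∃ C ∈ (p.1 j).2.1, ∀ e : X.E1, e.1 = (p.1 j).1 → C ∈ e.2.1 → e ∈ t j := by
      intro j
      have h4 := ht j
      generalize p.1 j = e₀ at h4 ⊢
      obtain ⟨b, η⟩ := e₀
      rw [Sigma.nhds_mk, Filter.mem_map] at h4
      obtain ⟨C, hC, hsub⟩ := StoneDual.mem_nhds_iff.1 h4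
      refine ⟨C, hC, ?_⟩
      rintro ⟨b', η'⟩ hb hC'
      obtain rfl : b' = b := hb
      exact hsub hC'
    choose C hC hCt using h3
    choose F hF hF' using fun j => X.exists_mem_last_of_mem p j (hC j)
    obtain ⟨A₀, hA₀, hle⟩ := (p.1 (Fin.last _)).2.exists_le_of_finite Finset.univ hF
    -- Meeting with `A₁` brings the set into the ideal of the whole word.
    obtain ⟨A₁, hA₁, hA₁I⟩ := X.exists_mem_last_wordIdeal p hp
    refine ⟨a :: α, A₀ ⊓ A₁, X.wordIdeal_mono inf_le_right hA₁I,
      ⟨p, rfl, hp, (p.1 _).2.2.1.inf_mem hA₀ hA₁⟩, ?_⟩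
    rintro _ ⟨q, rfl, hq, hAq⟩
    have hlabel : ∀ i, (q.1 i).1 = (p.1 i).1 := fun i => (hq i).trans (hp i).symm
    refine hTU (htT fun j _ => hCt j _ (hlabel j) (hF' j q hlabel ?_))
    refine (q.1 _).2.upper hAq ?_ (inf_le_left.trans (hle j (Finset.mem_univ j)))
    rw [hlabel]
    exact (p.1 _).2.mem_J (hF j)

theorem mem_cyl_iff {S : Set X.FinPaths} {μ : X.BoundaryPath} :
    μ ∈ X.cyl S ↔ ∃ x ∈ S, μ ∈ X.cyl {x} := by
  constructor
  · rintro (⟨v, hv, hS⟩ | ⟨n, p, hS, hp⟩)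
    · exact ⟨_, hS, Or.inl ⟨v, hv, rfl⟩⟩
    · exact ⟨_, hS, Or.inr ⟨n, p, rfl, hp⟩⟩
  · rintro ⟨x, hx, ⟨v, hv, hS⟩ | ⟨n, p, hS, hp⟩⟩
    · exact Or.inl ⟨v, hv, hS ▸ hx⟩
    · exact Or.inr ⟨n, p, hS ▸ hx, hp⟩

theorem cyl_mono {S T : Set X.FinPaths} (h : S ⊆ T) : X.cyl S ⊆ X.cyl T := fun μ hμ => by
  rw [mem_cyl_iff] at hμ ⊢
  obtain ⟨x, hx, hμ⟩ := hμ
  exact ⟨x, h hx, hμ⟩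

theorem cyl_univ : X.cyl Set.univ = Set.univ := by
  refine Set.eq_univ_of_forall fun μ => ?_
  rcases h : μ.edge? 0 with _ | e
  · obtain ⟨v, hv, -⟩ := BoundaryPath.exists_range_mem_E0sg h
    exact Or.inl ⟨v, hv, trivial⟩
  · refine Or.inr ⟨0, ⟨fun _ => e, fun i => i.elim0⟩, trivial, fun j => ?_⟩
    rw [Fin.fin_one_eq_zero j]
    exact h

theorem cyl_empty : X.cyl ∅ = ∅ := by
  refine Set.eq_empty_of_forall_notMem fun μ hμ => ?_
  obtain ⟨x, hx, -⟩ := X.mem_cyl_iff.1 hμ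
  exact hx

theorem isClopen_N {α : List L} {A : B} (hA : A ∈ X.wordIdeal α) : IsClopen (X.N α A) := by
  rw [← cyl_finCyl]
  constructor
  · rw [← isOpen_compl_iff]
    -- The complement is the generator with `U = E*` and `K` the compact cylinder; below, the set
    -- itself is the generator with `K = ∅`.
    refine TopologicalSpace.isOpen_generateFrom_of_mem
      ⟨Set.univ, X.finCyl α A, isOpen_univ, X.isCompact_finCyl hA, ?_⟩
    rw [cyl_univ, Set.univ_inter]
  · refine TopologicalSpace.isOpen_generateFrom_of_mem
      ⟨X.finCyl α A, ∅, X.isOpen_finCyl α A, isCompact_empty, ?_⟩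
    rw [cyl_empty, Set.compl_empty, Set.inter_univ]

/-- There is at most one initial segment of each length, and points are closed in the Hausdorff
spaces `Eⁿ`. -/
theorem isClosed_segments (μ : X.BoundaryPath) : IsClosed {x | μ ∈ X.cyl {x}} := by
  refine isClosed_sigma_iff.2 fun n => Set.Subsingleton.isClosed ?_
  rintro p (⟨v, hv, h⟩ | ⟨m, p', h, hp⟩) q (⟨v', hv', h'⟩ | ⟨m', q', h', hq⟩)
  · cases h
    cases h'
    exact congrArg ULift.up (OnePoint.coe_injective (hv.symm.trans hv'))
  · cases h
    cases h'
  · cases h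
    cases h'
  · cases h
    cases h'
    exact Subtype.ext (funext fun j => Option.some.inj ((hp j).symm.trans (hq j)))

/-- In any topology for which the sets `𝒩(α, A)` are clopen, the generating sets of the topology of
the boundary path space are open. -/
theorem isOpen_preimage_cyl_inter {Y : Type*} [TopologicalSpace Y] (f : Y → X.BoundaryPath)
    (hf : ∀ α, ∀ A ∈ X.wordIdeal α, IsClopen (f ⁻¹' X.N α A)) {U K : Set X.FinPaths}
    (hU : IsOpen U) (hK : IsCompact K) : IsOpen (f ⁻¹' (X.cyl U ∩ (X.cyl K)ᶜ)) := by
  rw [Set.preimage_inter]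
  refine IsOpen.inter ?_ ?_
  · refine isOpen_iff_forall_mem_open.2 fun y hy => ?_
    obtain ⟨x, hx, hxy⟩ := X.mem_cyl_iff.1 hy
    obtain ⟨α, A, hA, hxA, hsub⟩ := X.exists_finCyl_subset hU hx
    have h := X.cyl_mono hsub
    have h' := X.cyl_mono (Set.singleton_subset_iff.2 hxA)
    rw [cyl_finCyl] at h h'
    exact ⟨_, Set.preimage_mono h, (hf α A hA).isOpen, h' hxy⟩
  · refine isOpen_iff_forall_mem_open.2 fun y hy => ?_
    -- `K` misses the closed set of initial segments of `f y`, so it is covered by sets `finCyl`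
    -- that miss it too. Finitely many suffice, and the complements of the corresponding `𝒩(α, A)`
    -- meet in a neighbourhood of `y`.
    let I := {i : List L × B // i.2 ∈ X.wordIdeal i.1 ∧ f y ∉ X.N i.1 i.2}
    have hcover : ∀ x ∈ K, ∃ i : I, x ∈ X.finCyl i.1.1 i.1.2 := by
      intro x hx
      have hxU : x ∈ {x | f y ∈ X.cyl {x}}ᶜ := fun h =>
        hy (X.cyl_mono (Set.singleton_subset_iff.2 hx) h)
      obtain ⟨α, A, hA, hxA, hsub⟩ :=
        X.exists_finCyl_subset (X.isClosed_segments (f y)).isOpen_compl hxU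
      refine ⟨⟨(α, A), hA, fun hN => ?_⟩, hxA⟩
      rw [← cyl_finCyl] at hN
      obtain ⟨z, hz, hzy⟩ := X.mem_cyl_iff.1 hN
      exact hsub hz hzy
    obtain ⟨t, ht⟩ := hK.elim_finite_subcover (fun i : I => X.finCyl i.1.1 i.1.2)
      (fun i => X.isOpen_finCyl _ _) fun x hx => Set.mem_iUnion.2 (hcover x hx)
    refine ⟨⋂ i ∈ t, (f ⁻¹' X.N i.1.1 i.1.2)ᶜ, fun z hz hzK => ?_,
      isOpen_biInter_finset fun i _ => (hf _ _ i.2.1).compl.isOpen,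
      Set.mem_iInter₂.2 fun i _ => i.2.2⟩
    obtain ⟨x, hx, hxz⟩ := X.mem_cyl_iff.1 hzK
    obtain ⟨i, hi, hxi⟩ := Set.mem_iUnion₂.1 (ht hx)
    refine Set.mem_iInter₂.1 hz i hi ?_
    rw [Set.mem_preimage, ← cyl_finCyl]
    exact X.cyl_mono (Set.singleton_subset_iff.2 hxi) hxz

end GBDS

/-! ### Characters of the diagonal and the spectrum. -/

namespace GBDS

variable {B : Type u} [GeneralizedBooleanAlgebra B] {L : Type v} {X : GBDS B L}

theorem Rep.map_wordOp {C : Type*} {C' : Type*} [NonUnitalCStarAlgebra C]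
    [NonUnitalCStarAlgebra C'] (ρ : X.Rep C) (ρ' : X.Rep C') (π : C →⋆ₙₐ[ℂ] C')
    (hP : ∀ A, π (ρ.P A) = ρ'.P A) (hS : ∀ a A, π (ρ.S a A) = ρ'.S a A) (α : List L) (A : B) :
    π (ρ.wordOp α A) = ρ'.wordOp α A := by
  have hl : ∀ a A, π (ρ.letterOp a A) = ρ'.letterOp a A := fun a A => by
    unfold Rep.letterOp
    split_ifs
    · exact hS _ _
    · exact map_zero π
  have hp : ∀ α a D A, π (ρ.pathProd a D α A) = ρ'.pathProd a D α A := fun α => by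
    induction α with
    | nil => exact fun a D A => hl a A
    | cons b α ih => exact fun a D A => by rw [Rep.pathProd, Rep.pathProd, map_mul, hl, ih]
  cases α with
  | nil => exact hP A
  | cons a α =>
    rw [Rep.wordOp, Rep.wordOp]
    split_ifs
    · exact hp _ _ _ _
    · exact map_zero π

variable (X)

/-- An induction principle for the diagonal; the generators are self-adjoint, so that stability
under the involution is not needed. -/
theorem diagonal_induction {p : X.diagonal → Prop} (hcl : IsClosed {x | p x})
    (hgen : ∀ α A (hA : A ∈ X.wordIdeal α), p (X.diagProj α A hA)) (hzero : p 0)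
    (hadd : ∀ x y, p x → p y → p (x + y)) (hmul : ∀ x y, p x → p y → p (x * y))
    (hsmul : ∀ (c : ℂ) x, p x → p (c • x)) (x : X.diagonal) : p x := by
  set s : Set X.CStarAlg := {x | ∃ α, ∃ A ∈ X.wordIdeal α, x = X.wordProj α A} with hs
  have hle : NonUnitalStarAlgebra.adjoin ℂ s ≤ X.diagonal :=
    NonUnitalStarSubalgebra.le_topologicalClosure _
  -- The property is carried for `y` and `star y` together, so the step for the involution only
  -- swaps the two.
  have key : ∀ y (hy : y ∈ NonUnitalStarAlgebra.adjoin ℂ s),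
      p ⟨y, hle hy⟩ ∧ p (star ⟨y, hle hy⟩) := by
    intro y hy
    induction hy using NonUnitalStarAlgebra.adjoin_induction with
    | mem y h =>
      obtain ⟨α, A, hA, rfl⟩ := h
      have h := hgen α A hA
      refine ⟨h, ?_⟩
      have : star (X.diagProj α A hA) = X.diagProj α A hA :=
        Subtype.ext (X.univRep.star_wordQ α A)
      exact this.symm ▸ h
    | add y z hy hz h1 h2 =>
      refine ⟨hadd ⟨y, hle hy⟩ ⟨z, hle hz⟩ h1.1 h2.1, ?_⟩
      have : star (⟨y, hle hy⟩ + ⟨z, hle hz⟩ : X.diagonal) =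
        star ⟨y, hle hy⟩ + star ⟨z, hle hz⟩ := star_add _ _
      exact this.symm ▸ hadd _ _ h1.2 h2.2
    | zero =>
      refine ⟨hzero, ?_⟩
      have : star (0 : X.diagonal) = 0 := star_zero _
      exact this.symm ▸ hzero
    | mul y z hy hz h1 h2 =>
      refine ⟨hmul ⟨y, hle hy⟩ ⟨z, hle hz⟩ h1.1 h2.1, ?_⟩
      have : star (⟨y, hle hy⟩ * ⟨z, hle hz⟩ : X.diagonal) =
        star ⟨z, hle hz⟩ * star ⟨y, hle hy⟩ := star_mul _ _
      exact this.symm ▸ hmul _ _ h2.2 h1.2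
    | smul c y hy h1 =>
      refine ⟨hsmul c ⟨y, hle hy⟩ h1.1, ?_⟩
      have : star (c • ⟨y, hle hy⟩ : X.diagonal) = star c • star ⟨y, hle hy⟩ := star_smul _ _
      exact this.symm ▸ hsmul _ _ h1.2
    | star y hy h1 =>
      refine ⟨h1.2, ?_⟩
      have : star (star ⟨y, hle hy⟩ : X.diagonal) = ⟨y, hle hy⟩ := star_star _
      exact this.symm ▸ h1.1
  have hd : x ∈ closure {y : X.diagonal | y.1 ∈ NonUnitalStarAlgebra.adjoin ℂ s} := by
    have hind : Topology.IsInducing (fun y : X.diagonal => (y.1 : X.CStarAlg)) :=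
      Topology.IsInducing.subtypeVal
    rw [hind.closure_eq_preimage_closure_image]
    refine closure_mono ?_ x.2
    intro z hz
    exact ⟨⟨z, hle hz⟩, hz, rfl⟩
  exact closure_minimal (fun y hy => (key y.1 hy).1) hcl hd

theorem diagonal_mul_comm (x y : X.diagonal) : x * y = y * x := by
  induction x using X.diagonal_induction with
  | hcl => exact isClosed_eq (by fun_prop) (by fun_prop)
  | hzero => rw [zero_mul, mul_zero]
  | hadd x x' h h' => rw [add_mul, mul_add, h, h']
  | hmul x x' h h' => rw [mul_assoc, h', ← mul_assoc, h, mul_assoc]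
  | hsmul c x h => rw [smul_mul_assoc, mul_smul_comm, h]
  | hgen α A hA =>
    induction y using X.diagonal_induction with
    | hcl => exact isClosed_eq (by fun_prop) (by fun_prop)
    | hzero => rw [zero_mul, mul_zero]
    | hadd x x' h h' => rw [add_mul, mul_add, h, h']
    | hmul x x' h h' => rw [mul_assoc, ← h', ← mul_assoc, h, mul_assoc]
    | hsmul c x h => rw [smul_mul_assoc, mul_smul_comm, h]
    | hgen β A' hA' => exact Subtype.ext (X.univRep.wordQ_commute hA hA')

variable {X}

theorem character_ext {φ ψ : WeakDual.characterSpace ℂ X.diagonal}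
    (h : ∀ α A (hA : A ∈ X.wordIdeal α), φ (X.diagProj α A hA) = ψ (X.diagProj α A hA)) :
    φ = ψ := by
  refine DFunLike.ext _ _ fun x => ?_
  induction x using X.diagonal_induction with
  | hcl => exact isClosed_eq (map_continuous φ) (map_continuous ψ)
  | hzero => rw [map_zero, map_zero]
  | hadd x x' h h' => rw [map_add, map_add, h, h']
  | hmul x x' h h' => rw [map_mul, map_mul, h, h']
  | hsmul c x h => rw [map_smul, map_smul, h]
  | hgen α A hA => exact h α A hA

theorem character_diagProj_sup (φ : WeakDual.characterSpace ℂ X.diagonal) {α : List L} {A A' : B}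
    (hA : A ∈ X.wordIdeal α) (hA' : A' ∈ X.wordIdeal α) (hS : A ⊔ A' ∈ X.wordIdeal α) :
    φ (X.diagProj α (A ⊔ A') hS) = φ (X.diagProj α A hA) + φ (X.diagProj α A' hA') -
      φ (X.diagProj α A hA) * φ (X.diagProj α A' hA') := by
  have : X.diagProj α (A ⊔ A') hS = X.diagProj α A hA + X.diagProj α A' hA' -
      X.diagProj α A hA * X.diagProj α A' hA' := by
    refine Subtype.ext ((X.univRep.wordQ_sup hA hA').trans ?_)
    rw [inf_comm A A', ← X.univRep.wordQ_mul_wordQ hA hA']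
    rfl
  rw [this, map_sub, map_add, map_mul]

theorem character_diagProj_append (φ : WeakDual.characterSpace ℂ X.diagonal) {α β : List L}
    {A A' : B} (hA : A ∈ X.wordIdeal α) (hA' : A' ∈ X.wordIdeal (α ++ β))
    (h : A' ⊓ X.θWord β A ∈ X.wordIdeal (α ++ β)) :
    φ (X.diagProj (α ++ β) (A' ⊓ X.θWord β A) h) =
      φ (X.diagProj α A hA) * φ (X.diagProj (α ++ β) A' hA') := by
  rw [← map_mul]
  congr 1
  exact Subtype.ext (X.univRep.wordQ_mul_wordQ_append hA hA').symm

theorem character_diagProj_inf (φ : WeakDual.characterSpace ℂ X.diagonal) {α : List L}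
    {A A' : B} (hA : A ∈ X.wordIdeal α) (hA' : A' ∈ X.wordIdeal α)
    (h : A' ⊓ A ∈ X.wordIdeal α) :
    φ (X.diagProj α (A' ⊓ A) h) = φ (X.diagProj α A hA) * φ (X.diagProj α A' hA') := by
  rw [← map_mul]
  congr 1
  exact Subtype.ext (X.univRep.wordQ_mul_wordQ hA hA').symm

theorem character_diagProj_eq_zero_or_one (φ : WeakDual.characterSpace ℂ X.diagonal) {α : List L}
    {A : B} (hA : A ∈ X.wordIdeal α) :
    φ (X.diagProj α A hA) = 0 ∨ φ (X.diagProj α A hA) = 1 := by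
  have h := character_diagProj_inf φ hA hA (X.wordIdeal_mono inf_le_left hA)
  simp only [inf_idem] at h
  have h' : φ (X.diagProj α A hA) * (1 - φ (X.diagProj α A hA)) = 0 := by
    linear_combination h
  exact (mul_eq_zero.1 h').imp id fun h => (sub_eq_zero.1 h).symm

/-- The point of the spectrum given by a character of the diagonal. -/
def specOfCharacter (φ : WeakDual.characterSpace ℂ X.diagonal) : X.Spec where
  mem α := {A | ∃ hA : A ∈ X.wordIdeal α, φ (X.diagProj α A hA) = 1}
  mem_wordIdeal hA := hA.1
  bot_notMem := by
    rintro α ⟨h, h1⟩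
    have : X.diagProj α ⊥ h = 0 := Subtype.ext (X.univRep.wordQ_bot α)
    rw [this, map_zero] at h1
    exact zero_ne_one h1
  upper := by
    rintro α A A' ⟨hA, h1⟩ hA' hle
    refine ⟨hA', ?_⟩
    have h := character_diagProj_inf φ hA' hA (X.wordIdeal_mono inf_le_left hA)
    simp only [inf_eq_left.2 hle] at h
    rw [h1, mul_one] at h
    exact h.symm
  inf := by
    rintro α A A' ⟨hA, h1⟩ ⟨hA', h1'⟩
    refine ⟨X.wordIdeal_mono inf_le_left hA, ?_⟩
    rw [character_diagProj_inf φ hA' hA, h1, h1', mul_one]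
  prime := by
    rintro α A A' ⟨h, h1⟩
    have hA := X.wordIdeal_mono le_sup_left h
    have hA' := X.wordIdeal_mono le_sup_right h
    rw [character_diagProj_sup φ hA hA'] at h1
    rcases character_diagProj_eq_zero_or_one φ hA with h0 | h0
    · rcases character_diagProj_eq_zero_or_one φ hA' with h0' | h0'
      · rw [h0, h0'] at h1
        simp at h1
      · exact Or.inr ⟨hA', h0'⟩
    · exact Or.inl ⟨hA, h0⟩
  letter := by
    rintro α b A A' hA ⟨hA', h1⟩
    have h := X.wordIdeal_mono (inf_le_left : A' ⊓ X.θ b A ≤ A') hA'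
    have h2 := character_diagProj_append φ (β := [b]) hA hA' h
    rw [h1, mul_one] at h2
    exact ⟨fun ⟨_, h3⟩ => ⟨h, h2.trans h3⟩, fun ⟨_, h3⟩ => ⟨hA, h2.symm.trans h3⟩⟩
  letter_unique := by
    rintro α b b' A A' ⟨hA, h1⟩ ⟨hA', h1'⟩
    by_contra hne
    have h : X.diagProj (α ++ [b]) A hA * X.diagProj (α ++ [b']) A' hA' = 0 := by
      refine Subtype.ext (X.univRep.wordQ_mul_wordQ_of_not_prefix hA hA' ?_ ?_)
      · simpa using hne
      · simpa using fun h => hne h.symm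
    have h2 := congrArg φ h
    rw [map_mul, h1, h1', map_zero, mul_one] at h2
    exact one_ne_zero h2
  regular := by
    rintro α A ⟨hA, h1⟩ hreg
    by_contra! hno
    -- Regularity gives finiteness of `Δ` only for nonzero elements, hence the case distinction.
    have hfin : (X.Δ A).Finite := by
      by_cases h0 : A = ⊥
      · subst h0
        convert Set.finite_empty
        refine Set.eq_empty_of_forall_notMem fun a ha => ha (X.θ_bot a)
      · exact (hreg A le_rfl h0).2
    have h : X.diagProj α A hA = ∑ b ∈ hfin.toFinset,
        X.diagProj (α ++ [b]) (X.θ b A) (X.θ_mem_wordIdeal b hA) := by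
      refine Subtype.ext ((X.univRep.wordQ_regular hA hreg (F := hfin.toFinset) (by simp)).trans ?_)
      rw [AddSubmonoidClass.coe_finsetSum]
      rfl
    rw [h, map_sum, Finset.sum_eq_zero] at h1
    · exact zero_ne_one h1
    · intro b _
      exact (character_diagProj_eq_zero_or_one φ _).resolve_right fun h => hno b ⟨_, h⟩
  nonempty := by
    by_contra! hno
    -- A functional that vanishes on all generators would vanish on `D`, but characters are nonzero.
    refine φ.2.1 (ContinuousLinearMap.ext fun x => ?_)
    change φ x = 0
    induction x using X.diagonal_induction with
    | hcl => exact isClosed_eq (map_continuous φ) continuous_const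
    | hzero => rw [map_zero]
    | hadd x x' h h' => rw [map_add, h, h', add_zero]
    | hmul x x' h h' => rw [map_mul, h, zero_mul]
    | hsmul c x h => rw [map_smul, h, smul_zero]
    | hgen α A hA =>
      exact (character_diagProj_eq_zero_or_one φ _).resolve_right fun h => hno α A ⟨_, h⟩

theorem mem_specOfCharacter {φ : WeakDual.characterSpace ℂ X.diagonal} {α : List L} {A : B}
    (hA : A ∈ X.wordIdeal α) :
    A ∈ (specOfCharacter φ).mem α ↔ φ (X.diagProj α A hA) = 1 :=
  ⟨fun h => h.2, fun h => ⟨hA, h⟩⟩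

namespace Spec

variable (X) in
/-- The ⋆-homomorphism of the universal algebra to the operators on `ℓ²` of the spectrum. -/
noncomputable def repHom :
    X.CStarAlg →⋆ₙₐ[ℂ] (lp (fun _ : X.Spec => ℂ) 2 →L[ℂ] lp (fun _ : X.Spec => ℂ) 2) :=
  X.evalRep ⟨_, rep X⟩

theorem repHom_wordProj {α : List L} {A : B} (hA : A ∈ X.wordIdeal α) :
    repHom X (X.wordProj α A) = indOp {w | A ∈ w.mem α} := by
  rw [← wordQ_rep hA, wordProj, Rep.wordQ, map_mul, map_star,
    X.univRep.map_wordOp (rep X) (repHom X) (fun _ => rfl) fun _ _ => rfl]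

variable (w : X.Spec)

open Classical in
/-- The basis vector of `ℓ²` at a point of the spectrum. -/
noncomputable def basisVec : lp (fun _ : X.Spec => ℂ) 2 := lp.single 2 w 1

theorem basisVec_self : w.basisVec w = 1 := by
  classical
  exact lp.single_apply_self ..

theorem norm_basisVec : ‖w.basisVec‖ = 1 := by
  classical
  exact (lp.norm_single (by norm_num) _ _).trans norm_one

/-- The functional `x ↦ (x z)(w)` on the diagonal. -/
noncomputable def vecFunctional (z : lp (fun _ : X.Spec => ℂ) 2) : X.diagonal →L[ℂ] ℂ :=
  LinearMap.mkContinuous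
    { toFun := fun x => repHom X x z w
      map_add' := fun x y => by
        rw [NonUnitalStarSubalgebra.coe_add, map_add]; rfl
      map_smul' := fun c x => by
        rw [NonUnitalStarSubalgebra.coe_smul, map_smul]; rfl }
    ‖z‖ fun x => by
      refine (lp.norm_apply_le_norm (by norm_num) _ w).trans ?_
      refine (ContinuousLinearMap.le_opNorm _ _).trans ?_
      rw [mul_comm]
      exact mul_le_mul_of_nonneg_left (NonUnitalStarAlgHom.norm_apply_le (repHom X) x.1)
        (norm_nonneg z)

theorem vecFunctional_apply (z : lp (fun _ : X.Spec => ℂ) 2) (x : X.diagonal) :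
    w.vecFunctional z x = repHom X x z w := rfl

theorem vecFunctional_mul (z : lp (fun _ : X.Spec => ℂ) 2) (x y : X.diagonal) :
    w.vecFunctional z (x * y) = w.vecFunctional (repHom X y z) x := by
  rw [vecFunctional_apply, NonUnitalStarSubalgebra.coe_mul, map_mul]
  rfl

/-- Multiplication operators satisfy `(x z)(w) = (x δ_w)(w) z(w)`. The vector `z` stays arbitrary
because the product step uses the formula at `x' z` and at `x' δ_w`. -/
theorem vecFunctional_eq (x : X.diagonal) (z : lp (fun _ : X.Spec => ℂ) 2) :
    w.vecFunctional z x = w.vecFunctional w.basisVec x * z w := by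
  induction x using X.diagonal_induction generalizing z with
  | hcl =>
    simpa only [Set.ofPred_forall] using isClosed_iInter fun z =>
      isClosed_eq (f := fun x => w.vecFunctional z x)
        (g := fun x => w.vecFunctional w.basisVec x * z w) (by fun_prop) (by fun_prop)
  | hzero => rw [map_zero, map_zero, zero_mul]
  | hadd x x' h h' => rw [map_add, map_add, h, h', add_mul]
  | hmul x x' h h' =>
    rw [vecFunctional_mul, vecFunctional_mul, h, h (repHom X x' w.basisVec),
      ← vecFunctional_apply, ← vecFunctional_apply, h', mul_assoc]
  | hsmul c x h => rw [map_smul, map_smul, h, smul_mul_assoc]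
  | hgen α A hA =>
    change repHom X (X.wordProj α A) z w = repHom X (X.wordProj α A) w.basisVec w * z w
    rw [repHom_wordProj hA]
    by_cases hw : w ∈ {w : X.Spec | A ∈ w.mem α}
    · rw [indOp_apply_of_mem hw, indOp_apply_of_mem hw, basisVec_self, one_mul]
    · rw [indOp_apply_of_notMem hw, indOp_apply_of_notMem hw, zero_mul]

open Classical in
theorem vecFunctional_diagProj {α : List L} {A : B} (hA : A ∈ X.wordIdeal α) :
    w.vecFunctional w.basisVec (X.diagProj α A hA) = if A ∈ w.mem α then 1 else 0 := by
  change repHom X (X.wordProj α A) w.basisVec w = _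
  rw [repHom_wordProj hA]
  split_ifs with h
  · rw [indOp_apply_of_mem (s := {w : X.Spec | A ∈ w.mem α}) h, basisVec_self]
  · rw [indOp_apply_of_notMem (s := {w : X.Spec | A ∈ w.mem α}) h]

/-- The character of the diagonal given by a point of the spectrum: a vector state of the
representation on `ℓ²` of the spectrum. -/
noncomputable def character : WeakDual.characterSpace ℂ X.diagonal :=
  ⟨StrongDual.toWeakDual (w.vecFunctional w.basisVec), by
    constructor
    · intro h
      obtain ⟨α, A, hA⟩ := w.nonempty
      have h1 := w.vecFunctional_diagProj (w.mem_wordIdeal hA)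
      rw [if_pos hA] at h1
      have h2 : w.vecFunctional w.basisVec (X.diagProj α A (w.mem_wordIdeal hA)) = 0 :=
        DFunLike.congr_fun h (X.diagProj α A (w.mem_wordIdeal hA))
      exact one_ne_zero (h1.symm.trans h2)
    · intro x y
      change w.vecFunctional w.basisVec (x * y) =
        w.vecFunctional w.basisVec x * w.vecFunctional w.basisVec y
      rw [vecFunctional_mul, vecFunctional_eq, vecFunctional_apply]
      rfl⟩

open Classical in
theorem character_diagProj {α : List L} {A : B} (hA : A ∈ X.wordIdeal α) :
    w.character (X.diagProj α A hA) = if A ∈ w.mem α then 1 else 0 :=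
  w.vecFunctional_diagProj hA

variable (X) in
/-- The spectrum is the character space of the diagonal. -/
noncomputable def equivCharacterSpace : X.Spec ≃ WeakDual.characterSpace ℂ X.diagonal where
  toFun := character
  invFun := specOfCharacter
  left_inv w := by
    classical
    refine Spec.ext (funext fun α => Set.ext fun A => ?_)
    constructor
    · intro hA
      have h := hA.2
      rw [character_diagProj] at h
      by_contra hn
      rw [if_neg hn] at h
      exact zero_ne_one h
    · intro hA
      exact ⟨w.mem_wordIdeal hA, by rw [character_diagProj, if_pos hA]⟩
  right_inv φ := by
    classical
    refine character_ext fun α A hA => ?_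
    rw [character_diagProj]
    split_ifs with h
    · exact ((mem_specOfCharacter hA).1 h).symm
    · exact ((character_diagProj_eq_zero_or_one φ hA).resolve_right fun h1 =>
        h ((mem_specOfCharacter hA).2 h1)).symm

end Spec

end GBDS

/-! ### Gelfand duality without unit, through the unitization. -/

section NonUnitalGelfand

open WeakDual Unitization

section Eval

variable {R : Type*} [NonUnitalNonAssocSemiring R] [TopologicalSpace R] [Module ℂ R]
  {Y : Type*} [TopologicalSpace Y]

theorem continuous_character_eval (b : R) : Continuous fun φ : characterSpace ℂ R => φ b :=
  (WeakDual.eval_continuous b).comp continuous_subtype_val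

theorem continuous_character_of_eval {f : Y → characterSpace ℂ R}
    (h : ∀ b, Continuous fun y => f y b) : Continuous f :=
  continuous_induced_rng.2 (WeakDual.continuous_of_continuous_eval h)

end Eval

variable {A : Type*} [NonUnitalCommCStarAlgebra A]

/-- The extension of a character to the unitization. -/
noncomputable def characterUnitization (φ : characterSpace ℂ A) :
    characterSpace ℂ (Unitization ℂ A) :=
  CharacterSpace.equivAlgHom.symm (Unitization.lift (CharacterSpace.toNonUnitalAlgHom φ))

theorem characterUnitization_apply (φ : characterSpace ℂ A) (x : Unitization ℂ A) :
    characterUnitization φ x = x.fst + φ x.snd := rfl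

theorem characterUnitization_inr (φ : characterSpace ℂ A) (a : A) :
    characterUnitization φ (a : Unitization ℂ A) = φ a := by
  rw [characterUnitization_apply, fst_inr, snd_inr, zero_add]

theorem continuous_characterUnitization :
    Continuous (characterUnitization : characterSpace ℂ A → characterSpace ℂ (Unitization ℂ A)) :=
  continuous_character_of_eval fun x => continuous_const.add (continuous_character_eval x.snd)

/-- The restriction of a character of the unitization. -/
noncomputable def characterRestrict (χ : characterSpace ℂ (Unitization ℂ A))
    (h : ∃ a : A, χ (a : Unitization ℂ A) ≠ 0) : characterSpace ℂ A :=
  ⟨StrongDual.toWeakDual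
    { toFun := fun a => χ (a : Unitization ℂ A)
      map_add' := fun a b => by rw [inr_add, map_add]
      map_smul' := fun c a => by rw [inr_smul, map_smul]; rfl
      cont := (map_continuous χ).comp (Unitization.isometry_inr (𝕜 := ℂ)).continuous },
    fun h0 => h.elim fun a ha => ha (DFunLike.congr_fun h0 a), fun a b => by
      change χ ((a * b : A) : Unitization ℂ A) = χ (a : Unitization ℂ A) * χ (b : Unitization ℂ A)
      rw [inr_mul, map_mul]⟩

theorem characterRestrict_apply (χ : characterSpace ℂ (Unitization ℂ A))
    (h : ∃ a : A, χ (a : Unitization ℂ A) ≠ 0) (a : A) :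
    characterRestrict χ h a = χ (a : Unitization ℂ A) := rfl

theorem characterUnitization_characterRestrict (χ : characterSpace ℂ (Unitization ℂ A))
    (h : ∃ a : A, χ (a : Unitization ℂ A) ≠ 0) :
    characterUnitization (characterRestrict χ h) = χ := by
  refine DFunLike.ext _ _ fun x => ?_
  rw [characterUnitization_apply, characterRestrict_apply]
  conv_rhs => rw [← inl_fst_add_inr_snd_eq x, map_add]
  congr 1
  exact (AlgHomClass.commutes χ x.fst).symm

theorem exists_characterUnitization_ne_zero (φ : characterSpace ℂ A) :
    ∃ a : A, characterUnitization φ (a : Unitization ℂ A) ≠ 0 := by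
  by_contra! h
  refine φ.2.1 (ContinuousLinearMap.ext fun a => ?_)
  have := h a
  rwa [characterUnitization_inr] at this

theorem characterRestrict_characterUnitization (φ : characterSpace ℂ A) :
    characterRestrict (characterUnitization φ) (exists_characterUnitization_ne_zero φ) = φ :=
  DFunLike.ext _ _ fun a => characterUnitization_inr φ a

/-- This set is the continuous image, under restriction, of a closed subset of the compact character
space of the unitization. It makes Gelfand transforms vanish at infinity. -/
theorem isCompact_le_norm_character (a : A) {ε : ℝ} (hε : 0 < ε) :
    IsCompact {φ : characterSpace ℂ A | ε ≤ ‖φ a‖} := by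
  set K : Set (characterSpace ℂ (Unitization ℂ A)) := {χ | ε ≤ ‖χ (a : Unitization ℂ A)‖} with hK
  have hKc : IsCompact K :=
    (isClosed_le continuous_const (continuous_character_eval _).norm).isCompact
  have hne : ∀ χ : K, ∃ a : A, χ.1 (a : Unitization ℂ A) ≠ 0 := fun χ =>
    ⟨a, norm_pos_iff.1 (hε.trans_le χ.2)⟩
  have hcont : Continuous fun χ : K => characterRestrict χ.1 (hne χ) :=
    continuous_character_of_eval fun b =>
      (continuous_character_eval (b : Unitization ℂ A)).comp continuous_subtype_val
  have : CompactSpace K := isCompact_iff_compactSpace.1 hKc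
  convert isCompact_range hcont
  ext φ
  constructor
  · intro h
    refine ⟨⟨characterUnitization φ, ?_⟩, characterRestrict_characterUnitization φ⟩
    rw [hK, Set.mem_ofPred_eq, characterUnitization_inr]
    exact h
  · rintro ⟨χ, rfl⟩
    exact χ.2

theorem character_map_star (φ : characterSpace ℂ A) (a : A) : φ (star a) = star (φ a) := by
  rw [← characterUnitization_inr φ (star a), ← characterUnitization_inr φ a, inr_star, map_star]

/-- The Gelfand transform of an element of a commutative C⋆-algebra without unit. -/
noncomputable def nonUnitalGelfand (a : A) : C₀(characterSpace ℂ A, ℂ) where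
  toFun φ := φ a
  continuous_toFun := continuous_character_eval a
  zero_at_infty' := by
    rw [Metric.tendsto_nhds]
    intro ε hε
    filter_upwards [(isCompact_le_norm_character a hε).compl_mem_cocompact] with φ hφ
    rw [dist_zero_right]
    exact not_le.1 hφ

/-- A character of the unitization either restricts to a character of `A` or kills `A`; in both
cases it takes equal values at the two elements. -/
theorem nonUnitalGelfand_injective :
    Function.Injective (nonUnitalGelfand : A → C₀(characterSpace ℂ A, ℂ)) := by
  intro a b hab
  refine Unitization.inr_injective (R := ℂ)
    ((gelfandStarTransform (Unitization ℂ A)).injective (ContinuousMap.ext fun χ => ?_))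
  change χ (a : Unitization ℂ A) = χ (b : Unitization ℂ A)
  by_cases h : ∃ a : A, χ (a : Unitization ℂ A) ≠ 0
  · exact DFunLike.congr_fun hab (characterRestrict χ h)
  · push Not at h
    rw [h, h]

-- Restriction is continuous on the open set where some `a` has nonzero value. At a character
-- killing `A`, `f` is small outside a compact `K`, whose image in the unitization's character space
-- is closed and avoids that character.
open Classical in
theorem continuous_extend_characterUnitization (f : C₀(characterSpace ℂ A, ℂ)) :
    Continuous fun χ : characterSpace ℂ (Unitization ℂ A) =>
      if h : ∃ a : A, χ (a : Unitization ℂ A) ≠ 0 then f (characterRestrict χ h) else 0 := by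
  refine continuous_iff_continuousAt.2 fun χ => ?_
  by_cases h : ∃ a : A, χ (a : Unitization ℂ A) ≠ 0
  · obtain ⟨a, ha⟩ := h
    set U : Set (characterSpace ℂ (Unitization ℂ A)) := {χ | χ (a : Unitization ℂ A) ≠ 0} with hU
    have hUo : IsOpen U := isOpen_ne_fun (continuous_character_eval _) continuous_const
    refine ContinuousOn.continuousAt (s := U) ?_ (hUo.mem_nhds ha)
    rw [continuousOn_iff_continuous_domRestrict]
    have hcont : Continuous fun χ : U => characterRestrict χ.1 ⟨a, χ.2⟩ :=
      continuous_character_of_eval fun b =>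
        (continuous_character_eval (b : Unitization ℂ A)).comp continuous_subtype_val
    refine ((map_continuous f).comp hcont).congr fun χ => ?_
    rw [Set.domRestrict_apply, dif_pos ⟨a, χ.2⟩]
    rfl
  · rw [ContinuousAt, dif_neg h, Metric.tendsto_nhds]
    intro ε hε
    have hf := (Metric.tendsto_nhds.1 (zero_at_infty f)) ε hε
    obtain ⟨K, hK, hsub⟩ := Filter.mem_cocompact.1 hf
    have hKc : IsCompact (characterUnitization '' K) := hK.image continuous_characterUnitization
    have hmem : χ ∉ characterUnitization '' K := by
      rintro ⟨φ, -, rfl⟩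
      exact h (exists_characterUnitization_ne_zero φ)
    filter_upwards [hKc.isClosed.isOpen_compl.mem_nhds hmem] with χ' hχ'
    split_ifs with h'
    · exact hsub fun hk => hχ' ⟨_, hk, characterUnitization_characterRestrict χ' h'⟩
    · rwa [dist_self]

theorem nonUnitalGelfand_surjective :
    Function.Surjective (nonUnitalGelfand : A → C₀(characterSpace ℂ A, ℂ)) := by
  classical
  intro f
  set g : C(characterSpace ℂ (Unitization ℂ A), ℂ) :=
    ⟨_, continuous_extend_characterUnitization f⟩ with hg
  obtain ⟨y, hy⟩ := (gelfandStarTransform (Unitization ℂ A)).surjective g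
  have hy' : ∀ χ : characterSpace ℂ (Unitization ℂ A), χ y =
      if h : ∃ a : A, χ (a : Unitization ℂ A) ≠ 0 then f (characterRestrict χ h) else 0 :=
    fun χ => DFunLike.congr_fun hy χ
  -- The extended function is 0 at the character `Unitization.fstHom`, whose value at `y` is the
  -- scalar part; so `y` comes from `A`.
  have h0 : y.fst = 0 := by
    have h := hy' (CharacterSpace.equivAlgHom.symm (Unitization.fstHom ℂ A))
    rw [dif_neg] at h
    · exact h
    · push Not
      intro a
      exact fst_inr ℂ a
  refine ⟨y.snd, DFunLike.ext _ _ fun φ => ?_⟩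
  have h := hy' (characterUnitization φ)
  rw [dif_pos (exists_characterUnitization_ne_zero φ), characterRestrict_characterUnitization,
    characterUnitization_apply, h0, zero_add] at h
  exact h

/-- Gelfand duality for commutative C⋆-algebras without unit, along a homeomorphism with the
character space. -/
theorem exists_starAlgEquiv_zeroAtInfty {Y : Type*} [TopologicalSpace Y]
    (Φ : Y ≃ₜ characterSpace ℂ A) :
    ∃ Ψ : A ≃⋆ₐ[ℂ] C₀(Y, ℂ), ∀ (x : A) (y : Y), Ψ x y = Φ y x := by
  let G : A → C₀(Y, ℂ) := fun a => (nonUnitalGelfand a).comp Φ.toCocompactMap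
  have hG : ∀ a y, G a y = Φ y a := fun _ _ => rfl
  have hbij : Function.Bijective G := by
    constructor
    · intro a b hab
      refine nonUnitalGelfand_injective (DFunLike.ext _ _ fun φ => ?_)
      have := DFunLike.congr_fun hab (Φ.symm φ)
      rwa [hG, hG, Φ.apply_symm_apply] at this
    · intro f
      obtain ⟨a, ha⟩ := nonUnitalGelfand_surjective (A := A) (f.comp Φ.symm.toCocompactMap)
      refine ⟨a, DFunLike.ext _ _ fun y => ?_⟩
      have h := DFunLike.congr_fun ha (Φ y)
      refine h.trans ?_
      change f (Φ.symm (Φ y)) = f y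
      rw [Φ.symm_apply_apply]
  let e := Equiv.ofBijective G hbij
  refine ⟨{ e with
    map_mul' := fun a b => DFunLike.ext _ _ fun y => map_mul (Φ y) a b
    map_add' := fun a b => DFunLike.ext _ _ fun y => map_add (Φ y) a b
    map_star' := fun a => DFunLike.ext _ _ fun y => character_map_star (Φ y) a
    map_smul' := fun c a => DFunLike.ext _ _ fun y => map_smul (Φ y) c a }, fun _ _ => rfl⟩

end NonUnitalGelfand

/-! ### The homeomorphism and the final theorem. -/

namespace GBDS
variable {B : Type u} [GeneralizedBooleanAlgebra B] {L : Type v} (X : GBDS B L)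

theorem exists_diagonal_starAlgEquiv {Y : Type*} [TopologicalSpace Y]
    (Φ : Y ≃ₜ WeakDual.characterSpace ℂ X.diagonal) :
    ∃ Ψ : X.diagonal ≃⋆ₐ[ℂ] C₀(Y, ℂ), ∀ (x : X.diagonal) (y : Y), Ψ x y = Φ y x := by
  let _ : NonUnitalCommCStarAlgebra X.diagonal :=
    { NonUnitalStarSubalgebra.nonUnitalCStarAlgebra X.diagonal
        (h_closed := NonUnitalStarSubalgebra.isClosed_topologicalClosure _) with
      mul_comm := X.diagonal_mul_comm }
  exact exists_starAlgEquiv_zeroAtInfty Φ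
end GBDS

namespace GBDS

variable {B : Type u} [GeneralizedBooleanAlgebra B] {L : Type v} (X : GBDS B L)

/-- The bound comes from a unit vector and is uniform in `w`, so continuity in the path survives
norm limits in `D`. -/
theorem Spec.norm_character_le {X : GBDS B L} (w : X.Spec) (x : X.diagonal) :
    ‖w.character x‖ ≤ ‖x‖ := by
  have h : ‖w.vecFunctional w.basisVec x‖ ≤ ‖w.basisVec‖ * ‖x‖ :=
    (LinearMap.mkContinuous_norm_le _ (norm_nonneg _) _ |> ContinuousLinearMap.le_of_opNorm_le _) x
  rwa [norm_basisVec, one_mul] at h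

/-- The character of a boundary path. -/
noncomputable def pathEquivCharacterSpace :
    X.BoundaryPath ≃ WeakDual.characterSpace ℂ X.diagonal :=
  X.pathEquivSpec.trans (Spec.equivCharacterSpace X)

open Classical in
theorem pathEquivCharacterSpace_diagProj (μ : X.BoundaryPath) {α : List L} {A : B}
    (hA : A ∈ X.wordIdeal α) :
    X.pathEquivCharacterSpace μ (X.diagProj α A hA) = if μ ∈ X.N α A then 1 else 0 := by
  have h := (specOfPath μ).character_diagProj hA
  simp only [mem_specOfPath hA] at h
  exact h

theorem continuous_pathEquivCharacterSpace : Continuous X.pathEquivCharacterSpace := by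
  classical
  refine continuous_character_of_eval fun x => ?_
  induction x using X.diagonal_induction with
  | hcl =>
    refine isClosed_of_closure_subset fun x hx => ?_
    refine continuous_of_uniform_approx_of_continuous fun u hu => ?_
    obtain ⟨ε, hε, hu⟩ := Metric.mem_uniformity_dist.1 hu
    obtain ⟨y, hy, hxy⟩ := Metric.mem_closure_iff.1 hx ε hε
    refine ⟨_, hy, fun μ => hu ?_⟩
    rw [dist_eq_norm, ← map_sub]
    rw [dist_eq_norm] at hxy
    exact (Spec.norm_character_le (specOfPath μ) (x - y)).trans_lt hxy
  | hgen α A hA =>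
    simp only [pathEquivCharacterSpace_diagProj]
    refine Continuous.if (fun μ hμ => ?_) continuous_const continuous_const
    -- A clopen set has empty frontier, so there is nothing to check there.
    exact absurd hμ ((X.isClopen_N hA).frontier_eq ▸ Set.notMem_empty μ)
  | hzero => simpa only [map_zero] using continuous_const
  | hadd x x' h h' => simp only [map_add]; exact h.add h'
  | hmul x x' h h' => simp only [map_mul]; exact h.mul h'
  | hsmul c x h => simp only [map_smul]; exact h.const_smul c

/-- The values are 0 or 1, so "equal to 1" is closed and the same as "nonzero", which is open. -/
theorem isClopen_preimage_N {α : List L} {A : B} (hA : A ∈ X.wordIdeal α) :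
    IsClopen (X.pathEquivCharacterSpace.symm ⁻¹' X.N α A) := by
  classical
  have h : ∀ φ, φ ∈ X.pathEquivCharacterSpace.symm ⁻¹' X.N α A ↔ φ (X.diagProj α A hA) = 1 := by
    intro φ
    have := X.pathEquivCharacterSpace_diagProj (X.pathEquivCharacterSpace.symm φ) hA
    rw [Equiv.apply_symm_apply] at this
    rw [this, Set.mem_preimage]
    simp
  have h1 : X.pathEquivCharacterSpace.symm ⁻¹' X.N α A = {φ | φ (X.diagProj α A hA) = 1} :=
    Set.ext h
  have h0 : X.pathEquivCharacterSpace.symm ⁻¹' X.N α A = {φ | φ (X.diagProj α A hA) ≠ 0} := by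
    ext φ
    rw [h, Set.mem_ofPred_eq]
    refine ⟨fun h => h ▸ one_ne_zero, (character_diagProj_eq_zero_or_one φ hA).resolve_left⟩
  constructor
  · rw [h1]
    exact isClosed_eq (continuous_character_eval _) continuous_const
  · rw [h0]
    exact isOpen_ne_fun (continuous_character_eval _) continuous_const

/-- The boundary path space is homeomorphic to the character space of the diagonal. -/
noncomputable def pathHomeomorph : X.BoundaryPath ≃ₜ WeakDual.characterSpace ℂ X.diagonal where
  toEquiv := X.pathEquivCharacterSpace
  continuous_toFun := X.continuous_pathEquivCharacterSpace
  continuous_invFun := by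
    refine continuous_generateFrom_iff.2 ?_
    rintro _ ⟨U, K, hU, hK, rfl⟩
    exact X.isOpen_preimage_cyl_inter _ (fun α A hA => X.isClopen_preimage_N hA) hU hK

end GBDS

open Classical in
theorem mainTheorem3 {B : Type u} [GeneralizedBooleanAlgebra B] {L : Type v} (X : GBDS B L) :
    (∀ μ : X.BoundaryPath, ∃! φ : WeakDual.characterSpace ℂ X.diagonal,
      ∀ (α : List L) (A : B) (hA : A ∈ X.wordIdeal α),
        φ (X.diagProj α A hA) = if μ ∈ X.N α A then 1 else 0) ∧
    ∃ Φ : X.BoundaryPath ≃ₜ WeakDual.characterSpace ℂ X.diagonal,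
      (∀ (μ : X.BoundaryPath) (α : List L) (A : B) (hA : A ∈ X.wordIdeal α),
        Φ μ (X.diagProj α A hA) = if μ ∈ X.N α A then 1 else 0) ∧
      ∃ Ψ : X.diagonal ≃⋆ₐ[ℂ] C₀(X.BoundaryPath, ℂ),
        ∀ (x : X.diagonal) (μ : X.BoundaryPath), Ψ x μ = Φ μ x := by
  have hΦ : ∀ (μ : X.BoundaryPath) (α : List L) (A : B) (hA : A ∈ X.wordIdeal α),
      X.pathHomeomorph μ (X.diagProj α A hA) = if μ ∈ X.N α A then 1 else 0 :=
    fun μ _ _ hA => X.pathEquivCharacterSpace_diagProj μ hA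
  refine ⟨fun μ => ⟨X.pathHomeomorph μ, hΦ μ, fun φ hφ => ?_⟩, X.pathHomeomorph, hΦ,
    X.exists_diagonal_starAlgEquiv _⟩
  exact GBDS.character_ext fun α A hA => (hφ α A hA).trans (hΦ μ α A hA).symm
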